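/- **Setting.** Let $n \ge 1$. Let $P_n$ be the set of matchings on $[2n]=\{1,\dots,2n\}$, regarded as fixed-point-free involutions $\tau$ of $[2n]$. *Medial graphs.* A medial graph is a finite graph embedded in a closed disk with boundary vertices $1,\dots,2n$ in cyclic order on the boundary circle, each of degree one, all other vertices (the crossings) lying in the interior and being four-valent. Its wires are the curves obtained by following edges and going straight through every crossing. A medial graph is lensless if every wire begins and ends on the boundary, no wire intersects itself, and no two distinct wires meet in two different crossings. It represents $\tau\in P_n$ if its wires join $i$ to $\tau(i)$ for every $i \in [2n]$. The crossing number $c(\tau)$ is the number of crossings of a lensless medial graph representing $\tau$; such a graph exists, and the number does not depend on its choice. *The uncrossing order.* Uncrossing a crossing of a medial graph means removing this four-valent vertex and joining the four edge ends there in pairs of cyclically adjacent ends, in one of the two possible ways. The uncrossing order on $P_n$ is the reflexive and transitive closure of the relations $\tau' \le \tau$ for which some lensless medial graph representing $\tau$ can be uncrossed at one crossing to give a lensless medial graph representing $\tau'$. *Affine permutations.* For $N \ge 1$ and $k\in\mathbb Z$, an affine permutation of type $(k,N)$ is a bijection $f:\mathbb Z\to\mathbb Z$ with $f(i+N)=f(i)+N$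 for all $i$ and $\sum_{i=1}^N (f(i)-i)=kN$. It is bounded if $i\le f(i)\le i+N$ for all $i$. Its length $\ell(f)$ is the number of pairs $(i,j)\in\mathbb Z^2$ with $1\le i\le N$, $i<j$ and $f(i)>f(j)$. For $a\not\equiv b \pmod N$ let $t_{a,b}$ be the bijection of $\mathbb Z$ that exchanges $a+rN$ and $b+rN$ for every $r\in\mathbb Z$ and fixes all other integers. Bruhat order on affine permutations of type $(k,N)$ is the reflexive and transitive closure of the relations $f \le t_{a,b}f$ with $\ell(f)<\ell(t_{a,b}f)$. Bounded affine permutations carry the induced order. For $\tau\in P_n$ let $g_\tau$ be the bounded affine permutation of type $(n,2n)$ determined by $$g_\tau(i)=\begin{cases}\tau(i) & \text{if } i<\tau(i),\\ \tau(i)+2n & \text{if } i>\tau(i),\end{cases}\qquad 1\le i\le 2n.$$ **Theorem.** For every $\tau\in P_n$, $$\ell(g_\tau)=2\left(\binom n2-c(\tau)\right).$$ The uncrossing order is a partial order on $P_n$, and the map $\tau\mapsto g_\tau$ identifies $P_n$ with an induced subposet of the dual of the Bruhat order on bounded affine permutations of type $(n,2n)$: it is injective, and for all $\tau,\tau'\in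 P_n$, $$g_\tau\le g_{\tau'}\text{ in Bruhat order} \iff \tau'\le\tau \text{ in } P_n.$$ -/

import Mathlib

/-! ### Matchings on `2n` points -/

/-- A matching (medial pairing) on the points `1, …, 2n`, as a fixed-point free involution.
The element `p : Fin (2 * n)` stands for the point with label `p + 1`. -/
@[ext]
structure Matching (n : ℕ) where
  toFun : Fin (2 * n) → Fin (2 * n)
  invol : ∀ p, toFun (toFun p) = p
  ne_self : ∀ p, toFun p ≠ p

instance (n : ℕ) : CoeFun (Matching n) (fun _ => Fin (2 * n) → Fin (2 * n)) := ⟨Matching.toFun⟩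

/-! ### Medial graphs in the disk

An embedded graph is described, up to homeomorphism, by its darts (half-edges), the rotation
around each vertex, and the involution that exchanges the two darts of each edge. The part of
the plane outside the disk is contracted to one extra vertex, around which the boundary points
`1, …, 2n` follow each other in cyclic order; the disk becomes a sphere. -/

/-- The darts: four at each crossing `v`, in cyclic order, and one at each boundary point. -/
abbrev Dart (n : ℕ) (V : Type) : Type := (V × ZMod 4) ⊕ Fin (2 * n)

/-- The rotation: `(v, k) ↦ (v, k + 1)` at a crossing, `i ↦ i + 1` cyclically on the boundary. -/
def dartRotation (n : ℕ) (V : Type) : Equiv.Perm (Dart n V) :=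
  Equiv.sumCongr (Equiv.prodCongr (Equiv.refl V) (Equiv.addRight (1 : ZMod 4))) (finRotate (2 * n))

/-- The number of orbits (cycles, including fixed points) of a permutation of a finite set. -/
noncomputable def numOrbits {D : Type} (f : Equiv.Perm D) : ℕ :=
  Nat.card (Quot fun x y : D => y = f x)

/-- The number of orbits of the group generated by two permutations of a finite set. -/
noncomputable def numOrbits₂ {D : Type} (f g : Equiv.Perm D) : ℕ :=
  Nat.card (Quot fun x y : D => y = f x ∨ y = g x)

/-- A medial graph: a graph embedded in the disk, with `2n` boundary vertices of degree one, all
other vertices (the crossings) being four-valent. `edge` exchanges the two darts of an edge; the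
cycles of the rotation, of `edge`, and of their product are the vertices, the edges and the faces.
`planar` is Euler's formula: each connected component has genus zero. -/
structure MedialGraph (n : ℕ) where
  V : Type
  finite : Finite V
  edge : Equiv.Perm (Dart n V)
  edge_invol : ∀ x, edge (edge x) = x
  edge_ne_self : ∀ x, edge x ≠ x
  planar : numOrbits (dartRotation n V) + numOrbits (edge.trans (dartRotation n V)) =
    numOrbits edge + 2 * numOrbits₂ (dartRotation n V) edge

namespace MedialGraph

variable {n : ℕ}

/-- The number of crossings. -/
noncomputable def crossings (G : MedialGraph n) : ℕ := Nat.card G.V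

/-- Elementary moves along a wire: from one end of an edge to the other, and straight through a
crossing. -/
def WireStep (G : MedialGraph n) (x y : Dart n G.V) : Prop :=
  y = G.edge x ∨ ∃ (v : G.V) (k : ZMod 4), x = Sum.inl (v, k) ∧ y = Sum.inl (v, k + 2)

/-- The wires (strands): classes of darts under moving along edges and straight through
crossings. -/
def Wire (G : MedialGraph n) : Type := Quot G.WireStep

/-- The wire that contains a given dart. -/
def wire (G : MedialGraph n) (x : Dart n G.V) : G.Wire := Quot.mk _ x

/-- The wire `p` passes through the crossing `v`. -/
def OnWire (G : MedialGraph n) (v : G.V) (p : G.Wire) : Prop :=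
  ∃ k : ZMod 4, G.wire (Sum.inl (v, k)) = p

/-- A medial graph is lensless if every wire runs between boundary points, no wire intersects
itself, and no two distinct wires bound a lens, that is, meet in two different crossings. -/
structure Lensless (G : MedialGraph n) : Prop where
  ends : ∀ x, ∃ i : Fin (2 * n), G.wire x = G.wire (Sum.inr i)
  no_self_crossing : ∀ (v : G.V) (k : ZMod 4),
    G.wire (Sum.inl (v, k)) ≠ G.wire (Sum.inl (v, k + 1))
  no_lens : ∀ (p q : G.Wire) (v w : G.V), p ≠ q →
    G.OnWire v p → G.OnWire v q → G.OnWire w p → G.OnWire w q → v = w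

/-- `τ` is the pairing of the boundary points by the wires of `G`. -/
def Represents (G : MedialGraph n) (τ : Matching n) : Prop :=
  ∀ i j : Fin (2 * n), i ≠ j → (G.wire (Sum.inr i) = G.wire (Sum.inr j) ↔ τ i = j)

/-- When the crossing `v` is resolved by joining its ends `k` to `k + 1` and `k + 2` to `k + 3`,
this is the end to which the end `l` is joined. -/
def joinedEnd (k l : ZMod 4) : ZMod 4 := if l = k ∨ l = k + 2 then l + 1 else l - 1

open Classical in
/-- Where an edge that arrives at the dart `y` ends after the crossing `v` has been resolved as in
`joinedEnd`: if `y` is not at `v` it ends at `y`, otherwise it goes on along the edge at the end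
that `y` is joined to. -/
noncomputable def resolve (G : MedialGraph n) (v : G.V) (k : ZMod 4) : Dart n G.V → Dart n G.V
  | Sum.inl (w, l) => if w = v then G.edge (Sum.inl (v, joinedEnd k l)) else Sum.inl (w, l)
  | Sum.inr i => Sum.inr i

/-- `G'` is obtained from `G` by uncrossing one crossing `v`, in either of the two ways (given by
`k = 0` and `k = 1`; `k = 2`, `k = 3` repeat them). The other crossings, their rotations and the
boundary points are kept. -/
def Uncrosses (G G' : MedialGraph n) : Prop :=
  ∃ (v : G.V) (k : ZMod 4) (e : G'.V ≃ {w : G.V // w ≠ v}),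
    ∀ x : Dart n G'.V,
      Sum.map (Prod.map (fun w => (e w : G.V)) id) id (G'.edge x) =
        G.resolve v k (G.edge (Sum.map (Prod.map (fun w => (e w : G.V)) id) id x))

end MedialGraph

namespace Matching

variable {n : ℕ}

/-- `c` is the crossing number of `τ`: lensless medial graphs representing `τ` exist, and they all
have `c` crossings. -/
def IsCrossingNumber (τ : Matching n) (c : ℕ) : Prop :=
  (∃ G : MedialGraph n, G.Lensless ∧ G.Represents τ) ∧
    ∀ G : MedialGraph n, G.Lensless → G.Represents τ → G.crossings = c

/-- The generating relation of the uncrossing order: some lensless medial graph representing `τ`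
can be uncrossed at one crossing to a lensless medial graph representing `τ'`. -/
def UncrossStep (τ' τ : Matching n) : Prop :=
  ∃ G G' : MedialGraph n, G.Lensless ∧ G.Represents τ ∧ G.Uncrosses G' ∧
    G'.Lensless ∧ G'.Represents τ'

/-- The uncrossing order: the reflexive and transitive closure of `UncrossStep`. -/
instance : Preorder (Matching n) where
  le := Relation.ReflTransGen UncrossStep
  le_refl _ := Relation.ReflTransGen.refl
  le_trans _ _ _ := Relation.ReflTransGen.trans

end Matching

/-! ### Affine permutations and Bruhat order -/

/-- Affine permutations of type `(k, N)`. -/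
structure AffinePerm (k : ℤ) (N : ℕ) where
  toPerm : Equiv.Perm ℤ
  periodic : ∀ i : ℤ, toPerm (i + N) = toPerm i + N
  sum_eq : ∑ i ∈ Finset.Icc (1 : ℤ) N, (toPerm i - i) = k * N

/-- The affine transposition `t_{a,b}` of period `N`, for `a`, `b` distinct modulo `N`: it
exchanges `a + rN` and `b + rN` for all `r` and fixes all other integers. -/
def affineTransposition (N : ℕ) (a b i : ℤ) : ℤ :=
  if i ≡ a [ZMOD N] then i + (b - a) else if i ≡ b [ZMOD N] then i + (a - b) else i

namespace AffinePerm

variable {k : ℤ} {N : ℕ}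

instance : CoeFun (AffinePerm k N) (fun _ => ℤ → ℤ) := ⟨fun f => f.toPerm⟩

/-- Representatives of the inversions `i < j`, `f i > f j`, up to simultaneous translation of
`i` and `j` by multiples of `N`. -/
def inversions (f : AffinePerm k N) : Set (ℤ × ℤ) :=
  {p | 1 ≤ p.1 ∧ p.1 ≤ N ∧ p.1 < p.2 ∧ f p.2 < f p.1}

theorem shift_zmul (f : AffinePerm k N) (i q : ℤ) : f (i + N * q) = f i + N * q := by
  induction q using Int.induction_on with
  | zero => simp
  | succ m ih =>
    have e : i + (N : ℤ) * (m + 1) = i + N * m + N := by ring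
    rw [e, f.periodic, ih]; ring
  | pred m ih =>
    have h := f.periodic (i + N * (-(m : ℤ) - 1))
    have e : i + (N : ℤ) * (-(m : ℤ) - 1) + N = i + N * (-(m : ℤ)) := by ring
    rw [e, ih] at h
    linarith

theorem finite_inversions (f : AffinePerm k N) : f.inversions.Finite := by
  rcases Nat.eq_zero_or_pos N with rfl | hN
  · refine Set.Finite.subset Set.finite_empty ?_
    rintro p ⟨h1, h2, -⟩
    simp only [Nat.cast_zero] at h2
    omega
  obtain ⟨m, hm⟩ := ((Finset.Ico (0 : ℤ) N).image fun r => f r - r).bddBelow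
  obtain ⟨M, hM⟩ := ((Finset.Icc (1 : ℤ) N).image fun r => f r).bddAbove
  have hlow : ∀ j : ℤ, m ≤ f j - j := by
    intro j
    have h := f.shift_zmul (j % N) (j / N)
    rw [Int.emod_add_mul_ediv] at h
    have h1 := Int.emod_nonneg j (b := (N : ℤ)) (by omega)
    have h2 := Int.emod_lt_of_pos j (b := (N : ℤ)) (by omega)
    have h3 := hm (Finset.mem_coe.2 (Finset.mem_image.2
      ⟨j % N, Finset.mem_Ico.2 ⟨h1, h2⟩, rfl⟩))
    have h4 := Int.emod_add_mul_ediv j N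
    linarith
  refine Set.Finite.subset ((Set.finite_Icc (1 : ℤ) N).prod (Set.finite_Icc (1 : ℤ) (M - m))) ?_
  rintro p ⟨h1, h2, h3, h4⟩
  have h5 := hlow p.2
  have h6 := hM (Finset.mem_coe.2 (Finset.mem_image.2
    ⟨p.1, Finset.mem_Icc.2 ⟨h1, h2⟩, rfl⟩))
  have h7 : f p.1 ≤ M := h6
  exact ⟨⟨h1, h2⟩, ⟨by linarith, by linarith⟩⟩

/-- The length of an affine permutation: the number of inversions up to translation. -/
noncomputable def length (f : AffinePerm k N) : ℕ := f.inversions.ncard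

/-- One step up in Bruhat order: `g` is `f` multiplied by a transposition, and longer. -/
def BruhatStep (f g : AffinePerm k N) : Prop :=
  (∃ a b : ℤ, ¬ a ≡ b [ZMOD N] ∧ ∀ i, g i = affineTransposition N a b (f i)) ∧
    f.length < g.length

theorem length_le_of_bruhat {f g : AffinePerm k N} (h : Relation.ReflTransGen BruhatStep f g) :
    f.length ≤ g.length := by
  induction h with
  | refl => exact le_rfl
  | tail _ h ih => exact ih.trans h.2.le

/-- Bruhat order: the reflexive and transitive closure of `BruhatStep`. -/
instance : PartialOrder (AffinePerm k N) where
  le := Relation.ReflTransGen BruhatStep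
  le_refl _ := Relation.ReflTransGen.refl
  le_trans _ _ _ := Relation.ReflTransGen.trans
  le_antisymm f g hfg hgf := by
    rcases Relation.ReflTransGen.cases_head hfg with h | ⟨c, hfc, hcg⟩
    · exact h
    · have h1 := length_le_of_bruhat hcg
      have h2 := length_le_of_bruhat hgf
      have h3 := hfc.2
      omega

end AffinePerm

/-- Bounded affine permutations of type `(k, N)`, with the Bruhat order of all affine
permutations. -/
abbrev BoundedAffinePerm (k : ℤ) (N : ℕ) : Type :=
  {f : AffinePerm k N // ∀ i : ℤ, i ≤ f i ∧ f i ≤ i + N}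

/-! ### The bounded affine permutation of a matching -/

namespace Matching

variable {n : ℕ}

/-- The label in `{1, …, 2n}` of a point. -/
def label (p : Fin (2 * n)) : ℤ := (p : ℤ) + 1

/-- The point whose label is congruent to `i` modulo `2n`. -/
def residue (n : ℕ) [NeZero n] (i : ℤ) : Fin (2 * n) :=
  ⟨((i - 1) % (2 * n : ℤ)).toNat, by
    have hn : 0 < n := Nat.pos_of_ne_zero (NeZero.ne n)
    have h1 := Int.emod_nonneg (i - 1) (b := (2 * n : ℤ)) (by omega)
    have h2 := Int.emod_lt_of_pos (i - 1) (b := (2 * n : ℤ)) (by omega)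
    omega⟩

theorem label_residue [NeZero n] (i : ℤ) :
    label (residue n i) + 2 * n * ((i - 1) / (2 * n)) = i := by
  have hn : 0 < n := Nat.pos_of_ne_zero (NeZero.ne n)
  have h1 := Int.emod_nonneg (i - 1) (b := (2 * n : ℤ)) (by omega)
  have h2 := Int.emod_add_mul_ediv (i - 1) (2 * n : ℤ)
  simp only [label, residue]
  rw [Int.toNat_of_nonneg h1]
  linarith

theorem label_inj_aux [NeZero n] (p : Fin (2 * n)) (q : ℤ) :
    (label p + 2 * n * q - 1) / (2 * n) = q ∧ (label p + 2 * n * q - 1) % (2 * n) = (p : ℤ) := by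
  have hn : 0 < n := Nat.pos_of_ne_zero (NeZero.ne n)
  have hp := p.2
  have e : label p + 2 * n * q - 1 = (p : ℤ) + 2 * n * q := by simp only [label]; ring
  rw [e]
  constructor
  · rw [Int.add_mul_ediv_left _ _ (by omega), Int.ediv_eq_zero_of_lt (by omega) (by omega)]; simp
  · rw [Int.add_mul_emod_self_left, Int.emod_eq_of_lt (by omega) (by omega)]

theorem residue_label [NeZero n] (p : Fin (2 * n)) (q : ℤ) :
    residue n (label p + 2 * n * q) = p := by
  ext
  simp only [residue, (label_inj_aux p q).2, Int.toNat_natCast]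

/-- The function `g_τ`: on labels in `{1, …, 2n}` it is `i ↦ τ(i)` if `i < τ(i)` and
`i ↦ τ(i) + 2n` if `i > τ(i)`, and it is extended by `g_τ(i + 2n) = g_τ(i) + 2n`. -/
def gFun [NeZero n] (τ : Matching n) (i : ℤ) : ℤ :=
  (if residue n i < τ (residue n i) then label (τ (residue n i))
    else label (τ (residue n i)) + 2 * n) + 2 * n * ((i - 1) / (2 * n))

theorem gFun_label [NeZero n] (τ : Matching n) (p : Fin (2 * n)) (q : ℤ) :
    τ.gFun (label p + 2 * n * q) =
      (if p < τ p then label (τ p) else label (τ p) + 2 * n) + 2 * n * q := by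
  simp only [gFun, residue_label, (label_inj_aux p q).1]

/-- The inverse of `g_τ`. -/
def gInv [NeZero n] (τ : Matching n) (i : ℤ) : ℤ :=
  (if τ (residue n i) < residue n i then label (τ (residue n i))
    else label (τ (residue n i)) - 2 * n) + 2 * n * ((i - 1) / (2 * n))

theorem gInv_label [NeZero n] (τ : Matching n) (p : Fin (2 * n)) (q : ℤ) :
    τ.gInv (label p + 2 * n * q) =
      (if τ p < p then label (τ p) else label (τ p) - 2 * n) + 2 * n * q := by
  simp only [gInv, residue_label, (label_inj_aux p q).1]

theorem gInv_gFun [NeZero n] (τ : Matching n) (i : ℤ) : τ.gInv (τ.gFun i) = i := by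
  rw [← label_residue (n := n) i]
  generalize residue n i = p
  generalize (i - 1) / (2 * (n : ℤ)) = q
  rw [gFun_label]
  split_ifs with h
  · rw [gInv_label, τ.invol, if_pos h]
  · have h' : ¬ τ (τ p) < τ p := by rw [τ.invol]; exact h
    have e : label (τ p) + 2 * (n : ℤ) + 2 * n * q = label (τ p) + 2 * n * (q + 1) := by ring
    rw [e, gInv_label, if_neg h', τ.invol]; ring

theorem gFun_gInv [NeZero n] (τ : Matching n) (i : ℤ) : τ.gFun (τ.gInv i) = i := by
  rw [← label_residue (n := n) i]
  generalize residue n i = p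
  generalize (i - 1) / (2 * (n : ℤ)) = q
  rw [gInv_label]
  split_ifs with h
  · rw [gFun_label, τ.invol, if_pos h]
  · have h' : ¬ τ p < τ (τ p) := by rw [τ.invol]; exact h
    have e : label (τ p) - 2 * (n : ℤ) + 2 * n * q = label (τ p) + 2 * n * (q - 1) := by ring
    rw [e, gFun_label, if_neg h', τ.invol]; ring

theorem gFun_periodic [NeZero n] (τ : Matching n) (i : ℤ) :
    τ.gFun (i + (2 * n : ℕ)) = τ.gFun i + (2 * n : ℕ) := by
  rw [← label_residue (n := n) i]
  generalize residue n i = p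
  generalize (i - 1) / (2 * (n : ℤ)) = q
  have e : label p + 2 * (n : ℤ) * q + (2 * n : ℕ) = label p + 2 * n * (q + 1) := by
    push_cast; ring
  rw [e, gFun_label, gFun_label]
  push_cast; ring

theorem gFun_bounded [NeZero n] (τ : Matching n) (i : ℤ) :
    i ≤ τ.gFun i ∧ τ.gFun i ≤ i + (2 * n : ℕ) := by
  rw [← label_residue (n := n) i]
  generalize residue n i = p
  generalize (i - 1) / (2 * (n : ℤ)) = q
  rw [gFun_label]
  have h1 := p.2
  have h2 := (τ p).2
  split_ifs with h
  · have h3 : (p : ℕ) < τ p := h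
    simp only [label]; push_cast; constructor <;> linarith
  · have h3 : (τ p : ℕ) ≤ p := by simpa using h
    simp only [label]; push_cast; constructor <;> linarith

theorem gFun_sum [NeZero n] (τ : Matching n) :
    ∑ i ∈ Finset.Icc (1 : ℤ) (2 * n : ℕ), (τ.gFun i - i) = (n : ℤ) * (2 * n : ℕ) := by
  have himg : Finset.Icc (1 : ℤ) (2 * n : ℕ) = Finset.univ.image (label : Fin (2 * n) → ℤ) := by
    ext i
    simp only [Finset.mem_Icc, Finset.mem_image, Finset.mem_univ, true_and, label]
    constructor
    · intro h
      exact ⟨⟨(i - 1).toNat, by omega⟩, by simp only; omega⟩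
    · rintro ⟨p, rfl⟩
      have := p.2
      omega
  have hinj : Function.Injective (label : Fin (2 * n) → ℤ) := by
    intro p q h
    simp only [label] at h
    ext; omega
  rw [himg, Finset.sum_image (fun _ _ _ _ h => hinj h)]
  have hval : ∀ p : Fin (2 * n), τ.gFun (label p) - label p =
      (label (τ p) - label p) + if p < τ p then 0 else 2 * (n : ℤ) := by
    intro p
    have := gFun_label τ p 0
    simp only [mul_zero, add_zero] at this
    rw [this]
    split_ifs <;> ring
  let E : Equiv.Perm (Fin (2 * n)) := ⟨τ, τ, τ.invol, τ.invol⟩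
  have hE : ∀ F : Fin (2 * n) → ℤ, ∑ p, F (τ p) = ∑ p, F p := fun F => Equiv.sum_comp E F
  have h1 : ∑ p : Fin (2 * n), (label (τ p) - label p) = 0 := by
    rw [Finset.sum_sub_distrib, hE, sub_self]
  have h2 : ∑ p : Fin (2 * n), (if p < τ p then 0 else 2 * (n : ℤ)) =
      ∑ p : Fin (2 * n), (if p < τ p then 2 * (n : ℤ) else 0) := by
    rw [← hE]
    refine Finset.sum_congr rfl fun p _ => ?_
    rw [τ.invol]
    rcases lt_trichotomy p (τ p) with h | h | h
    · rw [if_neg h.not_gt, if_pos h]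
    · exact absurd h.symm (τ.ne_self p)
    · rw [if_pos h, if_neg h.not_gt]
  have h3 : ∑ p : Fin (2 * n), (if p < τ p then 0 else 2 * (n : ℤ)) +
      ∑ p : Fin (2 * n), (if p < τ p then 2 * (n : ℤ) else 0) = 2 * n * (2 * n) := by
    rw [← Finset.sum_add_distrib]
    have : ∀ p : Fin (2 * n), ((if p < τ p then 0 else 2 * (n : ℤ)) +
      (if p < τ p then 2 * (n : ℤ) else 0)) = 2 * n := by
      intro p; split_ifs <;> simp
    simp [this]
  simp only [hval]
  rw [Finset.sum_add_distrib, h1]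
  push_cast
  linarith

/-- The bounded affine permutation `g_τ` of type `(n, 2n)`. -/
def g [NeZero n] (τ : Matching n) : BoundedAffinePerm n (2 * n) :=
  ⟨{ toPerm := ⟨τ.gFun, τ.gInv, τ.gInv_gFun, τ.gFun_gInv⟩
     periodic := τ.gFun_periodic
     sum_eq := τ.gFun_sum }, τ.gFun_bounded⟩

end Matching

/-! ### Euler's formula and two-colourings of the faces -/

/-! Read `τ` as a chord diagram on a circle. Its lift `gFun` sends each integer to the next integer
matched to it modulo `2n`; it satisfies `z < f z` and `f (f z) = z + 2n` (`IsAffineMatching`). The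
crossing number is then `cross`, the number of interlacing pairs of chords.

Topology. Planarity enters only through homology: Euler's formula says that every cycle modulo 2 is
the boundary of a set of faces (`CombMap.euler_iff`). A wire is such a cycle, so it two-colours the
faces, and following a second wire through the colours shows that two wires cross an odd number of
times exactly when their ends interlace (`Represents.sum_crossAt`). Hence a graph representing `τ`
has at least `τ.cross` crossings, with equality if it is lensless; conversely, equality forces a
graph without closed wires to be lensless (`Represents.lensless`). Uncrossing a crossing of a
lensless graph reconnects the four halves of its two wires, which conjugates `τ` by a transposition
(`Represents.uncross`). So a step of the uncrossing order is the same as an uncrossing of two chords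
that lowers `cross` by exactly one.

Order. `innerCount` counts the chords inside an interval. Exchanging two values in increasing order
can only raise these counts, so they are monotone in Bruhat order
(`AffinePerm.innerCount_le_of_le`). Uncrossing two chords is two Bruhat steps up (`g_le_conjSwap`),
which gives one implication. For the other, suppose that the counts of `τ` are at most those of `τ'`
and that `τ ≠ τ'`. Then `IsAffineMatching.exists_uncrossing` finds two crossing chords of `τ` whose
uncrossing removes a single crossing and keeps the counts below those of `τ'`. Induction on `cross`
leads from `τ` down to `τ'` (`le_of_innerCount_le`).

Existence of lensless graphs. Starting from the planar rainbow matching, crossings are added next to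
the boundary until any two chords at adjacent points cross. All chords are then diameters, the
counts are minimal, and the same induction descends to every matching.

Length. An inversion at `x` is a chord nested inside the one from `x` to `f x`. Each of the `f x - x
- 1` points in between belongs to a nested chord or to a crossing one; the sum over a period sees
every crossing four times (`length_g`). -/

namespace CombMap

open Classical in
/-- The incidence matrix modulo 2 between the orbits of two permutations. -/
noncomputable def incidence {D : Type} [Fintype D] (σ α : Equiv.Perm D) :
    Matrix (Quot fun x y : D => y = σ x) (Quot fun x y : D => y = α x) (ZMod 2) :=
  fun v e => ∑ x : D, if Quot.mk _ x = v ∧ Quot.mk _ x = e then 1 else 0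

theorem quot_mk_apply {D : Type} (f : Equiv.Perm D) (x : D) :
    Quot.mk (fun x y : D => y = f x) (f x) = Quot.mk _ x :=
  (Quot.sound (r := fun x y : D => y = f x) rfl).symm

theorem quot_mk_eq_iff {D : Type} {α : Equiv.Perm D} (hα : ∀ x, α (α x) = x) (x y : D) :
    Quot.mk (fun x y : D => y = α x) x = Quot.mk _ y ↔ y = x ∨ y = α x := by
  constructor
  · intro h
    let S : (Quot fun x y : D => y = α x) → Prop :=
      Quot.lift (fun y => y = x ∨ y = α x) (by
        rintro a b rfl
        have h1 : α a = x ↔ a = α x := ⟨fun h => by rw [← h, hα], fun h => by rw [h, hα]⟩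
        simp only [h1, α.injective.eq_iff, eq_iff_iff]
        tauto)
    have : S (Quot.mk _ y) := by
      rw [← h]; exact Or.inl rfl
    exact this
  · rintro (rfl | rfl)
    · rfl
    · exact Quot.sound rfl

/-- Since `α` is an involution, vertex rotation and face rotation each express the other through
`α`. So the faces and the vertices define the same connected components. -/
theorem numOrbits₂_trans {D : Type} (σ : Equiv.Perm D) {α : Equiv.Perm D}
    (hα : ∀ x, α (α x) = x) : numOrbits₂ (α.trans σ) α = numOrbits₂ σ α := by
  refine Nat.card_congr ⟨Quot.lift (fun x => Quot.mk _ x) ?_, Quot.lift (fun x => Quot.mk _ x) ?_,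
    fun c => by induction c using Quot.ind; rfl, fun c => by induction c using Quot.ind; rfl⟩
  · rintro a b (rfl | rfl)
    · exact (Quot.sound (r := fun x y : D => y = σ x ∨ y = α x) (b := α a) (Or.inr rfl)).trans
        (Quot.sound (Or.inl rfl))
    · exact Quot.sound (Or.inr rfl)
  · rintro a b (rfl | rfl)
    · refine (Quot.sound (r := fun x y : D => y = (α.trans σ) x ∨ y = α x) (b := α a)
        (Or.inr rfl)).trans (Quot.sound (Or.inl ?_))
      rw [Equiv.trans_apply, hα]
    · exact Quot.sound (Or.inr rfl)

variable {D : Type} [Fintype D] (σ α : Equiv.Perm D)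

noncomputable instance : Fintype (Quot fun x y : D => y = σ x) := Fintype.ofFinite _

open Classical in
theorem incidence_mulVec (w : (Quot fun x y : D => y = α x) → ZMod 2)
    (v : Quot fun x y : D => y = σ x) :
    (incidence σ α).mulVec w v = ∑ x : D, if Quot.mk _ x = v then w (Quot.mk _ x) else 0 := by
  simp only [Matrix.mulVec, dotProduct, incidence, Finset.sum_mul]
  rw [Finset.sum_comm]
  refine Finset.sum_congr rfl fun x _ => ?_
  by_cases h : Quot.mk _ x = v <;> simp [h]

theorem incidence_transpose : (incidence σ α).transpose = incidence α σ := by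
  ext e v
  simp only [Matrix.transpose_apply, incidence]
  refine Finset.sum_congr rfl fun x _ => ?_
  congr 1; rw [and_comm]

variable {α}

open Classical in
theorem incidence_mulVec_mk (hα : ∀ x, α (α x) = x) (hα' : ∀ x, α x ≠ x)
    (s : (Quot fun x y : D => y = σ x) → ZMod 2) (x : D) :
    (incidence α σ).mulVec s (Quot.mk _ x) = s (Quot.mk _ x) + s (Quot.mk _ (α x)) := by
  rw [incidence_mulVec, ← Finset.sum_filter]
  have : (Finset.univ.filter fun y : D =>
      (Quot.mk (fun x y : D => y = α x) y) = Quot.mk _ x) = {x, α x} := by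
    ext y
    rw [Finset.mem_filter, eq_comm (b := Quot.mk _ x), quot_mk_eq_iff hα]
    simp
  rw [this, Finset.sum_pair (hα' x).symm]

/-- The kernel of the transposed incidence matrix consists of the functions on the components. -/
noncomputable def kerEquiv (hα : ∀ x, α (α x) = x) (hα' : ∀ x, α x ≠ x) :
    LinearMap.ker (incidence α σ).mulVecLin ≃ₗ[ZMod 2]
      ((Quot fun x y : D => y = σ x ∨ y = α x) → ZMod 2) where
  toFun s := Quot.lift (fun x => s.1 (Quot.mk _ x)) (by
    rintro a b (rfl | rfl)
    · exact congrArg s.1 (Quot.sound rfl)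
    · have h : (incidence α σ).mulVec s.1 (Quot.mk _ a) = 0 :=
        congrFun (LinearMap.mem_ker.1 s.2) _
      rw [incidence_mulVec_mk σ hα hα'] at h
      exact CharTwo.add_eq_zero.1 h)
  map_add' s t := by
    ext c; induction c using Quot.ind; rfl
  map_smul' s t := by
    ext c; induction c using Quot.ind; rfl
  invFun u := ⟨Quot.lift (fun x => u (Quot.mk _ x)) (by
      rintro a b rfl
      exact congrArg u (Quot.sound (Or.inl rfl))), by
      rw [LinearMap.mem_ker]
      ext c
      induction c using Quot.ind with | mk x => ?_
      rw [Matrix.mulVecLin_apply, incidence_mulVec_mk σ hα hα']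
      refine CharTwo.add_eq_zero.2 (congrArg u (Quot.sound (Or.inr rfl)))⟩
  left_inv s := by
    ext c; induction c using Quot.ind; rfl
  right_inv u := by
    ext c; induction c using Quot.ind; rfl

/-- Rank and nullity: the kernel consists of the functions that are constant on components. This
applies to the faces as well as to the vertices, because the components are the same. -/
theorem rank_incidence_add (hα : ∀ x, α (α x) = x) (hα' : ∀ x, α x ≠ x) :
    (incidence α σ).rank + numOrbits₂ σ α = numOrbits σ := by
  have h := LinearMap.finrank_range_add_finrank_ker (incidence α σ).mulVecLin
  rw [(kerEquiv σ hα hα').finrank_eq] at h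
  have : Fintype (Quot fun x y : D => y = σ x ∨ y = α x) := Fintype.ofFinite _
  rw [Module.finrank_fintype_fun_eq_card, Module.finrank_fintype_fun_eq_card] at h
  rw [numOrbits, numOrbits₂, Nat.card_eq_fintype_card, Nat.card_eq_fintype_card, ← h]
  rfl

open Classical in
/-- Euler's formula holds if and only if every cycle modulo 2 bounds: it is the set of edges whose
sides have different colours in some two-colouring of the faces. -/
theorem euler_iff (hα : ∀ x, α (α x) = x) (hα' : ∀ x, α x ≠ x) :
    numOrbits σ + numOrbits (α.trans σ) = numOrbits α + 2 * numOrbits₂ σ α ↔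
    ∀ w : D → ZMod 2, (∀ x, w (α x) = w x) →
      (∀ c : Quot fun x y : D => y = σ x, (∑ x : D, if Quot.mk _ x = c then w x else 0) = 0) →
      ∃ χ : D → ZMod 2, (∀ x, χ (σ x) = χ x + w x) ∧ ∀ x, χ (σ (α x)) = χ x := by
  set φ := α.trans σ with hφ
  have hφa : ∀ x, φ x = σ (α x) := fun x => rfl
  have r1 := rank_incidence_add σ hα hα'
  have r2 := rank_incidence_add φ hα hα'
  rw [numOrbits₂_trans σ hα] at r2
  have hrank : (incidence σ α).rank = (incidence α σ).rank := by
    rw [← incidence_transpose, Matrix.rank_transpose]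
  -- The edges that separate faces of different colours form a cycle: going once around a vertex,
  -- each face colour occurs twice.
  have hle : LinearMap.range (incidence α φ).mulVecLin ≤
      LinearMap.ker (incidence σ α).mulVecLin := by
    rintro _ ⟨χ, rfl⟩
    rw [LinearMap.mem_ker]
    ext v
    rw [Matrix.mulVecLin_apply, Matrix.mulVecLin_apply, incidence_mulVec]
    simp only [incidence_mulVec_mk φ hα hα']
    have e : ∀ x, χ (Quot.mk _ (α x)) = χ (Quot.mk _ (σ x)) := fun x =>
      congrArg χ (Quot.sound (by rw [hφa, hα]))
    simp only [e]
    have e2 : ∀ x, (if Quot.mk (fun x y : D => y = σ x) x = v then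
        χ (Quot.mk _ x) + χ (Quot.mk _ (σ x)) else 0) =
        (if Quot.mk (fun x y : D => y = σ x) x = v then χ (Quot.mk _ x) else 0) +
        (if Quot.mk (fun x y : D => y = σ x) (σ x) = v then χ (Quot.mk _ (σ x)) else 0) := by
      intro x
      rw [quot_mk_apply]
      split_ifs <;> simp
    simp only [e2, Finset.sum_add_distrib]
    rw [Equiv.sum_comp σ fun x => if Quot.mk (fun x y : D => y = σ x) x = v then
      χ (Quot.mk _ x) else 0]
    exact CharTwo.add_self_eq_zero _
  have hker := LinearMap.finrank_range_add_finrank_ker (incidence σ α).mulVecLin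
  rw [Module.finrank_fintype_fun_eq_card, ← Nat.card_eq_fintype_card] at hker
  change (incidence σ α).rank + _ = numOrbits α at hker
  -- With `V`, `E`, `F`, `C` the numbers of vertices, edges, faces and components, the cycle space
  -- has dimension `E - (V - C)` and the space of boundaries has dimension `F - C`. An inclusion of
  -- these spaces is an equality exactly if `V + F = E + 2C`.
  have hfin : numOrbits σ + numOrbits φ = numOrbits α + 2 * numOrbits₂ σ α ↔
      LinearMap.range (incidence α φ).mulVecLin = LinearMap.ker (incidence σ α).mulVecLin := by
    constructor
    · intro h
      refine Submodule.eq_of_le_of_finrank_eq hle ?_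
      change (incidence α φ).rank = _
      omega
    · intro h
      have := congrArg (fun S : Submodule (ZMod 2) _ => Module.finrank (ZMod 2) S) h
      change (incidence α φ).rank = _ at this
      omega
  rw [hfin]
  constructor
  · intro h w hw hsum
    have hmem : (Quot.lift w (by rintro a b rfl; exact (hw a).symm) :
        (Quot fun x y : D => y = α x) → ZMod 2) ∈ LinearMap.ker (incidence σ α).mulVecLin := by
      rw [LinearMap.mem_ker]
      ext v
      rw [Matrix.mulVecLin_apply, incidence_mulVec]
      exact hsum v
    rw [← h] at hmem
    obtain ⟨χ, hχ⟩ := hmem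
    have hχ' : ∀ x, χ (Quot.mk _ x) + χ (Quot.mk _ (α x)) = w x := by
      intro x
      rw [← incidence_mulVec_mk φ hα hα']
      exact congrFun hχ (Quot.mk _ x)
    refine ⟨fun x => χ (Quot.mk _ x), fun x => ?_, fun x => ?_⟩
    · have e : χ (Quot.mk _ (α x)) = χ (Quot.mk _ (σ x)) :=
        congrArg χ (Quot.sound (by rw [hφa, hα]))
      simp only
      rw [← hχ', e, ← add_assoc, CharTwo.add_self_eq_zero, zero_add]
    · exact congrArg χ (quot_mk_apply φ x)
  · intro h
    refine le_antisymm hle fun w hw => ?_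
    rw [LinearMap.mem_ker] at hw
    obtain ⟨χ, h1, h2⟩ := h (fun x => w (Quot.mk _ x))
      (fun x => congrArg w (quot_mk_apply α x)) (fun c => by
        rw [← incidence_mulVec]; exact congrFun hw c)
    refine ⟨Quot.lift χ (by rintro a b rfl; exact (h2 a).symm), ?_⟩
    ext e
    induction e using Quot.ind with | mk x => ?_
    rw [Matrix.mulVecLin_apply, incidence_mulVec_mk φ hα hα']
    have := h2 (α x)
    rw [hα, h1] at this
    simp only [← this]
    rw [← add_assoc, CharTwo.add_self_eq_zero, zero_add]

end CombMap

/-! ### Cycles bound in planar medial graphs -/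

theorem finRotate_val (m : ℕ) (i : Fin m) :
    (finRotate m i : ℕ) = if (i : ℕ) + 1 = m then 0 else (i : ℕ) + 1 := by
  cases m with
  | zero => exact i.elim0
  | succ m =>
    rw [coe_finRotate]
    simp only [Fin.ext_iff, Fin.val_last, Nat.add_right_cancel_iff]

theorem ZMod.sum_four {M : Type} [AddCommMonoid M] (f : ZMod 4 → M) :
    ∑ k, f k = f 0 + f 1 + f 2 + f 3 := Fin.sum_univ_four f

theorem ZMod.four_cases (k : ZMod 4) : k = 0 ∨ k = 1 ∨ k = 2 ∨ k = 3 := by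
  revert k; decide

/-- Every cycle modulo 2 of the graph on the sphere bounds. -/
def CyclesBound {n : ℕ} {V : Type} (edge : Equiv.Perm (Dart n V)) : Prop :=
  ∀ w : Dart n V → ZMod 2, (∀ x, w (edge x) = w x) →
    (∀ v, ∑ k : ZMod 4, w (Sum.inl (v, k)) = 0) → ∑ i, w (Sum.inr i) = 0 →
    ∃ χ : Dart n V → ZMod 2, (∀ x, χ (dartRotation n V x) = χ x + w x) ∧
      ∀ x, χ (dartRotation n V (edge x)) = χ x

section Rotation

variable {n : ℕ} {V : Type}

@[simp] theorem dartRotation_inl (v : V) (k : ZMod 4) :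
    dartRotation n V (Sum.inl (v, k)) = Sum.inl (v, k + 1) := rfl

@[simp] theorem dartRotation_inr (i : Fin (2 * n)) :
    dartRotation n V (Sum.inr i) = Sum.inr (finRotate (2 * n) i) := rfl

/-- The vertex of a dart, `none` being the outer vertex. -/
def dartVertex : Dart n V → Option V
  | Sum.inl (v, _) => some v
  | Sum.inr _ => none

theorem quot_dartRotation_inl (v : V) (k : ZMod 4) :
    Quot.mk (fun x y : Dart n V => y = dartRotation n V x) (Sum.inl (v, k)) =
      Quot.mk _ (Sum.inl (v, 0)) := by
  have h : ∀ k : ZMod 4, Quot.mk (fun x y : Dart n V => y = dartRotation n V x)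
      (Sum.inl (v, k + 1)) = Quot.mk _ (Sum.inl (v, k)) := fun k =>
    CombMap.quot_mk_apply (dartRotation n V) (Sum.inl (v, k))
  have h1 := h 0
  have h2 := h 1
  have h3 := h 2
  rw [zero_add] at h1
  rw [one_add_one_eq_two] at h2
  rw [two_add_one_eq_three] at h3
  rcases ZMod.four_cases k with rfl | rfl | rfl | rfl
  · rfl
  · exact h1
  · exact h2.trans h1
  · exact h3.trans (h2.trans h1)

theorem quot_dartRotation_inr (i j : Fin (2 * n)) :
    Quot.mk (fun x y : Dart n V => y = dartRotation n V x) (Sum.inr i) =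
      Quot.mk _ (Sum.inr j) := by
  have key : ∀ (m : ℕ) (h : m < 2 * n), Quot.mk (fun x y : Dart n V => y = dartRotation n V x)
      (Sum.inr ⟨m, h⟩) = Quot.mk _ (Sum.inr ⟨0, by omega⟩) := by
    intro m
    induction m with
    | zero => intro _; rfl
    | succ m ih =>
      intro h
      rw [← ih (by omega)]
      have h1 := CombMap.quot_mk_apply (dartRotation n V) (Sum.inr ⟨m, by omega⟩)
      have h2 : finRotate (2 * n) ⟨m, by omega⟩ = ⟨m + 1, h⟩ := by
        ext
        rw [finRotate_val, if_neg (by simp only; omega)]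
      rwa [dartRotation_inr, h2] at h1
  exact (key i i.2).trans (key j j.2).symm

theorem quot_dartRotation_eq_iff (x y : Dart n V) :
    Quot.mk (fun x y : Dart n V => y = dartRotation n V x) x = Quot.mk _ y ↔
      dartVertex x = dartVertex y := by
  constructor
  · intro h
    have hinv : ∀ a b : Dart n V, b = dartRotation n V a → dartVertex a = dartVertex b := by
      rintro (⟨v, k⟩ | i) b rfl <;> rfl
    exact congrArg (Quot.lift dartVertex hinv) h
  · intro h
    rcases x with ⟨v, k⟩ | i <;> rcases y with ⟨v', k'⟩ | j
    · obtain rfl : v = v' := by simpa [dartVertex] using h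
      rw [quot_dartRotation_inl, quot_dartRotation_inl v k']
    · simp [dartVertex] at h
    · simp [dartVertex] at h
    · exact quot_dartRotation_inr i j

/-- The orbits of the rotation are the crossings and the one outer vertex, so the vertex conditions
of `euler_iff` become the sums in `CyclesBound`. With `n > 0` the outer vertex carries a dart. -/
theorem planar_iff_cyclesBound [Finite V] (hn : 0 < n) (edge : Equiv.Perm (Dart n V))
    (hα : ∀ x, edge (edge x) = x) (hα' : ∀ x, edge x ≠ x) :
    numOrbits (dartRotation n V) + numOrbits (edge.trans (dartRotation n V)) =
      numOrbits edge + 2 * numOrbits₂ (dartRotation n V) edge ↔ CyclesBound edge := by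
  classical
  have : Fintype V := Fintype.ofFinite V
  rw [CombMap.euler_iff _ hα hα']
  have hinl : ∀ (w : Dart n V → ZMod 2) (v : V), (∑ x : Dart n V,
      if Quot.mk (fun x y : Dart n V => y = dartRotation n V x) x = Quot.mk _ (Sum.inl (v, 0))
      then w x else 0) = ∑ k : ZMod 4, w (Sum.inl (v, k)) := by
    intro w v
    simp only [quot_dartRotation_eq_iff]
    rw [Fintype.sum_sum_type, Fintype.sum_prod_type, Finset.sum_eq_single v]
    · simp [dartVertex]
    · intro u _ hu
      simp [dartVertex, hu]
    · simp
  have hinr : ∀ (w : Dart n V → ZMod 2) (i : Fin (2 * n)), (∑ x : Dart n V,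
      if Quot.mk (fun x y : Dart n V => y = dartRotation n V x) x = Quot.mk _ (Sum.inr i)
      then w x else 0) = ∑ i, w (Sum.inr i) := by
    intro w i
    simp only [quot_dartRotation_eq_iff]
    rw [Fintype.sum_sum_type]
    simp [dartVertex]
  constructor
  · intro h w h1 h2 h3
    refine h w h1 fun c => ?_
    induction c using Quot.ind with | mk x => ?_
    rcases x with ⟨v, k⟩ | i
    · rw [quot_dartRotation_inl]
      exact (hinl w v).trans (h2 v)
    · exact (hinr w i).trans h3
  · intro h w h1 h2
    refine h w h1 (fun v => ?_) ?_
    · rw [← hinl]; exact h2 _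
    · rw [← hinr w ⟨0, by omega⟩]; exact h2 _

end Rotation

/-! ### Wires and crossings -/

namespace Matching

variable {n : ℕ}

open Classical in
/-- The parity of the number of sign changes between the endpoints of the chords at `a` and `b`:
it is `1` if these chords cross and `0` if they are disjoint. -/
noncomputable def interlace (τ : Matching n) (a b : Fin (2 * n)) : ZMod 2 :=
  ((if a < b then 1 else 0) + (if τ a < b then 1 else 0)) +
    ((if a < τ b then 1 else 0) + (if τ a < τ b then 1 else 0))

/-- The crossing pairs of chords, represented by their left endpoints. -/
def crossingPairs (τ : Matching n) : Finset (Fin (2 * n) × Fin (2 * n)) :=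
  Finset.univ.filter fun p => p.1 < p.2 ∧ p.2 < τ p.1 ∧ τ p.1 < τ p.2

/-- The number of pairs of crossing chords. -/
def cross (τ : Matching n) : ℕ := τ.crossingPairs.card

theorem mem_crossingPairs {τ : Matching n} {p : Fin (2 * n) × Fin (2 * n)} :
    p ∈ τ.crossingPairs ↔ p.1 < p.2 ∧ p.2 < τ p.1 ∧ τ p.1 < τ p.2 := by
  simp [crossingPairs]

theorem injective (τ : Matching n) : Function.Injective τ := fun p q h => by
  rw [← τ.invol p, h, τ.invol]

theorem interlace_eq_one (τ : Matching n) {p : Fin (2 * n) × Fin (2 * n)}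
    (h : p ∈ τ.crossingPairs) : τ.interlace p.1 p.2 = 1 := by
  obtain ⟨h1, h2, h3⟩ := mem_crossingPairs.1 h
  rw [interlace, if_pos h1, if_neg h2.not_gt, if_pos (h1.trans (h2.trans h3)), if_pos h3]
  decide

theorem mem_crossingPairs_of_interlace (τ : Matching n) {a b : Fin (2 * n)} (hab : a < b)
    (hb : b < τ b) (hne : b ≠ τ a) (h : τ.interlace a b = 1) :
    (a, b) ∈ τ.crossingPairs := by
  rw [mem_crossingPairs]
  refine ⟨hab, ?_⟩
  rw [interlace, if_pos hab, if_pos (hab.trans hb)] at h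
  by_cases h1 : τ a < b
  · rw [if_pos h1, if_pos (h1.trans hb)] at h
    exact absurd h (by decide)
  · rw [if_neg h1] at h
    by_cases h2 : τ a < τ b
    · exact ⟨lt_of_le_of_ne (not_lt.1 h1) hne, h2⟩
    · rw [if_neg h2] at h
      exact absurd h (by decide)

end Matching

namespace MedialGraph

variable {n : ℕ} (G : MedialGraph n)

theorem wire_edge (x : Dart n G.V) : G.wire (G.edge x) = G.wire x :=
  (Quot.sound (r := G.WireStep) (Or.inl rfl)).symm

theorem wire_add_two (v : G.V) (k : ZMod 4) :
    G.wire (Sum.inl (v, k + 2)) = G.wire (Sum.inl (v, k)) :=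
  (Quot.sound (r := G.WireStep) (Or.inr ⟨v, k, rfl, rfl⟩)).symm

theorem wire_two (v : G.V) : G.wire (Sum.inl (v, 2)) = G.wire (Sum.inl (v, 0)) := by
  rw [← G.wire_add_two v 0, zero_add]

theorem wire_three (v : G.V) : G.wire (Sum.inl (v, 3)) = G.wire (Sum.inl (v, 1)) := by
  rw [← G.wire_add_two v 1]; rfl

theorem cyclesBound (hn : 0 < n) : CyclesBound G.edge :=
  have := G.finite
  (planar_iff_cyclesBound hn G.edge G.edge_invol G.edge_ne_self).1 G.planar

/-- The two wires through the crossing `v` are `p` and `q`. -/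
def CrossAt (v : G.V) (p q : G.Wire) : Prop :=
  G.wire (Sum.inl (v, 0)) = p ∧ G.wire (Sum.inl (v, 1)) = q ∨
    G.wire (Sum.inl (v, 0)) = q ∧ G.wire (Sum.inl (v, 1)) = p

variable {G}

theorem CrossAt.onWire_left {v : G.V} {p q : G.Wire} (h : G.CrossAt v p q) : G.OnWire v p :=
  h.elim (fun h => ⟨0, h.1⟩) (fun h => ⟨1, h.2⟩)

theorem CrossAt.onWire_right {v : G.V} {p q : G.Wire} (h : G.CrossAt v p q) : G.OnWire v q :=
  h.elim (fun h => ⟨1, h.2⟩) (fun h => ⟨0, h.1⟩)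

theorem onWire_iff {v : G.V} {p : G.Wire} :
    G.OnWire v p ↔ G.wire (Sum.inl (v, 0)) = p ∨ G.wire (Sum.inl (v, 1)) = p := by
  constructor
  · rintro ⟨k, hk⟩
    rcases ZMod.four_cases k with rfl | rfl | rfl | rfl
    · exact Or.inl hk
    · exact Or.inr hk
    · exact Or.inl (G.wire_two v ▸ hk)
    · exact Or.inr (G.wire_three v ▸ hk)
  · rintro (h | h)
    exacts [⟨0, h⟩, ⟨1, h⟩]

theorem crossAt_of_onWire {v : G.V} {p q : G.Wire} (hpq : p ≠ q) (hp : G.OnWire v p)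
    (hq : G.OnWire v q) : G.CrossAt v p q := by
  rw [onWire_iff] at hp hq
  rcases hp with rfl | rfl <;> rcases hq with rfl | rfl
  · exact absurd rfl hpq
  · exact Or.inl ⟨rfl, rfl⟩
  · exact Or.inr ⟨rfl, rfl⟩
  · exact absurd rfl hpq

theorem Lensless.crossAt_unique (hG : G.Lensless) {p q : G.Wire} (hpq : p ≠ q) {v w : G.V}
    (hv : G.CrossAt v p q) (hw : G.CrossAt w p q) : v = w :=
  hG.no_lens p q v w hpq hv.onWire_left hv.onWire_right hw.onWire_left hw.onWire_right

/-! ### Parity of crossings and interlacing ends -/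

section Represents

variable {τ : Matching n}

theorem Represents.wire_partner (hτ : G.Represents τ) (a : Fin (2 * n)) :
    G.wire (Sum.inr (τ a)) = G.wire (Sum.inr a) :=
  ((hτ a (τ a) (τ.ne_self a).symm).2 rfl).symm

theorem Represents.wire_eq_iff (hτ : G.Represents τ) (i a : Fin (2 * n)) :
    G.wire (Sum.inr i) = G.wire (Sum.inr a) ↔ i = a ∨ i = τ a := by
  by_cases h : a = i
  · subst h; simp
  · rw [eq_comm, hτ a i h]
    constructor
    · exact fun h => Or.inr h.symm
    · rintro (h' | h')
      exacts [absurd h'.symm h, h'.symm]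

theorem Represents.eq {τ' : Matching n} (h : G.Represents τ) (h' : G.Represents τ') : τ = τ' := by
  ext p : 2
  exact ((h' p (τ p) (τ.ne_self p).symm).1 (h.wire_partner p).symm).symm

open Classical in
/-- A colouring of the faces by the side of a wire on which they lie. -/
theorem Represents.exists_sides (hτ : G.Represents τ) (hn : 0 < n) (a : Fin (2 * n)) :
    ∃ χ : Dart n G.V → ZMod 2,
      (∀ x, χ (dartRotation n G.V x) =
        χ x + if G.wire x = G.wire (Sum.inr a) then 1 else 0) ∧
      (∀ x, G.wire x ≠ G.wire (Sum.inr a) → χ (G.edge x) = χ x) ∧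
      ∀ i j, χ (Sum.inr i) + χ (Sum.inr j) =
        ((if a < i then 1 else 0) + (if τ a < i then 1 else 0)) +
          ((if a < j then 1 else 0) + (if τ a < j then 1 else 0)) := by
  obtain ⟨χ, h1, h2⟩ := G.cyclesBound hn
    (fun x => if G.wire x = G.wire (Sum.inr a) then 1 else 0)
    (fun x => by simp only [G.wire_edge])
    (fun v => by
      rw [ZMod.sum_four]
      simp only [G.wire_two, G.wire_three]
      split_ifs <;> decide)
    (by
      simp only [hτ.wire_eq_iff]
      rw [← Finset.sum_filter]
      have : (Finset.univ.filter fun i => i = a ∨ i = τ a) = {a, τ a} := by ext; simp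
      rw [this, Finset.sum_pair (τ.ne_self a).symm]
      decide)
  -- Along the boundary the colour changes just after `a` and just after `τ a`, the two ends of the
  -- wire.
  have h3 : ∀ (m : ℕ) (h : m < 2 * n), χ (Sum.inr ⟨m, h⟩) = χ (Sum.inr ⟨0, by omega⟩) +
      ((if a < ⟨m, h⟩ then 1 else 0) + (if τ a < ⟨m, h⟩ then 1 else 0)) := by
    intro m
    induction m with
    | zero =>
      intro h
      have : ∀ i : Fin (2 * n), ¬ i < ⟨0, h⟩ := fun i hi => Nat.not_lt_zero _ hi
      simp [this]
    | succ m ih =>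
      intro h
      have e := h1 (Sum.inr ⟨m, by omega⟩)
      have e2 : finRotate (2 * n) ⟨m, by omega⟩ = ⟨m + 1, h⟩ := by
        ext
        rw [finRotate_val, if_neg (by simp only; omega)]
      rw [dartRotation_inr, e2, ih (by omega)] at e
      rw [e, hτ.wire_eq_iff, add_assoc]
      congr 1
      have hlt : ∀ i : Fin (2 * n), i < ⟨m + 1, h⟩ ↔ i < ⟨m, by omega⟩ ∨ ⟨m, by omega⟩ = i := by
        intro i
        simp only [Fin.lt_def, Fin.ext_iff]
        omega
      simp only [hlt]
      have hne := τ.ne_self a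
      generalize (⟨m, by omega⟩ : Fin (2 * n)) = i
      by_cases ha : i = a
      · subst ha
        simp [hne.symm, add_comm]
      · by_cases hb : i = τ a
        · subst hb
          simp [hne]
        · simp [ha, hb]
  refine ⟨χ, h1, fun x hx => ?_, fun i j => ?_⟩
  · have e := h1 (G.edge x)
    rw [h2, G.wire_edge, if_neg hx, add_zero] at e
    exact e.symm
  · rw [h3 i i.2, h3 j j.2, add_add_add_comm, CharTwo.add_self_eq_zero, zero_add]

open Classical in
/-- Two wires cross an odd number of times if and only if their ends interlace. -/
theorem Represents.sum_crossAt (hτ : G.Represents τ) (hn : 0 < n) [Fintype G.V]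
    {a b : Fin (2 * n)} (hab : G.wire (Sum.inr a) ≠ G.wire (Sum.inr b)) :
    (∑ v : G.V, if G.CrossAt v (G.wire (Sum.inr a)) (G.wire (Sum.inr b)) then (1 : ZMod 2)
      else 0) = τ.interlace a b := by
  obtain ⟨χ, h1, h2, h3⟩ := hτ.exists_sides hn a
  set p := G.wire (Sum.inr a)
  set q := G.wire (Sum.inr b) with hq
  -- Sum the colours over all darts of the second wire `q`. Grouped by edges the sum vanishes,
  -- because an edge of `q` does not lie on the first wire; grouped by vertices it yields the
  -- crossings and the boundary term.
  let f : Dart n G.V → ZMod 2 := fun x => if G.wire x = q then χ x else 0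
  have hf : ∑ x, f x = 0 := by
    refine Finset.sum_involution (fun x _ => G.edge x) ?_ ?_ ?_ ?_
    · intro x _
      simp only [f, G.wire_edge]
      split_ifs with h
      · rw [h2 x (h ▸ hab.symm)]; exact CharTwo.add_self_eq_zero _
      · rfl
    · exact fun x _ _ => G.edge_ne_self x
    · exact fun x _ => Finset.mem_univ _
    · exact fun x _ => G.edge_invol x
  rw [Fintype.sum_sum_type, Fintype.sum_prod_type] at hf
  have hb : ∑ i, f (Sum.inr i) = τ.interlace a b := by
    simp only [f, hq, hτ.wire_eq_iff]
    rw [← Finset.sum_filter]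
    have : (Finset.univ.filter fun i => i = b ∨ i = τ b) = {b, τ b} := by ext; simp
    rw [this, Finset.sum_pair (τ.ne_self b).symm, h3]
    rfl
  -- Two opposite darts of `q` at `v` differ in colour exactly if the wire across is `p`. If `q`
  -- crosses itself at `v`, all four darts have the same colour and cancel.
  have hv : ∀ v : G.V, ∑ k : ZMod 4, f (Sum.inl (v, k)) = if G.CrossAt v p q then 1 else 0 := by
    intro v
    have e0 := h1 (Sum.inl (v, 0))
    have e1 := h1 (Sum.inl (v, 1))
    have e2 := h1 (Sum.inl (v, 2))
    rw [dartRotation_inl] at e0 e1 e2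
    rw [zero_add] at e0
    rw [one_add_one_eq_two] at e1
    rw [two_add_one_eq_three] at e2
    rw [ZMod.sum_four]
    simp only [f, CrossAt, e2, e1, e0, G.wire_two, G.wire_three]
    generalize χ (Sum.inl (v, 0)) = c
    by_cases h1 : G.wire (Sum.inl (v, 0)) = q <;> by_cases h2 : G.wire (Sum.inl (v, 1)) = q <;>
      by_cases h3 : G.wire (Sum.inl (v, 0)) = p <;> by_cases h4 : G.wire (Sum.inl (v, 1)) = p
    all_goals
      first
      | exact absurd (h3.symm.trans h1) hab
      | exact absurd (h4.symm.trans h2) hab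
      | (simp only [h1, h2, h3, h4, hab, hab.symm, if_true, if_false, and_true, or_self,
          and_false, or_false, false_or]
         revert c; decide)
  rw [hb] at hf
  simp only [hv] at hf
  exact CharTwo.add_eq_zero.1 hf

theorem Represents.exists_crossAt (hτ : G.Represents τ) (hn : 0 < n) {a b : Fin (2 * n)}
    (hab : G.wire (Sum.inr a) ≠ G.wire (Sum.inr b)) (h : τ.interlace a b = 1) :
    ∃ v, G.CrossAt v (G.wire (Sum.inr a)) (G.wire (Sum.inr b)) := by
  classical
  have := G.finite
  have : Fintype G.V := Fintype.ofFinite _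
  by_contra! hno
  have hs := hτ.sum_crossAt hn hab
  simp only [hno, if_false, Finset.sum_const_zero] at hs
  rw [← hs] at h
  exact absurd h (by decide)

theorem Represents.interlace_eq_one_of_crossAt (hτ : G.Represents τ) (hn : 0 < n)
    (hG : G.Lensless) {a b : Fin (2 * n)}
    (hab : G.wire (Sum.inr a) ≠ G.wire (Sum.inr b)) {v : G.V}
    (hv : G.CrossAt v (G.wire (Sum.inr a)) (G.wire (Sum.inr b))) : τ.interlace a b = 1 := by
  classical
  have := G.finite
  have : Fintype G.V := Fintype.ofFinite _
  rw [← hτ.sum_crossAt hn hab, Finset.sum_eq_single v, if_pos hv]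
  · intro w _ hw
    exact if_neg fun h => hw (hG.crossAt_unique hab h hv)
  · simp

theorem Represents.wire_ne_of_mem_crossingPairs (hτ : G.Represents τ)
    {p : Fin (2 * n) × Fin (2 * n)} (hp : p ∈ τ.crossingPairs) :
    G.wire (Sum.inr p.1) ≠ G.wire (Sum.inr p.2) := by
  obtain ⟨h1, h2, h3⟩ := Matching.mem_crossingPairs.1 hp
  rw [ne_eq, eq_comm, hτ.wire_eq_iff]
  rintro (h | h)
  exacts [h1.ne' h, h2.ne h]

/-- A crossing determines the pair of chords that cross there. -/
theorem Represents.crossingPairs_eq (hτ : G.Represents τ)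
    {p q : Fin (2 * n) × Fin (2 * n)} (hp : p ∈ τ.crossingPairs) (hq : q ∈ τ.crossingPairs) {v : G.V}
    (hvp : G.CrossAt v (G.wire (Sum.inr p.1)) (G.wire (Sum.inr p.2)))
    (hvq : G.CrossAt v (G.wire (Sum.inr q.1)) (G.wire (Sum.inr q.2))) : p = q := by
  obtain ⟨a, b⟩ := p
  obtain ⟨c, d⟩ := q
  obtain ⟨h1, h2, h3⟩ := Matching.mem_crossingPairs.1 hp
  obtain ⟨h4, h5, h6⟩ := Matching.mem_crossingPairs.1 hq
  simp only at *
  have key : ∀ {i j : Fin (2 * n)}, i < τ i → j < τ j →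
      G.wire (Sum.inr i) = G.wire (Sum.inr j) → i = j := by
    intro i j hi hj h
    rcases (hτ.wire_eq_iff i j).1 h with rfl | rfl
    · rfl
    · rw [τ.invol] at hi
      exact absurd hi hj.not_gt
  have ha : a < τ a := h1.trans h2
  have hb : b < τ b := h2.trans h3
  have hc : c < τ c := h4.trans h5
  have hd : d < τ d := h5.trans h6
  rcases hvp with ⟨e1, e2⟩ | ⟨e1, e2⟩ <;> rcases hvq with ⟨e3, e4⟩ | ⟨e3, e4⟩
  · rw [key ha hc (e1.symm.trans e3), key hb hd (e2.symm.trans e4)]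
  · rw [key ha hd (e1.symm.trans e3), key hb hc (e2.symm.trans e4)] at h1
    exact absurd h1 h4.not_gt
  · rw [key ha hd (e2.symm.trans e4), key hb hc (e1.symm.trans e3)] at h1
    exact absurd h1 h4.not_gt
  · rw [key ha hc (e2.symm.trans e4), key hb hd (e1.symm.trans e3)]

/-- The crossing of a pair of crossing chords. -/
theorem Represents.exists_crossingMap (hτ : G.Represents τ) (hn : 0 < n) :
    ∃ F : τ.crossingPairs → G.V, Function.Injective F ∧
      ∀ p, G.CrossAt (F p) (G.wire (Sum.inr p.1.1)) (G.wire (Sum.inr p.1.2)) := by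
  have h : ∀ p : τ.crossingPairs, ∃ v, G.CrossAt v (G.wire (Sum.inr p.1.1))
      (G.wire (Sum.inr p.1.2)) := fun p =>
    hτ.exists_crossAt hn (hτ.wire_ne_of_mem_crossingPairs p.2) (τ.interlace_eq_one p.2)
  choose F hF using h
  refine ⟨F, fun p q hpq => Subtype.ext (hτ.crossingPairs_eq p.2 q.2 (hF p) ?_), hF⟩
  rw [hpq]
  exact hF q

/-- In a lensless graph every crossing belongs to two different wires that cross only there, hence
an odd number of times, so their ends interlace. This makes the injection from crossing pairs to
crossings surjective. -/
theorem Represents.crossings_eq (hτ : G.Represents τ) (hn : 0 < n) (hG : G.Lensless) :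
    G.crossings = τ.cross := by
  obtain ⟨F, hinj, hF⟩ := hτ.exists_crossingMap hn
  have hsurj : Function.Surjective F := by
    intro v
    have hleft : ∀ x, ∃ i, i < τ i ∧ G.wire x = G.wire (Sum.inr i) := by
      intro x
      obtain ⟨i, hi⟩ := hG.ends x
      rcases lt_or_gt_of_ne (τ.ne_self i) with h | h
      · exact ⟨τ i, by rwa [τ.invol], hi.trans (hτ.wire_partner i).symm⟩
      · exact ⟨i, h, hi⟩
    have key : ∀ {i j : Fin (2 * n)}, i < j → i < τ i → j < τ j →
        G.wire (Sum.inr i) ≠ G.wire (Sum.inr j) →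
        G.CrossAt v (G.wire (Sum.inr i)) (G.wire (Sum.inr j)) → ∃ p, F p = v := by
      intro i j hij hi hj hne hv
      have hmem := τ.mem_crossingPairs_of_interlace hij hj
        (fun h => hne ((hτ.wire_eq_iff j i).2 (Or.inr h)).symm)
        (hτ.interlace_eq_one_of_crossAt hn hG hne hv)
      exact ⟨⟨(i, j), hmem⟩, hG.crossAt_unique hne (hF ⟨(i, j), hmem⟩) hv⟩
    obtain ⟨i, hi, hi'⟩ := hleft (Sum.inl (v, 0))
    obtain ⟨j, hj, hj'⟩ := hleft (Sum.inl (v, 1))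
    have hne : G.wire (Sum.inr i) ≠ G.wire (Sum.inr j) := by
      rw [← hi', ← hj']
      exact hG.no_self_crossing v 0
    rcases lt_trichotomy i j with h | h | h
    · exact key h hi hj hne (Or.inl ⟨hi', hj'⟩)
    · exact absurd (by rw [h]) hne
    · exact key h hj hi hne.symm (Or.inr ⟨hi', hj'⟩)
  rw [crossings, Matching.cross, ← Nat.card_congr (Equiv.ofBijective F ⟨hinj, hsurj⟩),
    Nat.card_eq_fintype_card, Fintype.card_coe]

/-- A medial graph with as few crossings as possible is lensless. -/
theorem Represents.lensless (hτ : G.Represents τ) (hn : 0 < n)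
    (hends : ∀ x, ∃ i : Fin (2 * n), G.wire x = G.wire (Sum.inr i))
    (hcard : G.crossings = τ.cross) : G.Lensless := by
  obtain ⟨F, hinj, hF⟩ := hτ.exists_crossingMap hn
  have := G.finite
  -- An injection between finite sets of equal size is bijective: every crossing is the chosen
  -- crossing of some interlacing pair. This leaves none for self-crossings or lenses.
  have hbij : Function.Bijective F := by
    have : Fintype G.V := Fintype.ofFinite _
    refine (Fintype.bijective_iff_injective_and_card F).2 ⟨hinj, ?_⟩
    rw [Fintype.card_coe, ← Nat.card_eq_fintype_card]
    exact hcard.symm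
  have hne : ∀ v, G.wire (Sum.inl (v, 0)) ≠ G.wire (Sum.inl (v, 1)) := by
    intro v
    obtain ⟨p, rfl⟩ := hbij.2 v
    have h := hτ.wire_ne_of_mem_crossingPairs p.2
    rcases hF p with ⟨h1, h2⟩ | ⟨h1, h2⟩
    · rwa [h1, h2]
    · rw [h1, h2]; exact h.symm
  refine ⟨hends, fun v k => ?_, fun p q v w hpq hvp hvq hwp hwq => ?_⟩
  · have h := hne v
    rcases ZMod.four_cases k with rfl | rfl | rfl | rfl
    · exact h
    · rw [one_add_one_eq_two, G.wire_two]; exact h.symm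
    · rw [two_add_one_eq_three, G.wire_two, G.wire_three]; exact h
    · rw [show (3 : ZMod 4) + 1 = 0 from rfl, G.wire_three]; exact h.symm
  · obtain ⟨r, rfl⟩ := hbij.2 v
    obtain ⟨s, rfl⟩ := hbij.2 w
    have h1 := crossAt_of_onWire hpq hvp hvq
    have h2 := crossAt_of_onWire hpq hwp hwq
    have h3 := hF r
    have h4 : G.CrossAt (F s) (G.wire (Sum.inr r.1.1)) (G.wire (Sum.inr r.1.2)) := by
      unfold CrossAt at *
      rcases h1 with ⟨a1, a2⟩ | ⟨a1, a2⟩ <;> rcases h2 with ⟨b1, b2⟩ | ⟨b1, b2⟩ <;>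
        rw [b1, b2] <;> rw [a1, a2] at h3 <;> tauto
    rw [Subtype.ext (hτ.crossingPairs_eq r.2 s.2 h4 (hF s))]

end Represents

end MedialGraph

/-! ### Uncrossing -/

namespace Matching

variable {n : ℕ}

/-- The matching `τ` with the points `b` and `c` exchanged. When the chords `(a, c)` and `(b, d)`
cross, this replaces them by `(a, b)` and `(c, d)`. -/
def conjSwap (τ : Matching n) (b c : Fin (2 * n)) : Matching n where
  toFun p := Equiv.swap b c (τ (Equiv.swap b c p))
  invol p := by simp [τ.invol]
  ne_self p h := τ.ne_self (Equiv.swap b c p) (by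
    have := congrArg (Equiv.swap b c) h
    simpa using this)

theorem conjSwap_apply (τ : Matching n) (b c p : Fin (2 * n)) :
    τ.conjSwap b c p = Equiv.swap b c (τ (Equiv.swap b c p)) := rfl

theorem conjSwap_comm (τ : Matching n) (b c : Fin (2 * n)) :
    τ.conjSwap b c = τ.conjSwap c b := by
  ext p : 2
  rw [conjSwap_apply, conjSwap_apply, Equiv.swap_comm]

end Matching

namespace MedialGraph

variable {n : ℕ} (G : MedialGraph n)

theorem joinedEnd_joinedEnd (k l : ZMod 4) : joinedEnd k (joinedEnd k l) = l := by
  revert k l; unfold joinedEnd; decide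

theorem joinedEnd_ne (k l : ZMod 4) : joinedEnd k l ≠ l := by
  revert k l; unfold joinedEnd; decide

/-- Moves along a wire that do not go straight through the crossing `v`. -/
def HalfStep (v : G.V) (x y : Dart n G.V) : Prop :=
  y = G.edge x ∨ ∃ (w : G.V) (k : ZMod 4), w ≠ v ∧ x = Sum.inl (w, k) ∧ y = Sum.inl (w, k + 2)

/-- The part of its wire, cut at the crossing `v`, that contains the dart `x`. -/
def half (v : G.V) (x : Dart n G.V) : Quot (G.HalfStep v) := Quot.mk _ x

theorem half_edge (v : G.V) (x : Dart n G.V) : G.half v (G.edge x) = G.half v x :=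
  (Quot.sound (r := G.HalfStep v) (Or.inl rfl)).symm

theorem half_add_two {v w : G.V} (h : w ≠ v) (k : ZMod 4) :
    G.half v (Sum.inl (w, k + 2)) = G.half v (Sum.inl (w, k)) :=
  (Quot.sound (r := G.HalfStep v) (Or.inr ⟨w, k, h, rfl, rfl⟩)).symm

variable {G}

theorem eq_of_half_eq {v : G.V} {T : Type} (f : Dart n G.V → T)
    (h1 : ∀ x, f (G.edge x) = f x)
    (h2 : ∀ w k, w ≠ v → f (Sum.inl (w, k + 2)) = f (Sum.inl (w, k)))
    {x y : Dart n G.V} (h : G.half v x = G.half v y) : f x = f y := by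
  refine congrArg (Quot.lift f ?_) h
  rintro a b (rfl | ⟨w, k, hw, rfl, rfl⟩)
  · exact (h1 a).symm
  · exact (h2 w k hw).symm

theorem eq_of_wire_eq {T : Type} (f : Dart n G.V → T)
    (h1 : ∀ x, f (G.edge x) = f x)
    (h2 : ∀ w k, f (Sum.inl (w, k + 2)) = f (Sum.inl (w, k)))
    {x y : Dart n G.V} (h : G.wire x = G.wire y) : f x = f y := by
  refine congrArg (Quot.lift f ?_) h
  rintro a b (rfl | ⟨w, k, rfl, rfl⟩)
  · exact (h1 a).symm
  · exact (h2 w k).symm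

theorem wire_eq_of_half_eq {v : G.V} {x y : Dart n G.V} (h : G.half v x = G.half v y) :
    G.wire x = G.wire y :=
  eq_of_half_eq G.wire G.wire_edge (fun w k _ => G.wire_add_two w k) h

/-- Darts of a wire lie in the same half, or the wire passes through `v`. -/
theorem half_cases (v : G.V) {x y : Dart n G.V} (h : G.wire x = G.wire y) :
    G.half v x = G.half v y ∨ (∃ k, G.half v x = G.half v (Sum.inl (v, k))) ∧
      ∃ k, G.half v y = G.half v (Sum.inl (v, k)) := by
  classical
  -- All halves that reach `v` get the common label `none`. The label is therefore unchanged even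
  -- when a wire goes straight through `v`.
  have key := eq_of_wire_eq (fun z => if ∃ k, G.half v z = G.half v (Sum.inl (v, k)) then none
    else some (G.half v z)) (fun x => by simp only [half_edge]) (fun w k => by
      by_cases hw : w = v
      · subst hw
        rw [if_pos ⟨_, rfl⟩, if_pos ⟨_, rfl⟩]
      · simp only [G.half_add_two hw]) h
  split_ifs at key with h1 h2 h2
  · exact Or.inr ⟨h1, h2⟩
  · exact Or.inl (Option.some.inj key)

/-! ### The four halves of the wires at a crossing -/

section Lensless

variable {τ : Matching n}

/-- In a lensless graph, the two halves of a wire at `v` lie on different sides of the other wire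
through `v`. -/
theorem Represents.exists_half_sides (hτ : G.Represents τ) (hn : 0 < n) (hG : G.Lensless)
    (v : G.V) (k : ZMod 4) : ∃ f : Dart n G.V → ZMod 2,
      (∀ x y, G.half v x = G.half v y → f x = f y) ∧
      f (Sum.inl (v, k + 2)) ≠ f (Sum.inl (v, k)) ∧
      ∀ b, G.wire (Sum.inr b) = G.wire (Sum.inl (v, k)) → f (Sum.inr b) ≠ f (Sum.inr (τ b)) := by
  classical
  obtain ⟨a, ha⟩ := hG.ends (Sum.inl (v, k + 1))
  obtain ⟨χ, h1, h2, h3⟩ := hτ.exists_sides hn a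
  have hne : G.wire (Sum.inl (v, k)) ≠ G.wire (Sum.inr a) := ha ▸ hG.no_self_crossing v k
  have hadd : ∀ w l, χ (Sum.inl (w, l + 2)) = χ (Sum.inl (w, l)) +
      (if G.wire (Sum.inl (w, l)) = G.wire (Sum.inr a) then 1 else 0) +
      if G.wire (Sum.inl (w, l + 1)) = G.wire (Sum.inr a) then 1 else 0 := by
    intro w l
    rw [← h1, dartRotation_inl, ← h1, dartRotation_inl, add_assoc l, one_add_one_eq_two]
  -- The function is the side of the wire from `a`, recorded only on the wire through `(v, k)`.
  -- These two wires meet only at `v`, so the side is constant on each half, and it flips at `v`.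
  refine ⟨fun x => if G.wire x = G.wire (Sum.inl (v, k)) then χ x else 0, fun x y hxy => ?_,
    ?_, fun b hb => ?_⟩
  · refine eq_of_half_eq (fun x => if G.wire x = G.wire (Sum.inl (v, k)) then χ x else 0) ?_ ?_ hxy
    · intro x
      simp only [G.wire_edge]
      split_ifs with h
      · exact h2 x (h ▸ hne)
      · rfl
    · intro w l hw
      simp only [G.wire_add_two]
      split_ifs with h
      · rw [hadd, if_neg (h ▸ hne), if_neg, add_zero, add_zero]
        intro h'
        exact hw (hG.no_lens _ _ w v hne ⟨l, h⟩ ⟨l + 1, h'⟩ ⟨k, rfl⟩ ⟨k + 1, ha⟩)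
      · rfl
  · simp only [G.wire_add_two, if_true]
    rw [hadd, if_neg hne, if_pos ha, add_zero]
    simp
  · have hb' := (hτ.wire_partner b).trans hb
    simp only [hb, hb', if_true]
    intro h
    have e := h3 b (τ b)
    rw [h, CharTwo.add_self_eq_zero] at e
    have hab : G.wire (Sum.inr a) ≠ G.wire (Sum.inr b) := by rw [hb]; exact hne.symm
    have := hτ.interlace_eq_one_of_crossAt hn hG hab (v := v)
      (crossAt_of_onWire hab ⟨k + 1, ha⟩ ⟨k, hb.symm⟩)
    rw [Matching.interlace, ← e] at this
    exact absurd this (by decide)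

/-- Neighbouring darts at `v` lie on different wires, opposite ones on different sides of the other
wire. So the two wires really fall into four halves. -/
theorem Represents.half_injective (hτ : G.Represents τ) (hn : 0 < n) (hG : G.Lensless)
    (v : G.V) {k l : ZMod 4} (h : G.half v (Sum.inl (v, k)) = G.half v (Sum.inl (v, l))) :
    k = l := by
  have h1 : ∀ m, G.half v (Sum.inl (v, m)) ≠ G.half v (Sum.inl (v, m + 1)) := fun m hm =>
    hG.no_self_crossing v m (wire_eq_of_half_eq hm)
  have h2 : ∀ m, G.half v (Sum.inl (v, m)) ≠ G.half v (Sum.inl (v, m + 2)) := fun m hm => by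
    obtain ⟨f, hf, hf', -⟩ := hτ.exists_half_sides hn hG v m
    exact hf' (hf _ _ hm).symm
  have : l = k ∨ l = k + 1 ∨ l = k + 2 ∨ k = l + 1 := by clear * -; revert k l; decide
  rcases this with rfl | rfl | rfl | rfl
  · rfl
  · exact absurd h (h1 _)
  · exact absurd h (h2 _)
  · exact absurd h.symm (h1 _)

theorem half_eq_or (hG : G.Lensless)
    (v : G.V) (k : ZMod 4) {x : Dart n G.V} (h : G.wire x = G.wire (Sum.inl (v, k))) :
    G.half v x = G.half v (Sum.inl (v, k)) ∨ G.half v x = G.half v (Sum.inl (v, k + 2)) := by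
  have h1 : ∃ l, G.half v x = G.half v (Sum.inl (v, l)) := by
    rcases half_cases v h with h | h
    · exact ⟨k, h⟩
    · exact h.1
  obtain ⟨l, hl⟩ := h1
  have hw := (wire_eq_of_half_eq hl).symm.trans h
  have : l = k ∨ l = k + 2 ∨ l = k + 1 ∨ k = l + 1 := by clear * -; revert k l; decide
  rcases this with rfl | rfl | rfl | rfl
  · exact Or.inl hl
  · exact Or.inr hl
  · exact absurd hw (hG.no_self_crossing v k).symm
  · exact absurd hw (hG.no_self_crossing v l)

/-- The four ends of the two wires through `v`. -/
theorem Represents.exists_ends (hτ : G.Represents τ) (hn : 0 < n) (hG : G.Lensless) (v : G.V) :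
    ∃ e : ZMod 4 → Fin (2 * n),
      (∀ k i, G.half v (Sum.inr i) = G.half v (Sum.inl (v, k)) ↔ i = e k) ∧
      ∀ k, τ (e k) = e (k + 2) := by
  have hex : ∀ k, ∃ i, G.half v (Sum.inr i) = G.half v (Sum.inl (v, k)) := by
    intro k
    obtain ⟨b, hb⟩ := hG.ends (Sum.inl (v, k))
    obtain ⟨f, hf, -, hf'⟩ := hτ.exists_half_sides hn hG v k
    rcases half_eq_or hG v k hb.symm with h1 | h1
    · exact ⟨b, h1⟩
    -- The two ends of the wire take different values of `f`, so they cannot both lie in the half at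
    -- `k + 2`.
    · rcases half_eq_or hG v k ((hτ.wire_partner b).trans hb.symm) with h2 | h2
      · exact ⟨τ b, h2⟩
      · exact absurd (hf _ _ (h1.trans h2.symm)) (hf' b hb.symm)
  choose e he using hex
  have hτe : ∀ k, τ (e k) = e (k + 2) := by
    intro k
    have h1 : G.wire (Sum.inr (e (k + 2))) = G.wire (Sum.inr (e k)) := by
      rw [wire_eq_of_half_eq (he k), wire_eq_of_half_eq (he (k + 2)), G.wire_add_two]
    rcases (hτ.wire_eq_iff _ _).1 h1 with h | h
    · have h2 := he (k + 2)
      rw [h, he k] at h2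
      exact absurd (hτ.half_injective hn hG v h2) (by clear * -; revert k; decide)
    · exact h.symm
  refine ⟨e, fun k i => ⟨fun h => ?_, fun h => h ▸ he k⟩, hτe⟩
  rcases (hτ.wire_eq_iff i (e k)).1 ((wire_eq_of_half_eq h).trans
    (wire_eq_of_half_eq (he k)).symm) with h1 | h1
  · exact h1
  · rw [h1, hτe, he] at h
    exact absurd (hτ.half_injective hn hG v h) (by clear * -; revert k; decide)

end Lensless

/-! ### The graph obtained by uncrossing -/

section Uncross

variable {τ : Matching n} {G' : MedialGraph n} {v : G.V} {k : ZMod 4}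

theorem resolve_of_ne {w : G.V} (h : w ≠ v) (l : ZMod 4) :
    G.resolve v k (Sum.inl (w, l)) = Sum.inl (w, l) := by simp [resolve, h]

theorem resolve_self (l : ZMod 4) :
    G.resolve v k (Sum.inl (v, l)) = G.edge (Sum.inl (v, joinedEnd k l)) := by simp [resolve]

/-- The embedding of the darts of the uncrossed graph. -/
def dartMap {V : Type} (e : V ≃ {w : G.V // w ≠ v}) : Dart n V → Dart n G.V :=
  Sum.map (Prod.map (fun w => (e w : G.V)) id) id

theorem dartMap_inl {V : Type} (e : V ≃ {w : G.V // w ≠ v}) (w : V) (l : ZMod 4) :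
    dartMap (n := n) e (Sum.inl (w, l)) = Sum.inl ((e w : G.V), l) := rfl

theorem dartMap_inr {V : Type} (e : V ≃ {w : G.V // w ≠ v}) (i : Fin (2 * n)) :
    dartMap e (Sum.inr i) = Sum.inr i := rfl

theorem dartMap_injective {V : Type} (e : V ≃ {w : G.V // w ≠ v}) :
    Function.Injective (dartMap (n := n) e) :=
  Sum.map_injective.2 ⟨(Subtype.val_injective.comp e.injective).prodMap Function.injective_id,
    Function.injective_id⟩

theorem dartMap_ne {V : Type} (e : V ≃ {w : G.V // w ≠ v}) (x : Dart n V) (l : ZMod 4) :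
    dartMap e x ≠ Sum.inl (v, l) := by
  rcases x with ⟨w, m⟩ | i
  · rw [dartMap_inl]
    intro h
    exact (e w).2 (Prod.ext_iff.1 (Sum.inl.inj h)).1
  · exact Sum.inr_ne_inl

theorem exists_dartMap {V : Type} (e : V ≃ {w : G.V // w ≠ v}) {x : Dart n G.V}
    (h : ∀ l, x ≠ Sum.inl (v, l)) : ∃ y, dartMap e y = x := by
  rcases x with ⟨w, m⟩ | i
  · have hw : w ≠ v := fun hw => h m (by rw [hw])
    exact ⟨Sum.inl (e.symm ⟨w, hw⟩, m), by rw [dartMap_inl, Equiv.apply_symm_apply]⟩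
  · exact ⟨Sum.inr i, rfl⟩

theorem resolve_of_forall_ne {x : Dart n G.V} (h : ∀ l, x ≠ Sum.inl (v, l)) :
    G.resolve v k x = x := by
  rcases x with ⟨w, m⟩ | i
  · exact resolve_of_ne (fun hw => h m (by rw [hw])) m
  · rfl

/-- An edge stays inside one half, and the four darts at `v` lie in different halves. Without loops
at `v`, following one further edge in `resolve` always leaves `v`. -/
theorem edge_ne_of_lensless (hG : G.Lensless) (v : G.V) (k l : ZMod 4) (hτ : G.Represents τ)
    (hn : 0 < n) : G.edge (Sum.inl (v, k)) ≠ Sum.inl (v, l) := by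
  intro h
  have h1 := G.half_edge v (Sum.inl (v, k))
  rw [h] at h1
  rw [hτ.half_injective hn hG v h1] at h
  exact G.edge_ne_self _ h

open Classical in
/-- The wires of the uncrossed graph are obtained from the halves by joining them in pairs. -/
theorem Represents.uncross (hτ : G.Represents τ) (hn : 0 < n) (hG : G.Lensless)
    (e : G'.V ≃ {w : G.V // w ≠ v})
    (he : ∀ x, dartMap e (G'.edge x) = G.resolve v k (G.edge (dartMap e x)))
    {p : ZMod 4 → Fin (2 * n)}
    (hp : ∀ k i, G.half v (Sum.inr i) = G.half v (Sum.inl (v, k)) ↔ i = p k)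
    (hp2 : ∀ k, τ (p k) = p (k + 2)) :
    G'.Represents (τ.conjSwap (p (k + 1)) (p (k + 2))) ∧
      ∀ x, ∃ i : Fin (2 * n), G'.wire x = G'.wire (Sum.inr i) := by
  have hpp : ∀ k, G.half v (Sum.inr (p k)) = G.half v (Sum.inl (v, k)) := fun k => (hp k _).2 rfl
  have hpinj : ∀ {k l}, p k = p l → k = l := fun {k l} h => by
    have := hpp l
    rw [← h, hpp] at this
    exact hτ.half_injective hn hG v this
  -- from halves to wires
  have hedge : ∀ l, ∃ y, dartMap e y = G.edge (Sum.inl (v, l)) := fun l =>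
    exists_dartMap e fun m => edge_ne_of_lensless hG v l m hτ hn
  choose y hy using hedge
  -- The darts at `v` do not survive in `G'`. Each is sent to the wire of the far end of its edge,
  -- which makes `μ` constant on halves.
  let μ : Dart n G.V → G'.Wire := fun x =>
    if h : ∃ z, dartMap e z = x then G'.wire h.choose
    else match x with
      | Sum.inl (_, l) => G'.wire (y l)
      | Sum.inr i => G'.wire (Sum.inr i)
  have hμ1 : ∀ z, μ (dartMap e z) = G'.wire z := by
    intro z
    have h : ∃ z', dartMap e z' = dartMap e z := ⟨z, rfl⟩
    simp only [μ]
    rw [dif_pos h, dartMap_injective e h.choose_spec]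
  have hμ2 : ∀ l, μ (Sum.inl (v, l)) = G'.wire (y l) := by
    intro l
    simp only [μ]
    rw [dif_neg]
    rintro ⟨z, hz⟩
    exact dartMap_ne e z l hz
  have hμe : ∀ l, μ (G.edge (Sum.inl (v, l))) = μ (Sum.inl (v, l)) := by
    intro l
    rw [hμ2, ← hy, hμ1]
  have hμ : ∀ {x x'}, G.half v x = G.half v x' → μ x = μ x' := by
    intro x x' h
    refine eq_of_half_eq μ ?_ ?_ h
    · intro x
      by_cases hx : ∃ l, x = Sum.inl (v, l)
      · obtain ⟨l, rfl⟩ := hx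
        exact hμe l
      by_cases hx' : ∃ l, G.edge x = Sum.inl (v, l)
      · obtain ⟨l, hl⟩ := hx'
        rw [hl, ← hμe l, ← hl, G.edge_invol]
      push Not at hx hx'
      obtain ⟨z, rfl⟩ := exists_dartMap e hx
      have h1 := he z
      rw [resolve_of_forall_ne hx'] at h1
      rw [← h1, hμ1, hμ1, G'.wire_edge]
    · intro w l hw
      have h1 : ∀ m, μ (Sum.inl (w, m)) = G'.wire (Sum.inl (e.symm ⟨w, hw⟩, m)) := by
        intro m
        rw [← hμ1, dartMap_inl, Equiv.apply_symm_apply]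
      rw [h1, h1, G'.wire_add_two]
  have hjoin : ∀ l, μ (Sum.inl (v, joinedEnd k l)) = μ (Sum.inl (v, l)) := by
    intro l
    have h1 := he (y l)
    rw [hy, G.edge_invol, resolve_self, ← hy] at h1
    rw [hμ2, hμ2, ← dartMap_injective e h1, G'.wire_edge]
  -- from wires to pairs of halves
  let lam : Dart n G.V → Quot (G.HalfStep v) := fun x =>
    if G.half v x = G.half v (Sum.inl (v, k + 1)) then G.half v (Sum.inl (v, k))
    else if G.half v x = G.half v (Sum.inl (v, k + 3)) then G.half v (Sum.inl (v, k + 2))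
    else G.half v x
  have hlam0 : ∀ {x y}, G.half v x = G.half v y → lam x = lam y := fun h => by
    simp only [lam, h]
  have hinj := fun {l m} => hτ.half_injective hn hG v (k := l) (l := m)
  have h01 : k ≠ k + 1 := by clear * -; revert k; decide
  have h03 : k ≠ k + 3 := by clear * -; revert k; decide
  have h21 : k + 2 ≠ k + 1 := by clear * -; revert k; decide
  have h23 : k + 2 ≠ k + 3 := by clear * -; revert k; decide
  have h31 : k + 3 ≠ k + 1 := by clear * -; revert k; decide
  have l0 : lam (Sum.inl (v, k)) = G.half v (Sum.inl (v, k)) := by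
    simp only [lam]
    rw [if_neg (fun h => h01 (hinj h)), if_neg (fun h => h03 (hinj h))]
  have l1 : lam (Sum.inl (v, k + 1)) = G.half v (Sum.inl (v, k)) := by
    simp only [lam, if_true]
  have l2 : lam (Sum.inl (v, k + 2)) = G.half v (Sum.inl (v, k + 2)) := by
    simp only [lam]
    rw [if_neg (fun h => h21 (hinj h)), if_neg (fun h => h23 (hinj h))]
  have l3 : lam (Sum.inl (v, k + 3)) = G.half v (Sum.inl (v, k + 2)) := by
    simp only [lam]
    simp only [if_true, if_neg (fun h => h31 (hinj h))]
  have j0 : joinedEnd k k = k + 1 := by simp [joinedEnd]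
  have j1 : joinedEnd k (k + 1) = k := by clear * -; unfold joinedEnd; revert k; decide
  have j2 : joinedEnd k (k + 2) = k + 3 := by clear * -; unfold joinedEnd; revert k; decide
  have j3 : joinedEnd k (k + 3) = k + 2 := by clear * -; unfold joinedEnd; revert k; decide
  have hk : ∀ l, l = k ∨ l = k + 1 ∨ l = k + 2 ∨ l = k + 3 := by clear * -; revert k; decide
  -- `lam` represents the joined halves `k`, `k + 1` by `k`, and `k + 2`, `k + 3` by `k + 2`. It
  -- therefore descends to the wires of `G'` and separates the two new wires.
  have hlamj : ∀ l, lam (Sum.inl (v, joinedEnd k l)) = lam (Sum.inl (v, l)) := by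
    intro l
    rcases hk l with rfl | rfl | rfl | rfl
    · rw [j0, l0, l1]
    · rw [j1, l0, l1]
    · rw [j2, l2, l3]
    · rw [j3, l2, l3]
  have hlam : ∀ {x x'}, G'.wire x = G'.wire x' → lam (dartMap e x) = lam (dartMap e x') := by
    intro x x' h
    refine eq_of_wire_eq (fun x => lam (dartMap e x)) ?_ ?_ h
    · intro x
      simp only [he]
      by_cases hx : ∃ l, G.edge (dartMap e x) = Sum.inl (v, l)
      · obtain ⟨l, hl⟩ := hx
        rw [hl, resolve_self, hlam0 (G.half_edge v _), hlamj, ← hl, hlam0 (G.half_edge v _)]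
      · push Not at hx
        rw [resolve_of_forall_ne hx, hlam0 (G.half_edge v _)]
    · intro w l
      simp only [dartMap_inl]
      exact hlam0 (G.half_add_two (e w).2 l)
  have lamp : ∀ l, lam (Sum.inr (p l)) = lam (Sum.inl (v, l)) := fun l => hlam0 (hpp l)
  have hwp : ∀ l, G'.wire (Sum.inr (p (joinedEnd k l))) = G'.wire (Sum.inr (p l)) := by
    intro l
    rw [← hμ1, ← hμ1, dartMap_inr, dartMap_inr, hμ (hpp _), hμ (hpp _), hjoin]
  have hconj : ∀ l, τ.conjSwap (p (k + 1)) (p (k + 2)) (p l) = p (joinedEnd k l) := by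
    have n01 : p k ≠ p (k + 1) := fun h => h01 (hpinj h)
    have n02 : p k ≠ p (k + 2) := fun h => absurd (hpinj h) (by clear * -; revert k; decide)
    have n31 : p (k + 3) ≠ p (k + 1) := fun h => h31 (hpinj h)
    have n32 : p (k + 3) ≠ p (k + 2) := fun h => absurd (hpinj h).symm h23
    have a2 : k + 1 + 2 = k + 3 := by clear * -; revert k; decide
    have a3 : k + 2 + 2 = k := by clear * -; revert k; decide
    have a4 : k + 3 + 2 = k + 1 := by clear * -; revert k; decide
    intro l
    rw [Matching.conjSwap_apply]
    rcases hk l with rfl | rfl | rfl | rfl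
    · rw [Equiv.swap_apply_of_ne_of_ne n01 n02, hp2, Equiv.swap_apply_right, j0]
    · rw [Equiv.swap_apply_left, hp2, a3, Equiv.swap_apply_of_ne_of_ne n01 n02, j1]
    · rw [Equiv.swap_apply_right, hp2, a2, Equiv.swap_apply_of_ne_of_ne n31 n32, j2]
    · rw [Equiv.swap_apply_of_ne_of_ne n31 n32, hp2, a4, Equiv.swap_apply_left, j3]
  have hconj' : ∀ i, (∀ l, i ≠ p l) → τ.conjSwap (p (k + 1)) (p (k + 2)) i = τ i := by
    intro i hi
    have hτi : ∀ l, τ i ≠ p l := by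
      intro l h
      refine hi (l + 2) ?_
      rw [← hp2, ← h, τ.invol]
    rw [Matching.conjSwap_apply, Equiv.swap_apply_of_ne_of_ne (hi _) (hi _),
      Equiv.swap_apply_of_ne_of_ne (hτi _) (hτi _)]
  have hnot : ∀ {i}, (∀ l, i ≠ p l) → ¬ ∃ l, G.half v (Sum.inr i) = G.half v (Sum.inl (v, l)) :=
    fun hi ⟨l, hl⟩ => hi l ((hp l _).1 hl)
  refine ⟨fun i j hij => ?_, fun x => ?_⟩
  · by_cases hi : ∃ l, i = p l
    · obtain ⟨l, rfl⟩ := hi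
      rw [hconj]
      constructor
      · intro h
        have h1 : lam (Sum.inr (p l)) = lam (Sum.inr j) := hlam h
        rw [lamp] at h1
        have hj : ∃ m, j = p m := by
          by_contra! hj
          have h2 := hnot hj
          have h3 : lam (Sum.inr j) = G.half v (Sum.inr j) := by
            simp only [lam]
            rw [if_neg (fun h => h2 ⟨_, h⟩), if_neg (fun h => h2 ⟨_, h⟩)]
          rw [h3] at h1
          rcases hk l with rfl | rfl | rfl | rfl
          · exact h2 ⟨_, (l0 ▸ h1).symm⟩
          · exact h2 ⟨_, (l1 ▸ h1).symm⟩
          · exact h2 ⟨_, (l2 ▸ h1).symm⟩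
          · exact h2 ⟨_, (l3 ▸ h1).symm⟩
        obtain ⟨m, rfl⟩ := hj
        rw [lamp] at h1
        have hlm : l ≠ m := fun h => hij (by rw [h])
        have h02 : k ≠ k + 2 := by clear * -; revert k; decide
        congr 1
        rcases hk l with rfl | rfl | rfl | rfl <;> rcases hk m with rfl | rfl | rfl | rfl <;>
          first
          | exact absurd rfl hlm
          | assumption
          | (simp only [l0, l1, l2, l3] at h1
             exact absurd (hinj h1) (by first | exact h02 | exact h02.symm))
      · rintro rfl
        exact (hwp l).symm
    · push Not at hi
      rw [hconj' i hi]
      constructor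
      · intro h
        have h1 : lam (Sum.inr i) = lam (Sum.inr j) := hlam h
        have h2 := hnot hi
        have h3 : lam (Sum.inr i) = G.half v (Sum.inr i) := by
          simp only [lam]
          rw [if_neg (fun h => h2 ⟨_, h⟩), if_neg (fun h => h2 ⟨_, h⟩)]
        rw [h3] at h1
        refine (hτ i j hij).1 (wire_eq_of_half_eq (v := v) ?_)
        simp only [lam] at h1
        split_ifs at h1 with h4 h5
        · exact absurd ⟨_, h1⟩ h2
        · exact absurd ⟨_, h1⟩ h2
        · exact h1
      · intro h
        have h1 := (hτ i j hij).2 h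
        rcases half_cases v h1 with h2 | h2
        · have := hμ h2
          rwa [← dartMap_inr e, hμ1, ← dartMap_inr e, hμ1] at this
        · exact absurd h2.1 (hnot hi)
  · obtain ⟨i, hi⟩ := hG.ends (dartMap e x)
    rcases half_cases v hi with h2 | ⟨⟨l, hl⟩, -⟩
    · refine ⟨i, ?_⟩
      rw [← hμ1, hμ h2, ← dartMap_inr e, hμ1]
    · refine ⟨p l, ?_⟩
      rw [← hμ1, hμ (hl.trans (hpp l).symm), ← dartMap_inr e, hμ1]

end Uncross

end MedialGraph

/-! ### Planarity and lenslessness after uncrossing -/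

namespace MedialGraph

variable {n : ℕ} {G : MedialGraph n} {τ : Matching n}

theorem card_subtype_ne_add_one {V : Type} [Finite V] (v : V) :
    Nat.card {w : V // w ≠ v} + 1 = Nat.card V := by
  classical
  rw [← Finite.card_option, Nat.card_congr (Equiv.optionSubtypeNe v)]

/-- Uncrossing a crossing of a planar graph gives a planar graph. -/
theorem exists_uncross (hn : 0 < n) (v : G.V) (k : ZMod 4)
    (hloop : ∀ k l, G.edge (Sum.inl (v, k)) ≠ Sum.inl (v, l)) :
    ∃ (G' : MedialGraph n) (e : G'.V ≃ {w : G.V // w ≠ v}),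
      ∀ x, dartMap e (G'.edge x) = G.resolve v k (G.edge (dartMap e x)) := by
  let e : {w : G.V // w ≠ v} ≃ {w : G.V // w ≠ v} := Equiv.refl _
  have hex : ∀ x : Dart n {w : G.V // w ≠ v}, ∃ y,
      dartMap e y = G.resolve v k (G.edge (dartMap e x)) := by
    intro x
    refine exists_dartMap e fun l => ?_
    by_cases hx : ∃ l, G.edge (dartMap e x) = Sum.inl (v, l)
    · obtain ⟨m, hm⟩ := hx
      rw [hm, resolve_self]
      exact hloop _ _
    · push Not at hx
      rw [resolve_of_forall_ne hx]
      exact hx l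
  choose f hf using hex
  have hcase : ∀ x, (dartMap e (f x) = G.edge (dartMap e x)) ∨
      ∃ l, G.edge (dartMap e x) = Sum.inl (v, l) ∧
        dartMap e (f x) = G.edge (Sum.inl (v, joinedEnd k l)) := by
    intro x
    by_cases hx : ∃ l, G.edge (dartMap e x) = Sum.inl (v, l)
    · obtain ⟨m, hm⟩ := hx
      refine Or.inr ⟨m, hm, ?_⟩
      rw [hf, hm, resolve_self]
    · push Not at hx
      exact Or.inl (by rw [hf, resolve_of_forall_ne hx])
  have hinv : ∀ x, f (f x) = x := by
    intro x
    apply dartMap_injective e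
    rcases hcase x with h | ⟨l, h1, h2⟩
    · rw [hf, h, G.edge_invol, resolve_of_forall_ne (dartMap_ne e x)]
    · rw [hf, h2, G.edge_invol, resolve_self, joinedEnd_joinedEnd, ← h1, G.edge_invol]
  have hne : ∀ x, f x ≠ x := by
    intro x hx
    rcases hcase x with h | ⟨l, h1, h2⟩
    · rw [hx] at h
      exact G.edge_ne_self _ h.symm
    · rw [hx] at h2
      rw [h2, G.edge_invol] at h1
      exact joinedEnd_ne k l (Prod.ext_iff.1 (Sum.inl.inj h1)).2
  have := G.finite
  let E : Equiv.Perm (Dart n {w : G.V // w ≠ v}) := ⟨f, f, hinv, hinv⟩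
  refine ⟨⟨{w : G.V // w ≠ v}, inferInstance, E, hinv, hne,
    (planar_iff_cyclesBound hn E hinv hne).2 ?_⟩, e, hf⟩
  intro w hw hwv hwb
  have hEf : ∀ x, E x = f x := fun x => rfl
  -- the ends at `v` of the edges that are joined
  have hend : ∀ l, ∃ y, dartMap e y = G.edge (Sum.inl (v, l)) := fun l =>
    exists_dartMap e fun m => hloop l m
  choose y hy using hend
  have hfy : ∀ l, f (y l) = y (joinedEnd k l) := by
    intro l
    apply dartMap_injective e
    rw [hf, hy, G.edge_invol, resolve_self, hy]
  have hwy : ∀ l, w (y (joinedEnd k l)) = w (y l) := fun l => by rw [← hfy, ← hEf, hw]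
  classical
  -- A cycle of the uncrossed graph is pulled back to `G`: both edges that were joined at `v`
  -- receive the weight of the new edge. At `v` the weights then agree in pairs, so their sum is
  -- zero there.
  let W : Dart n G.V → ZMod 2 := fun x =>
    if h : ∃ z, dartMap e z = x then w h.choose
    else match x with
      | Sum.inl (_, l) => w (y l)
      | Sum.inr _ => 0
  have hW1 : ∀ z, W (dartMap e z) = w z := by
    intro z
    have h : ∃ z', dartMap e z' = dartMap e z := ⟨z, rfl⟩
    simp only [W]
    rw [dif_pos h, dartMap_injective e h.choose_spec]
  have hW2 : ∀ l, W (Sum.inl (v, l)) = w (y l) := by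
    intro l
    simp only [W]
    rw [dif_neg]
    rintro ⟨z, hz⟩
    exact dartMap_ne e z l hz
  have hWe : ∀ l, W (G.edge (Sum.inl (v, l))) = W (Sum.inl (v, l)) := by
    intro l
    rw [hW2, ← hy, hW1]
  have hWj : ∀ l, W (Sum.inl (v, joinedEnd k l)) = W (Sum.inl (v, l)) := by
    intro l
    rw [hW2, hW2, hwy]
  have hk1 : W (Sum.inl (v, k + 1)) = W (Sum.inl (v, k)) := by
    rw [← hWj k]; simp [joinedEnd]
  have hk3 : W (Sum.inl (v, k + 3)) = W (Sum.inl (v, k + 2)) := by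
    rw [← hWj (k + 2)]
    have : joinedEnd k (k + 2) = k + 3 := by clear * -; unfold joinedEnd; revert k; decide
    rw [this]
  have hWedge : ∀ x, W (G.edge x) = W x := by
    intro x
    by_cases hx : ∃ l, x = Sum.inl (v, l)
    · obtain ⟨l, rfl⟩ := hx
      exact hWe l
    by_cases hx' : ∃ l, G.edge x = Sum.inl (v, l)
    · obtain ⟨l, hl⟩ := hx'
      rw [hl, ← hWe l, ← hl, G.edge_invol]
    push Not at hx hx'
    obtain ⟨z, rfl⟩ := exists_dartMap e hx
    rcases hcase z with h | ⟨l, h3, -⟩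
    · rw [← h, hW1, hW1, ← hEf, hw]
    · exact absurd h3 (hx' l)
  have hWv : ∀ u, ∑ m : ZMod 4, W (Sum.inl (u, m)) = 0 := by
    intro u
    by_cases hu : u = v
    · subst hu
      rw [← Equiv.sum_comp (Equiv.addLeft k), ZMod.sum_four]
      simp only [Equiv.coe_addLeft, add_zero]
      rw [hk1, hk3, CharTwo.add_self_eq_zero, zero_add, CharTwo.add_self_eq_zero]
    · rw [← hwv ⟨u, hu⟩]
      refine Finset.sum_congr rfl fun m _ => ?_
      rw [← hW1]
      rfl
  have hWb : ∑ i, W (Sum.inr i) = 0 := by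
    rw [← hwb]
    refine Finset.sum_congr rfl fun i _ => ?_
    rw [← hW1]
    rfl
  obtain ⟨χ, h1, h2⟩ := G.cyclesBound hn W hWedge hWv hWb
  refine ⟨fun x => χ (dartMap e x), fun x => ?_, fun x => ?_⟩
  · have := h1 (dartMap e x)
    rw [hW1] at this
    rw [← this]
    rcases x with ⟨u, m⟩ | i <;> rfl
  · have hrot : ∀ z, dartMap e (dartRotation n {w : G.V // w ≠ v} z) =
        dartRotation n G.V (dartMap e z) := by
      rintro (⟨u, m⟩ | i) <;> rfl
    simp only [hrot]
    rcases hcase x with h | ⟨l, h3, h4⟩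
    · rw [hEf, h, h2]
    · rw [hEf, h4, h2, ← h2 (dartMap e x), h3]
      have hstep : ∀ m, χ (Sum.inl (v, m + 1)) = χ (Sum.inl (v, m)) + W (Sum.inl (v, m)) :=
        fun m => h1 (Sum.inl (v, m))
      by_cases hl : l = k ∨ l = k + 2
      · rw [joinedEnd, if_pos hl, dartRotation_inl]
      -- Uncrossing merges two opposite faces at `v`. The ends `l - 1` and `l` have equal weight, so
      -- these faces already have the same colour.
      · rw [joinedEnd, if_neg hl, dartRotation_inl, hstep]
        have e0 := hstep (l - 1)
        rw [sub_add_cancel] at e0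
        have hWl : W (Sum.inl (v, l - 1)) = W (Sum.inl (v, l)) := by
          rw [← hWj l, joinedEnd, if_neg hl]
        rw [e0, hWl, add_assoc, CharTwo.add_self_eq_zero, add_zero]

/-- Uncrossing the crossing of two chords `b` and `c` in a lensless graph, when this removes only
one crossing. -/
theorem Represents.exists_uncrosses (hτ : G.Represents τ) (hn : 0 < n) (hG : G.Lensless)
    {b c : Fin (2 * n)} (hbc : b ≠ c) (hbc' : b ≠ τ c) (hint : τ.interlace b c = 1)
    (hcross : τ.cross = (τ.conjSwap b c).cross + 1) :
    ∃ G' : MedialGraph n, G.Uncrosses G' ∧ G'.Lensless ∧ G'.Represents (τ.conjSwap b c) := by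
  have hne : G.wire (Sum.inr b) ≠ G.wire (Sum.inr c) := by
    rw [ne_eq, hτ.wire_eq_iff]
    rintro (h | h)
    exacts [hbc h, hbc' h]
  obtain ⟨v, hv⟩ := hτ.exists_crossAt hn hne hint
  obtain ⟨p, hp, hp2⟩ := hτ.exists_ends hn hG v
  have hmem : ∀ i l, G.wire (Sum.inl (v, l)) = G.wire (Sum.inr i) →
      ∃ m, (m = l ∨ m = l + 2) ∧ i = p m := by
    intro i l h
    rcases half_eq_or hG v l h.symm with h | h
    · exact ⟨l, Or.inl rfl, (hp _ _).1 h⟩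
    · exact ⟨l + 2, Or.inr rfl, (hp _ _).1 h⟩
  have hadj : ∃ m, (b = p m ∧ c = p (m + 1)) ∨ (c = p m ∧ b = p (m + 1)) := by
    rcases hv with ⟨h1, h2⟩ | ⟨h1, h2⟩ <;> obtain ⟨m, hm, rfl⟩ := hmem _ _ h1 <;>
      obtain ⟨l, hl, rfl⟩ := hmem _ _ h2
    · have : l = m + 1 ∨ m = l + 1 := by clear * - hm hl; revert m l; decide
      rcases this with rfl | rfl
      · exact ⟨_, Or.inl ⟨rfl, rfl⟩⟩
      · exact ⟨_, Or.inr ⟨rfl, rfl⟩⟩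
    · have : l = m + 1 ∨ m = l + 1 := by clear * - hm hl; revert m l; decide
      rcases this with rfl | rfl
      · exact ⟨_, Or.inr ⟨rfl, rfl⟩⟩
      · exact ⟨_, Or.inl ⟨rfl, rfl⟩⟩
  obtain ⟨m, hm⟩ := hadj
  -- Resolving with parameter `k` exchanges the ends `k + 1` and `k + 2` in the matching. To
  -- exchange the ends `m` and `m + 1`, take `k = m - 1`.
  have hconj : τ.conjSwap b c = τ.conjSwap (p (m - 1 + 1)) (p (m - 1 + 2)) := by
    have e1 : m - 1 + 1 = m := by ring
    have e2 : m - 1 + 2 = m + 1 := by ring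
    rw [e1, e2]
    rcases hm with ⟨rfl, rfl⟩ | ⟨rfl, rfl⟩
    · rfl
    · exact Matching.conjSwap_comm _ _ _
  obtain ⟨G', e, he⟩ := exists_uncross hn v (m - 1)
    (fun k l => edge_ne_of_lensless hG v k l hτ hn)
  obtain ⟨h1, h2⟩ := hτ.uncross hn hG e he hp hp2
  rw [← hconj] at h1
  -- One crossing is gone and `cross` drops by one, so `G'` has the minimal number of crossings and
  -- is lensless.
  refine ⟨G', ⟨v, m - 1, e, he⟩, h1.lensless hn h2 ?_, h1⟩
  have h3 := hτ.crossings_eq hn hG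
  have := G.finite
  have h4 := card_subtype_ne_add_one v
  rw [← Nat.card_congr e] at h4
  unfold crossings at *
  omega

end MedialGraph

/-- In a step down in the uncrossing order, two crossing chords are replaced by disjoint ones. -/
theorem Matching.UncrossStep.exists_conjSwap {n : ℕ} (hn : 0 < n) {τ τ' : Matching n}
    (h : Matching.UncrossStep τ' τ) :
    τ.cross = τ'.cross + 1 ∧ ∃ b c, b ≠ c ∧ b ≠ τ c ∧ τ.interlace b c = 1 ∧
      τ' = τ.conjSwap b c := by
  obtain ⟨G, G', hG, hτ, ⟨v, k, e, he⟩, hG', hτ'⟩ := h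
  constructor
  · have := G.finite
    have h4 := MedialGraph.card_subtype_ne_add_one v
    rw [← Nat.card_congr e] at h4
    have h1 := hτ.crossings_eq hn hG
    have h2 := hτ'.crossings_eq hn hG'
    unfold MedialGraph.crossings at *
    omega
  · obtain ⟨p, hp, hp2⟩ := hτ.exists_ends hn hG v
    obtain ⟨h1, h2⟩ := hτ.uncross hn hG e he hp hp2
    have hpw : ∀ k, G.wire (Sum.inr (p k)) = G.wire (Sum.inl (v, k)) := fun k =>
      MedialGraph.wire_eq_of_half_eq ((hp k _).2 rfl)
    have hne : G.wire (Sum.inr (p (k + 1))) ≠ G.wire (Sum.inr (p (k + 2))) := by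
      rw [hpw, hpw]
      have := hG.no_self_crossing v (k + 1)
      rwa [add_assoc, one_add_one_eq_two] at this
    refine ⟨p (k + 1), p (k + 2), fun h => hne (by rw [h]), fun h => hne ?_, ?_,
      hτ'.eq h1⟩
    · rw [h, hτ.wire_partner]
    · exact hτ.interlace_eq_one_of_crossAt hn hG hne
        (MedialGraph.crossAt_of_onWire hne ⟨_, (hpw _).symm⟩ ⟨_, (hpw _).symm⟩)

/-! ### Lensless graphs with many crossings -/

namespace MedialGraph

variable {n : ℕ}

/-- The matching of `i` with `2n + 1 - i`. -/
def _root_.Matching.rainbow (n : ℕ) : Matching n where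
  toFun := Fin.rev
  invol := Fin.rev_rev
  ne_self p h := by
    have := congrArg Fin.val h
    rw [Fin.val_rev] at this
    omega

/-- The edges of the graph without crossings that represents the rainbow matching. -/
def rainbowEdge (n : ℕ) : Equiv.Perm (Dart n Empty) :=
  Equiv.sumCongr (Equiv.refl _) Fin.revPerm

theorem rainbowEdge_inr (i : Fin (2 * n)) : rainbowEdge n (Sum.inr i) = Sum.inr i.rev := rfl

theorem rainbowEdge_invol (x : Dart n Empty) : rainbowEdge n (rainbowEdge n x) = x := by
  rcases x with ⟨v, k⟩ | i
  · exact v.elim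
  · rw [rainbowEdge_inr, rainbowEdge_inr, Fin.rev_rev]

theorem rainbowEdge_ne_self (x : Dart n Empty) : rainbowEdge n x ≠ x := by
  rcases x with ⟨v, k⟩ | i
  · exact v.elim
  · rw [rainbowEdge_inr]
    exact fun h => (Matching.rainbow n).ne_self i (Sum.inr.inj h)

/-- The face just before the boundary point `i` is coloured by the sum of the weights at the points
before `i`. As the weights are symmetric with total zero, the partial sums are symmetric too, so
both boundary arcs of a face receive the same colour. -/
theorem cyclesBound_rainbowEdge (n : ℕ) : CyclesBound (rainbowEdge n) := by
  intro w hw _ hwb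
  let u : ℕ → ZMod 2 := fun m => if h : m < 2 * n then w (Sum.inr ⟨m, h⟩) else 0
  have hu : ∀ i : Fin (2 * n), u i = w (Sum.inr i) := fun i => by simp [u]
  have hurev : ∀ m, m < 2 * n → u (2 * n - 1 - m) = u m := by
    intro m hm
    have := hw (Sum.inr ⟨m, hm⟩)
    rw [rainbowEdge_inr, ← hu, ← hu, Fin.val_rev] at this
    rw [← this]
    congr 1
    simp only
    omega
  let S : ℕ → ZMod 2 := fun m => ∑ j ∈ Finset.range m, u j
  have hS : S (2 * n) = 0 := by
    rw [← hwb]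
    simp only [S]
    rw [Finset.sum_range]
    simp only [hu]
  have hSrev : ∀ m, m ≤ 2 * n → S (2 * n - m) = S m := by
    intro m hm
    have h1 : S (2 * n) = S m + S (2 * n - m) := by
      conv_lhs => rw [show 2 * n = m + (2 * n - m) by omega]
      simp only [S]
      rw [Finset.sum_range_add, ← Finset.sum_range_reflect u (2 * n - m)]
      congr 1
      refine Finset.sum_congr rfl fun j hj => ?_
      rw [Finset.mem_range] at hj
      rw [← hurev (m + j) (by omega)]
      congr 1
      omega
    rw [hS] at h1
    exact (CharTwo.add_eq_zero.1 h1.symm).symm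
  refine ⟨Sum.elim (fun _ => 0) fun i => S i, ?_, ?_⟩
  · rintro (⟨v, k⟩ | i)
    · exact v.elim
    · rw [dartRotation_inr, Sum.elim_inr, Sum.elim_inr, finRotate_val, ← hu]
      have : S ((i : ℕ) + 1) = S i + u i := Finset.sum_range_succ _ _
      rw [← this]
      split_ifs with h
      · rw [h, hS]; rfl
      · rfl
  · rintro (⟨v, k⟩ | i)
    · exact v.elim
    · rw [rainbowEdge_inr, dartRotation_inr, Sum.elim_inr, Sum.elim_inr, finRotate_val,
        Fin.val_rev]
      have hi := i.2
      split_ifs with h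
      · rw [show (i : ℕ) = 0 by omega]
      · rw [← hSrev i hi.le]
        congr 1
        omega

theorem exists_lensless_rainbow (hn : 0 < n) : ∃ G : MedialGraph n, G.Lensless ∧
    G.Represents (Matching.rainbow n) := by
  let G : MedialGraph n := ⟨Empty, inferInstance, rainbowEdge n, rainbowEdge_invol,
    rainbowEdge_ne_self, (planar_iff_cyclesBound hn _ rainbowEdge_invol rainbowEdge_ne_self).2
      (cyclesBound_rainbowEdge n)⟩
  refine ⟨G, ⟨?_, fun v => v.elim, fun _ _ v => v.elim⟩, fun i j hij => ⟨fun h => ?_, fun h => ?_⟩⟩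
  · rintro (⟨v, k⟩ | i)
    · exact v.elim
    · exact ⟨i, rfl⟩
  · have h1 := eq_of_wire_eq (G := G) (Sum.elim (fun _ => (⟨0, by omega⟩ : Fin (2 * n)))
      (fun i => min i i.rev)) (by
        rintro (⟨v, k⟩ | i)
        · exact v.elim
        · change min i.rev i.rev.rev = min i i.rev
          rw [Fin.rev_rev, min_comm]) (fun v => v.elim) h
    simp only [Sum.elim_inr] at h1
    change i.rev = j
    rcases min_choice i i.rev with h2 | h2 <;> rcases min_choice j j.rev with h3 | h3 <;>
      rw [h2, h3] at h1
    · exact absurd h1 hij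
    · rw [h1, Fin.rev_rev]
    · exact h1
    · exact absurd (Fin.rev_injective h1) hij
  · have : G.wire (G.edge (Sum.inr i)) = G.wire (Sum.inr i) := G.wire_edge _
    rw [← this]
    exact congrArg (fun j => G.wire (Sum.inr j)) h

/-! ### Adding a crossing next to the boundary -/

section AddCrossing

variable (G : MedialGraph n) (i : Fin (2 * n))

/-- The embedding of the darts when a crossing `none` is added on the edges at the boundary points
`i` and `i + 1`; the ends of these edges become the ends `2` and `3` of the new crossing. -/
def addDart : Dart n G.V → Dart n (Option G.V)
  | Sum.inl (w, k) => Sum.inl (some w, k)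
  | Sum.inr m => if m = i then Sum.inl (none, 2) else if m = finRotate _ i then Sum.inl (none, 3)
      else Sum.inr m

/-- The edges of the graph with an added crossing. -/
def addEdge : Dart n (Option G.V) → Dart n (Option G.V)
  | Sum.inl (none, k) => if k = 0 then Sum.inr (finRotate _ i) else if k = 1 then Sum.inr i
      else if k = 2 then G.addDart i (G.edge (Sum.inr i))
      else G.addDart i (G.edge (Sum.inr (finRotate _ i)))
  | Sum.inl (some w, k) => G.addDart i (G.edge (Sum.inl (w, k)))
  | Sum.inr m => if m = i then Sum.inl (none, 1) else if m = finRotate _ i then Sum.inl (none, 0)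
      else G.addDart i (G.edge (Sum.inr m))

theorem finRotate_ne : finRotate (2 * n) i ≠ i := by
  intro h
  have := congrArg Fin.val h
  rw [finRotate_val] at this
  split_ifs at this <;> omega

variable {G i}

theorem addDart_inl (w : G.V) (k : ZMod 4) :
    G.addDart i (Sum.inl (w, k)) = Sum.inl (some w, k) := rfl

theorem addDart_left : G.addDart i (Sum.inr i) = Sum.inl (none, 2) := by simp [addDart]

theorem addDart_right :
    G.addDart i (Sum.inr (finRotate _ i)) = Sum.inl (none, 3) := by
  simp only [addDart]
  rw [if_neg (finRotate_ne i), if_pos trivial]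

theorem addDart_of_ne {m : Fin (2 * n)} (h1 : m ≠ i) (h2 : m ≠ finRotate _ i) :
    G.addDart i (Sum.inr m) = Sum.inr m := by
  simp only [addDart]
  rw [if_neg h1, if_neg h2]

theorem addEdge_zero : G.addEdge i (Sum.inl (none, 0)) = Sum.inr (finRotate _ i) := by
  simp [addEdge]

theorem addEdge_one : G.addEdge i (Sum.inl (none, 1)) = Sum.inr i := by
  simp [addEdge, show (1 : ZMod 4) ≠ 0 by decide]

theorem addEdge_left : G.addEdge i (Sum.inr i) = Sum.inl (none, 1) := by simp [addEdge]

theorem addEdge_right :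
    G.addEdge i (Sum.inr (finRotate _ i)) = Sum.inl (none, 0) := by
  simp only [addEdge]
  rw [if_neg (finRotate_ne i), if_pos trivial]

theorem addEdge_addDart (x : Dart n G.V) :
    G.addEdge i (G.addDart i x) = G.addDart i (G.edge x) := by
  rcases x with ⟨w, k⟩ | m
  · rfl
  · by_cases h1 : m = i
    · subst h1
      rw [addDart_left]
      simp [addEdge, show (2 : ZMod 4) ≠ 0 by decide, show (2 : ZMod 4) ≠ 1 by decide]
    · by_cases h2 : m = finRotate _ i
      · subst h2
        rw [addDart_right]
        simp [addEdge, show (3 : ZMod 4) ≠ 0 by decide, show (3 : ZMod 4) ≠ 1 by decide,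
          show (3 : ZMod 4) ≠ 2 by decide]
      · rw [addDart_of_ne h1 h2]
        simp only [addEdge]
        rw [if_neg h1, if_neg h2]

theorem dart_cases (x : Dart n (Option G.V)) :
    (∃ y, x = G.addDart i y) ∨ x = Sum.inr i ∨ x = Sum.inr (finRotate _ i) ∨
      x = Sum.inl (none, 0) ∨ x = Sum.inl (none, 1) := by
  rcases x with ⟨_ | w, k⟩ | m
  · rcases ZMod.four_cases k with rfl | rfl | rfl | rfl
    · tauto
    · tauto
    · exact Or.inl ⟨_, addDart_left.symm⟩
    · exact Or.inl ⟨_, (addDart_right).symm⟩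
  · exact Or.inl ⟨Sum.inl (w, k), rfl⟩
  · by_cases h1 : m = i
    · tauto
    · by_cases h2 : m = finRotate _ i
      · tauto
      · exact Or.inl ⟨_, (addDart_of_ne h1 h2).symm⟩

theorem addDart_injective : Function.Injective (G.addDart i) := by
  have key : ∀ m, G.addDart i (Sum.inr m) = Sum.inl (none, 2) ∧ m = i ∨
      G.addDart i (Sum.inr m) = Sum.inl (none, 3) ∧ m = finRotate _ i ∨
      G.addDart i (Sum.inr m) = Sum.inr m := by
    intro m
    by_cases h1 : m = i
    · subst h1; exact Or.inl ⟨addDart_left, rfl⟩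
    · by_cases h2 : m = finRotate _ i
      · subst h2; exact Or.inr (Or.inl ⟨addDart_right, rfl⟩)
      · exact Or.inr (Or.inr (addDart_of_ne h1 h2))
  have h23 : (2 : ZMod 4) ≠ 3 := by decide
  rintro (⟨w, k⟩ | m) (⟨w', k'⟩ | m') h
  · simpa [addDart_inl] using h
  · rcases key m' with ⟨h1, -⟩ | ⟨h1, -⟩ | h1 <;> simp [addDart_inl, h1] at h
  · rcases key m with ⟨h1, -⟩ | ⟨h1, -⟩ | h1 <;> simp [addDart_inl, h1] at h
  · rcases key m with ⟨h1, h2⟩ | ⟨h1, h2⟩ | h1 <;>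
      rcases key m' with ⟨h3, h4⟩ | ⟨h3, h4⟩ | h3 <;> rw [h1, h3] at h
    · rw [h2, h4]
    · exact absurd (Prod.ext_iff.1 (Sum.inl.inj h)).2 h23
    · simp at h
    · exact absurd (Prod.ext_iff.1 (Sum.inl.inj h)).2 h23.symm
    · rw [h2, h4]
    · simp at h
    · simp at h
    · simp at h
    · exact congrArg Sum.inr (Sum.inr.inj h)

theorem addEdge_addEdge (x : Dart n (Option G.V)) :
    G.addEdge i (G.addEdge i x) = x := by
  rcases dart_cases (i := i) x with ⟨y, rfl⟩ | rfl | rfl | rfl | rfl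
  · rw [addEdge_addDart, addEdge_addDart, G.edge_invol]
  · rw [addEdge_left, addEdge_one]
  · rw [addEdge_right, addEdge_zero]
  · rw [addEdge_zero, addEdge_right]
  · rw [addEdge_one, addEdge_left]

theorem addEdge_ne (x : Dart n (Option G.V)) : G.addEdge i x ≠ x := by
  rcases dart_cases (i := i) x with ⟨y, rfl⟩ | rfl | rfl | rfl | rfl
  · rw [addEdge_addDart]
    exact fun h => G.edge_ne_self y (addDart_injective h)
  · rw [addEdge_left]; exact Sum.inl_ne_inr
  · rw [addEdge_right]; exact Sum.inl_ne_inr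
  · rw [addEdge_zero]; exact Sum.inr_ne_inl
  · rw [addEdge_one]; exact Sum.inr_ne_inl

variable (G i) in
/-- `addEdge` as a permutation. -/
def addEdgePerm : Equiv.Perm (Dart n (Option G.V)) :=
  ⟨G.addEdge i, G.addEdge i, addEdge_addEdge, addEdge_addEdge⟩

/-- The sum of the weights at the new crossing is zero, so the weights at its ends `2` and `3` have
the same sum as those at `i` and `i + 1`. A cycle thus restricts to the old graph, and only the
small new face between the crossing and the boundary still needs a colour. -/
theorem cyclesBound_addEdge (hn : 0 < n) : CyclesBound (G.addEdgePerm i) := by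
  intro w hw hwv hwb
  have hE : ∀ x, G.addEdgePerm i x = G.addEdge i x := fun x => rfl
  simp only [hE] at hw ⊢
  set j := finRotate (2 * n) i with hj
  have hji : j ≠ i := finRotate_ne i
  have w1 : w (Sum.inl (none, 1)) = w (Sum.inr i) := by rw [← addEdge_left, hw]
  have w0 : w (Sum.inl (none, 0)) = w (Sum.inr j) := by rw [← addEdge_right, hw]
  have hv := hwv none
  rw [ZMod.sum_four, w0, w1] at hv
  have hsum : ∑ m, w (G.addDart i (Sum.inr m)) = 0 := by
    have hsplit : ∀ f : Fin (2 * n) → ZMod 2,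
        ∑ m, f m = f i + (f j + ∑ m ∈ (Finset.univ.erase i).erase j, f m) := by
      intro f
      rw [Finset.add_sum_erase _ f (by simp [hji]), Finset.add_sum_erase _ f (by simp)]
    rw [hsplit] at hwb ⊢
    have : ∑ m ∈ (Finset.univ.erase i).erase j, w (G.addDart i (Sum.inr m)) =
        ∑ m ∈ (Finset.univ.erase i).erase j, w (Sum.inr m) := by
      refine Finset.sum_congr rfl fun m hm => ?_
      simp only [Finset.mem_erase, Finset.mem_univ, and_true] at hm
      rw [addDart_of_ne hm.2 hm.1]
    rw [this, addDart_left, hj, addDart_right, ← hj]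
    clear this hsplit hw hwv w0 w1
    generalize w (Sum.inl (none, 2)) = a at *
    generalize w (Sum.inl (none, 3)) = b at *
    generalize w (Sum.inr i) = c at *
    generalize w (Sum.inr j) = d at *
    generalize ∑ m ∈ (Finset.univ.erase i).erase j, w (Sum.inr m) = e at *
    clear * - hwb hv
    revert a b c d e
    decide
  obtain ⟨χ, h1, h2⟩ := G.cyclesBound hn (fun x => w (G.addDart i x))
    (fun x => by rw [← addEdge_addDart, hw]) (fun v => hwv (some v)) hsum
  have hχj : χ (Sum.inr j) = χ (Sum.inr i) + w (Sum.inl (none, 2)) := by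
    have := h1 (Sum.inr i)
    rwa [dartRotation_inr, addDart_left] at this
  have hχj' : χ (Sum.inr (finRotate _ j)) = χ (Sum.inr j) + w (Sum.inl (none, 3)) := by
    have := h1 (Sum.inr j)
    rwa [dartRotation_inr, hj, addDart_right] at this
  -- Old faces keep their colours. The new face, seen from the end `1` of the crossing and from the
  -- boundary point `j`, is reached from the face at `i` by passing the new edge at `i`, hence the
  -- colour `χ (Sum.inr i) + w (Sum.inr i)`.
  let ψ : Dart n (Option G.V) → ZMod 2
    | Sum.inl (some u, k) => χ (Sum.inl (u, k))
    | Sum.inl (none, k) => if k = 0 then χ (Sum.inr (finRotate _ j))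
        else if k = 1 then χ (Sum.inr i) + w (Sum.inr i)
        else if k = 2 then χ (Sum.inr i) else χ (Sum.inr j)
    | Sum.inr m => if m = j then χ (Sum.inr i) + w (Sum.inr i) else χ (Sum.inr m)
  have p0 : ψ (Sum.inl (none, 0)) = χ (Sum.inr (finRotate _ j)) := by simp [ψ]
  have p1 : ψ (Sum.inl (none, 1)) = χ (Sum.inr i) + w (Sum.inr i) := by
    simp [ψ, show (1 : ZMod 4) ≠ 0 by decide]
  have p2 : ψ (Sum.inl (none, 2)) = χ (Sum.inr i) := by
    simp [ψ, show (2 : ZMod 4) ≠ 0 by decide, show (2 : ZMod 4) ≠ 1 by decide]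
  have p3 : ψ (Sum.inl (none, 3)) = χ (Sum.inr j) := by
    simp [ψ, show (3 : ZMod 4) ≠ 0 by decide, show (3 : ZMod 4) ≠ 1 by decide,
      show (3 : ZMod 4) ≠ 2 by decide]
  have pj : ψ (Sum.inr j) = χ (Sum.inr i) + w (Sum.inr i) := by simp [ψ]
  have pr : ∀ m, m ≠ j → ψ (Sum.inr m) = χ (Sum.inr m) := fun m hm => by simp [ψ, hm]
  have pi : ψ (Sum.inr i) = χ (Sum.inr i) := pr i hji.symm
  have prj : ψ (Sum.inr (finRotate _ j)) = χ (Sum.inr (finRotate _ j)) := pr _ (finRotate_ne j)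
  have hψ : ∀ x, ψ (G.addDart i x) = χ x := by
    rintro (⟨u, k⟩ | m)
    · rfl
    · by_cases hm1 : m = i
      · subst hm1; rw [addDart_left, p2]
      · by_cases hm2 : m = j
        · subst hm2; rw [addDart_right, p3]
        · rw [addDart_of_ne hm1 hm2, pr m hm2]
  have hψ2 : ∀ x, ψ (dartRotation n _ (G.addDart i x)) = χ (dartRotation n G.V x) := by
    rintro (⟨u, k⟩ | m)
    · rfl
    · by_cases hm1 : m = i
      · subst hm1
        rw [addDart_left, dartRotation_inl, two_add_one_eq_three, p3, dartRotation_inr]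
      · by_cases hm2 : m = j
        · subst hm2
          rw [addDart_right, dartRotation_inl, show (3 : ZMod 4) + 1 = 0 from rfl, p0,
            dartRotation_inr]
        · rw [addDart_of_ne hm1 hm2, dartRotation_inr, dartRotation_inr, pr]
          intro h
          exact hm1 ((finRotate (2 * n)).injective h)
  refine ⟨ψ, fun x => ?_, fun x => ?_⟩
  · rcases dart_cases (i := i) x with ⟨y, rfl⟩ | rfl | rfl | rfl | rfl
    · rw [hψ2, hψ, h1]
    · rw [dartRotation_inr, pi, pj]
    · rw [dartRotation_inr, ← hj, pj, prj, hχj', hχj]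
      generalize w (Sum.inl (none, 2)) = a at *
      generalize w (Sum.inl (none, 3)) = b at *
      generalize w (Sum.inr i) = c at *
      generalize w (Sum.inr j) = d at *
      generalize χ (Sum.inr i) = e at *
      clear * - hv
      revert a b c d e
      decide
    · rw [dartRotation_inl, zero_add, p1, p0, hχj', hχj, w0]
      generalize w (Sum.inl (none, 2)) = a at *
      generalize w (Sum.inl (none, 3)) = b at *
      generalize w (Sum.inr i) = c at *
      generalize w (Sum.inr j) = d at *
      generalize χ (Sum.inr i) = e at *
      clear * - hv
      revert a b c d e
      decide
    · rw [dartRotation_inl, one_add_one_eq_two, p2, p1, w1, add_assoc, CharTwo.add_self_eq_zero,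
        add_zero]
  · rcases dart_cases (i := i) x with ⟨y, rfl⟩ | rfl | rfl | rfl | rfl
    · rw [addEdge_addDart, hψ2, h2, hψ]
    · rw [addEdge_left, dartRotation_inl, one_add_one_eq_two, p2, pi]
    · rw [addEdge_right, dartRotation_inl, zero_add, p1, pj]
    · rw [addEdge_zero, dartRotation_inr, ← hj, prj, p0]
    · rw [addEdge_one, dartRotation_inr, ← hj, pj, p1]

variable (G i) in
/-- The graph with a crossing added next to the boundary points `i` and `i + 1`. -/
def addCrossing (hn : 0 < n) : MedialGraph n where
  V := Option G.V
  finite := have := G.finite; inferInstance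
  edge := G.addEdgePerm i
  edge_invol := addEdge_addEdge
  edge_ne_self := addEdge_ne
  planar :=
    have := G.finite
    (planar_iff_cyclesBound hn (G.addEdgePerm i) (addEdge_addEdge) (addEdge_ne)).2
      (cyclesBound_addEdge hn)

/-- Adding a crossing of two disjoint chords at adjacent boundary points. -/
theorem Represents.addCrossing {τ : Matching n} (hτ : G.Represents τ) (hn : 0 < n)
    (hG : G.Lensless) (hi : τ i ≠ finRotate _ i) (hint : τ.interlace i (finRotate _ i) ≠ 1) :
    (G.addCrossing i hn).Lensless ∧
      (G.addCrossing i hn).Represents (τ.conjSwap i (finRotate _ i)) := by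
  set j := finRotate (2 * n) i with hj
  have hji : j ≠ i := finRotate_ne i
  obtain ⟨W, hW⟩ : ∃ W : Dart n (Option G.V) → (G.addCrossing i hn).Wire,
      W = (G.addCrossing i hn).wire := ⟨_, rfl⟩
  have we : ∀ x, W (G.addEdge i x) = W x := by
    rw [hW]; exact (G.addCrossing i hn).wire_edge
  have ws : ∀ (v : Option G.V) (k : ZMod 4), W (Sum.inl (v, k + 2)) = W (Sum.inl (v, k)) := by
    rw [hW]; exact (G.addCrossing i hn).wire_add_two
  have weq : ∀ {T : Type} (f : Dart n (Option G.V) → T), (∀ x, f (G.addEdge i x) = f x) →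
      (∀ w k, f (Sum.inl (w, k + 2)) = f (Sum.inl (w, k))) → ∀ {x y}, W x = W y → f x = f y := by
    rw [hW]; exact eq_of_wire_eq (G := G.addCrossing i hn)
  have w20 : W (Sum.inl (none, 2)) = W (Sum.inl (none, 0)) := ws none 0
  have w31 : W (Sum.inl (none, 3)) = W (Sum.inl (none, 1)) := ws none 1
  have w0j : W (Sum.inr j) = W (Sum.inl (none, 0)) := by
    rw [← addEdge_right (G := G), we]
  have w1i : W (Sum.inr i) = W (Sum.inl (none, 1)) := by
    rw [← addEdge_left (G := G), we]
  have hfwd : ∀ {x y}, G.wire x = G.wire y →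
      W (G.addDart i x) = W (G.addDart i y) := by
    intro x y h
    refine eq_of_wire_eq (fun x => W (G.addDart i x)) (fun x => ?_) (fun w k => ?_) h
    · rw [← addEdge_addDart, we]
    · exact ws (some w) k
  have hs : ∀ m, W (G.addDart i (Sum.inr m)) = W (Sum.inr (Equiv.swap i j m)) := by
    intro m
    by_cases h1 : m = i
    · subst h1
      rw [addDart_left, Equiv.swap_apply_left, w0j, w20]
    · by_cases h2 : m = j
      · subst h2
        rw [addDart_right, Equiv.swap_apply_right, w1i, w31]
      · rw [addDart_of_ne h1 h2, Equiv.swap_apply_of_ne_of_ne h1 h2]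
  -- Every new wire is an old wire with a possibly exchanged end: going straight through the new
  -- crossing, the old wire at `i` now ends at `j`, and conversely.
  let lab : Dart n (Option G.V) → G.Wire
    | Sum.inl (some u, k) => G.wire (Sum.inl (u, k))
    | Sum.inl (none, k) => if k = 0 ∨ k = 2 then G.wire (Sum.inr i) else G.wire (Sum.inr j)
    | Sum.inr m => G.wire (Sum.inr (Equiv.swap i j m))
  have labk : ∀ k, lab (Sum.inl (none, k)) =
      if k = 0 ∨ k = 2 then G.wire (Sum.inr i) else G.wire (Sum.inr j) := fun k => rfl
  have lab0 : lab (Sum.inl (none, 0)) = G.wire (Sum.inr i) := by rw [labk]; simp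
  have lab1 : lab (Sum.inl (none, 1)) = G.wire (Sum.inr j) := by
    rw [labk]; simp [show ¬ ((1 : ZMod 4) = 0 ∨ (1 : ZMod 4) = 2) by decide]
  have labr : ∀ m, lab (Sum.inr m) = G.wire (Sum.inr (Equiv.swap i j m)) := fun m => rfl
  have hlabκ : ∀ x, lab (G.addDart i x) = G.wire x := by
    rintro (⟨u, k⟩ | m)
    · rfl
    · by_cases h1 : m = i
      · subst h1
        rw [addDart_left, labk, if_pos (Or.inr rfl)]
      · by_cases h2 : m = j
        · subst h2
          rw [addDart_right, labk, if_neg (by decide)]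
        · rw [addDart_of_ne h1 h2, labr, Equiv.swap_apply_of_ne_of_ne h1 h2]
  have hlab : ∀ {x y}, W x = W y → lab x = lab y := by
    intro x y h
    refine weq lab (fun x => ?_) (fun w k => ?_) h
    · rcases dart_cases (i := i) x with ⟨y, rfl⟩ | rfl | rfl | rfl | rfl
      · rw [addEdge_addDart, hlabκ, hlabκ, G.wire_edge]
      · rw [addEdge_left, lab1, labr, Equiv.swap_apply_left]
      · rw [addEdge_right, lab0, labr, Equiv.swap_apply_right]
      · rw [addEdge_zero, lab0, labr, Equiv.swap_apply_right]
      · rw [addEdge_one, lab1, labr, Equiv.swap_apply_left]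
    · rcases w with _ | w
      · rw [labk, labk]
        have : (k + 2 = 0 ∨ k + 2 = 2) ↔ (k = 0 ∨ k = 2) := by clear * -; revert k; decide
        simp only [this]
      · exact G.wire_add_two w k
  have hcover : ∀ x, ∃ y, W x = W (G.addDart i y) := by
    intro x
    rcases dart_cases (i := i) x with ⟨y, rfl⟩ | rfl | rfl | rfl | rfl
    · exact ⟨y, rfl⟩
    · exact ⟨Sum.inr j, by rw [hs, Equiv.swap_apply_right]⟩
    · exact ⟨Sum.inr i, by rw [hs, Equiv.swap_apply_left]⟩
    · exact ⟨Sum.inr i, by rw [hs, Equiv.swap_apply_left, w0j]⟩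
    · exact ⟨Sum.inr j, by rw [hs, Equiv.swap_apply_right, w1i]⟩
  have hiff : ∀ x y, W x = W y ↔ lab x = lab y := by
    intro x y
    refine ⟨hlab, fun h => ?_⟩
    obtain ⟨x', hx⟩ := hcover x
    obtain ⟨y', hy⟩ := hcover y
    rw [hlab hx, hlab hy, hlabκ, hlabκ] at h
    rw [hx, hy, hfwd h]
  have hij : G.wire (Sum.inr i) ≠ G.wire (Sum.inr j) := by
    rw [ne_eq, eq_comm, hτ.wire_eq_iff]
    rintro (h | h)
    exacts [hji h, hi h.symm]
  have hno : ∀ v, ¬ G.CrossAt v (G.wire (Sum.inr i)) (G.wire (Sum.inr j)) := fun v hv =>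
    hint (hτ.interlace_eq_one_of_crossAt hn hG hij hv)
  have hends : ∀ x, ∃ m, W x = W (Sum.inr m) := by
    intro x
    obtain ⟨y, hy⟩ := hcover x
    obtain ⟨m, hm⟩ := hG.ends y
    exact ⟨Equiv.swap i j m, hy.trans ((hfwd hm).trans (hs m))⟩
  have hself : ∀ v k, W (Sum.inl (v, k)) ≠ W (Sum.inl (v, k + 1)) := by
    intro v k h
    have h1 := hlab h
    rcases v with _ | v
    · rw [labk, labk] at h1
      rcases ZMod.four_cases k with rfl | rfl | rfl | rfl
      · rw [if_pos (by decide), if_neg (by decide)] at h1; exact hij h1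
      · rw [if_neg (by decide), if_pos (by decide)] at h1; exact hij h1.symm
      · rw [if_pos (by decide), if_neg (by decide)] at h1; exact hij h1
      · rw [if_neg (by decide), if_pos (by decide)] at h1; exact hij h1.symm
    · exact hG.no_self_crossing v k h1
  have hlens : ∀ x y v w, W x ≠ W y → (∃ k, W (Sum.inl (v, k)) = W x) →
      (∃ k, W (Sum.inl (v, k)) = W y) → (∃ k, W (Sum.inl (w, k)) = W x) →
      (∃ k, W (Sum.inl (w, k)) = W y) → v = w := by
    intro x y v w hpq hvp hvq hwp hwq
    have hp' : lab x ≠ lab y := fun h => hpq ((hiff x y).2 h)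
    have hon : ∀ (u : G.V) z, (∃ k, W (Sum.inl (some u, k)) = W z) → G.OnWire u (lab z) := by
      rintro u z ⟨k, hk⟩
      exact ⟨k, hlab hk⟩
    have hnone : ∀ z, (∃ k, W (Sum.inl (none, k)) = W z) →
        lab z = G.wire (Sum.inr i) ∨ lab z = G.wire (Sum.inr j) := by
      rintro z ⟨k, hk⟩
      rw [← hlab hk, labk]
      split_ifs
      exacts [Or.inl rfl, Or.inr rfl]
    -- Two wires that meet at the new crossing come from the old wires at `i` and `j`. Those do not
    -- cross anywhere in `G`, so no lens arises.
    have hmix : ∀ u : G.V, G.OnWire u (lab x) → G.OnWire u (lab y) →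
        (∃ k, W (Sum.inl (none, k)) = W x) → (∃ k, W (Sum.inl (none, k)) = W y) → False := by
      intro u h5 h6 h3 h4
      rcases hnone x h3 with h7 | h7 <;> rcases hnone y h4 with h8 | h8
      · exact hp' (h7.trans h8.symm)
      · rw [h7] at h5; rw [h8] at h6
        exact hno u (crossAt_of_onWire hij h5 h6)
      · rw [h7] at h5; rw [h8] at h6
        exact hno u (crossAt_of_onWire hij h6 h5)
      · exact hp' (h7.trans h8.symm)
    rcases v with _ | v <;> rcases w with _ | w
    · rfl
    · exact (hmix w (hon w x hwp) (hon w y hwq) hvp hvq).elim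
    · exact (hmix v (hon v x hvp) (hon v y hvq) hwp hwq).elim
    · exact congrArg some (hG.no_lens _ _ v w hp' (hon v x hvp) (hon v y hvq) (hon w x hwp)
        (hon w y hwq))
  have hrep : ∀ a b, a ≠ b →
      (W (Sum.inr a) = W (Sum.inr b) ↔ τ.conjSwap i j a = b) := by
    intro a b hab
    rw [hiff, labr, labr, hτ _ _ (fun h => hab ((Equiv.swap i j).injective h)),
      Matching.conjSwap_apply]
    constructor
    · intro h; rw [h, Equiv.swap_apply_self]
    · intro h; rw [← h, Equiv.swap_apply_self]
  subst hW
  refine ⟨⟨hends, hself, fun p q v w => ?_⟩, hrep⟩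
  obtain ⟨x, rfl⟩ := Quot.exists_rep p
  obtain ⟨y, rfl⟩ := Quot.exists_rep q
  exact hlens x y v w

end AddCrossing

/-- A matching with a lensless graph in which any two chords at adjacent points cross. -/
theorem exists_lensless_adjacent (hn : 0 < n) : ∃ (τ : Matching n) (G : MedialGraph n),
    G.Lensless ∧ G.Represents τ ∧
      ∀ i, τ i ≠ finRotate _ i → τ.interlace i (finRotate _ i) = 1 := by
  by_contra! hno
  have key : ∀ m : ℕ, ∃ (τ : Matching n) (G : MedialGraph n),
      G.Lensless ∧ G.Represents τ ∧ m ≤ G.crossings := by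
    intro m
    induction m with
    | zero =>
      obtain ⟨G, h1, h2⟩ := exists_lensless_rainbow hn
      exact ⟨_, G, h1, h2, Nat.zero_le _⟩
    | succ m ih =>
      obtain ⟨τ, G, h1, h2, h3⟩ := ih
      obtain ⟨i, h4, h5⟩ := hno τ G h1 h2
      obtain ⟨h6, h7⟩ := h2.addCrossing hn h1 h4 h5
      refine ⟨_, _, h6, h7, ?_⟩
      have := G.finite
      have h8 : (G.addCrossing i hn).crossings = G.crossings + 1 := Finite.card_option
      omega
  -- The number of crossings of a lensless graph is at most the number of pairs of points, so
  -- crossings cannot be added without end.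
  obtain ⟨τ, G, h1, h2, h3⟩ := key (Fintype.card (Fin (2 * n) × Fin (2 * n)) + 1)
  rw [h2.crossings_eq hn h1, Matching.cross] at h3
  have := Finset.card_le_univ τ.crossingPairs
  omega

end MedialGraph

/-! ### Affine transpositions and Bruhat order -/

section Transposition

variable {N : ℕ} {a b : ℤ}

theorem modEq_iff_exists {x y : ℤ} : x ≡ y [ZMOD N] ↔ ∃ r : ℤ, x = y + N * r := by
  constructor
  · intro h
    obtain ⟨c, hc⟩ := h.symm.dvd
    exact ⟨c, by linarith⟩
  · rintro ⟨r, rfl⟩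
    simp [Int.ModEq]

theorem affineTransposition_left (r : ℤ) :
    affineTransposition N a b (a + N * r) = b + N * r := by
  rw [affineTransposition, if_pos (modEq_iff_exists.2 ⟨r, rfl⟩)]
  ring

theorem affineTransposition_right (hab : ¬ a ≡ b [ZMOD N]) (r : ℤ) :
    affineTransposition N a b (b + N * r) = a + N * r := by
  have h : b + N * r ≡ b [ZMOD N] := modEq_iff_exists.2 ⟨r, rfl⟩
  rw [affineTransposition, if_neg (fun h' => hab (h'.symm.trans h)), if_pos h]
  ring

theorem affineTransposition_of_not {z : ℤ} (h1 : ¬ z ≡ a [ZMOD N]) (h2 : ¬ z ≡ b [ZMOD N]) :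
    affineTransposition N a b z = z := by
  rw [affineTransposition, if_neg h1, if_neg h2]

theorem affineTransposition_cases (hab : ¬ a ≡ b [ZMOD N]) (z : ℤ) :
    (¬ z ≡ a [ZMOD N] ∧ ¬ z ≡ b [ZMOD N] ∧ affineTransposition N a b z = z) ∨
    (∃ r : ℤ, z = a + N * r ∧ affineTransposition N a b z = b + N * r) ∨
    ∃ r : ℤ, z = b + N * r ∧ affineTransposition N a b z = a + N * r := by
  by_cases h1 : z ≡ a [ZMOD N]
  · obtain ⟨r, rfl⟩ := modEq_iff_exists.1 h1
    exact Or.inr (Or.inl ⟨r, rfl, affineTransposition_left r⟩)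
  · by_cases h2 : z ≡ b [ZMOD N]
    · obtain ⟨r, rfl⟩ := modEq_iff_exists.1 h2
      exact Or.inr (Or.inr ⟨r, rfl, affineTransposition_right hab r⟩)
    · exact Or.inl ⟨h1, h2, affineTransposition_of_not h1 h2⟩

theorem affineTransposition_self (hab : ¬ a ≡ b [ZMOD N]) (z : ℤ) :
    affineTransposition N a b (affineTransposition N a b z) = z := by
  rcases affineTransposition_cases hab z with ⟨-, -, h⟩ | ⟨r, h1, h2⟩ | ⟨r, h1, h2⟩
  · rw [h, h]
  · rw [h2, affineTransposition_right hab, h1]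
  · rw [h2, affineTransposition_left, h1]

theorem affineTransposition_add (hab : ¬ a ≡ b [ZMOD N]) (z q : ℤ) :
    affineTransposition N a b (z + N * q) = affineTransposition N a b z + N * q := by
  rcases affineTransposition_cases hab z with ⟨h1, h2, h⟩ | ⟨r, h1, h2⟩ | ⟨r, h1, h2⟩
  · have h3 : z + N * q ≡ z [ZMOD N] := modEq_iff_exists.2 ⟨q, rfl⟩
    rw [h, affineTransposition_of_not (fun h' => h1 (h3.symm.trans h'))
      (fun h' => h2 (h3.symm.trans h'))]
  · rw [h2, h1, add_assoc, ← mul_add, affineTransposition_left]; ring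
  · rw [h2, h1, add_assoc, ← mul_add, affineTransposition_right hab]; ring

theorem affineTransposition_comm (hab : ¬ a ≡ b [ZMOD N]) (z : ℤ) :
    affineTransposition N a b z = affineTransposition N b a z := by
  have hba : ¬ b ≡ a [ZMOD N] := fun h => hab h.symm
  rcases affineTransposition_cases hab z with ⟨h1, h2, h⟩ | ⟨r, h1, h2⟩ | ⟨r, h1, h2⟩
  · rw [h, affineTransposition_of_not h2 h1]
  · rw [h2, h1, affineTransposition_right hba]
  · rw [h2, h1, affineTransposition_left]

/-- An affine permutation carries transpositions of positions to transpositions of values. -/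
theorem affineTransposition_apply {f : ℤ → ℤ} (hf : Function.Injective f)
    (hper : ∀ z q : ℤ, f (z + N * q) = f z + N * q) {i j : ℤ} (hij : ¬ i ≡ j [ZMOD N]) (z : ℤ) :
    affineTransposition N (f i) (f j) (f z) = f (affineTransposition N i j z) := by
  have hmod : ∀ x y, f x ≡ f y [ZMOD N] → x ≡ y [ZMOD N] := by
    intro x y h
    obtain ⟨r, hr⟩ := modEq_iff_exists.1 h
    rw [← hper] at hr
    exact modEq_iff_exists.2 ⟨r, hf hr⟩
  rcases affineTransposition_cases hij z with ⟨h1, h2, h⟩ | ⟨r, h1, h2⟩ | ⟨r, h1, h2⟩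
  · rw [h, affineTransposition_of_not (fun h => h1 (hmod _ _ h)) (fun h => h2 (hmod _ _ h))]
  · rw [h2, h1, hper, hper, affineTransposition_left]
  · rw [h2, h1, hper, hper, affineTransposition_right (fun h => hij (hmod _ _ h))]

end Transposition

/-- The number of positions `z ≥ x` with value `f z ≤ y`. -/
noncomputable def innerCount (f : ℤ → ℤ) (x y : ℤ) : ℕ := {z : ℤ | x ≤ z ∧ f z ≤ y}.ncard

/-! ### Change of the counts under one transposition -/

section Step

variable {N : ℕ} {f : ℤ → ℤ} {i j : ℤ}

/-- A counted position that stops being counted must be `i + N * r`, since its value grew. It is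
replaced by the partner `j + N * r`, which is further right and now carries the small value. -/
theorem innerCount_le_comp (hper : ∀ z q : ℤ, f (z + N * q) = f z + N * q)
    (hij : ¬ i ≡ j [ZMOD N]) (hlt : i < j) (hflt : f i < f j) (x y : ℤ)
    (hfin : {z : ℤ | x ≤ z ∧ f (affineTransposition N i j z) ≤ y}.Finite) :
    innerCount f x y ≤ innerCount (fun z => f (affineTransposition N i j z)) x y := by
  classical
  set T := affineTransposition N i j
  refine Set.ncard_le_ncard_of_injOn (fun z => if f (T z) ≤ y then z else T z) ?_ ?_ hfin
  · rintro z ⟨h1, h2⟩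
    simp only [Set.mem_ofPred_eq]
    split_ifs with h
    · exact ⟨h1, h⟩
    · have hTT : T (T z) = z := affineTransposition_self hij z
      refine ⟨?_, by rwa [hTT]⟩
      rcases affineTransposition_cases hij z with ⟨-, -, h3⟩ | ⟨r, h3, h4⟩ | ⟨r, h3, h4⟩
      · change ¬ f (affineTransposition N i j z) ≤ y at h
        rw [h3] at h
        exact absurd h2 h
      · change x ≤ affineTransposition N i j z
        linarith
      · change ¬ f (affineTransposition N i j z) ≤ y at h
        rw [h4, hper] at h
        rw [h3, hper] at h2
        linarith
  · rintro z ⟨-, h2⟩ z' ⟨-, h2'⟩ h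
    simp only at h
    split_ifs at h with h3 h4 h4
    · exact h
    · exact absurd (h ▸ h2) h4
    · exact absurd (h ▸ h2') h3
    · rw [← affineTransposition_self hij z, ← affineTransposition_self hij z']
      exact congrArg _ h

/-- The exchange can create new counts only at positions `j + N * r` where the corner `(x, y)` lies
in the rectangle spanned by the two exchanged points. The set `s` is meant to absorb these
exceptions; everything else injects back. -/
theorem innerCount_comp_le (hper : ∀ z q : ℤ, f (z + N * q) = f z + N * q)
    (hij : ¬ i ≡ j [ZMOD N]) (hflt : f i < f j) (x y : ℤ) (s : Set ℤ)
    (hs : ∀ r : ℤ, i + N * r < x → x ≤ j + N * r → f i + N * r ≤ y → y < f j + N * r →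
      j + N * r ∈ s) (hfin : {z : ℤ | x ≤ z ∧ f z ≤ y}.Finite) :
    ({z : ℤ | x ≤ z ∧ f (affineTransposition N i j z) ≤ y} \ s).ncard ≤ innerCount f x y := by
  classical
  set T := affineTransposition N i j
  refine Set.ncard_le_ncard_of_injOn (fun z => if f z ≤ y then z else T z) ?_ ?_ hfin
  · rintro z ⟨⟨h1, h2⟩, hzs⟩
    simp only [Set.mem_ofPred_eq]
    split_ifs with h
    · exact ⟨h1, h⟩
    · refine ⟨?_, h2⟩
      rcases affineTransposition_cases hij z with ⟨-, -, h3⟩ | ⟨r, h3, h4⟩ | ⟨r, h3, h4⟩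
      · change f (affineTransposition N i j z) ≤ y at h2
        rw [h3] at h2
        exact absurd h2 h
      · change f (affineTransposition N i j z) ≤ y at h2
        rw [h4, hper] at h2
        rw [h3, hper] at h
        linarith
      · change f (affineTransposition N i j z) ≤ y at h2
        change x ≤ affineTransposition N i j z
        rw [h4] at h2 ⊢
        rw [hper] at h2
        rw [h3] at hzs h h1
        rw [hper] at h
        by_contra hx
        exact hzs (hs r (by linarith) h1 h2 (by linarith))
  · rintro z ⟨⟨-, h2⟩, -⟩ z' ⟨⟨-, h2'⟩, -⟩ h
    simp only at h
    split_ifs at h with h3 h4 h4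
    · exact h
    · rw [h] at h2
      change f (affineTransposition N i j (affineTransposition N i j z')) ≤ y at h2
      rw [affineTransposition_self hij] at h2
      exact absurd h2 h4
    · rw [← h] at h2'
      change f (affineTransposition N i j (affineTransposition N i j z)) ≤ y at h2'
      rw [affineTransposition_self hij] at h2'
      exact absurd h2' h3
    · rw [← affineTransposition_self hij z, ← affineTransposition_self hij z']
      exact congrArg _ h

end Step

theorem exists_le_sub_of_periodic {N : ℕ} (hN : 0 < N) {f : ℤ → ℤ}
    (hper : ∀ z q : ℤ, f (z + N * q) = f z + N * q) : ∃ m : ℤ, ∀ z, m ≤ f z - z := by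
  obtain ⟨m, hm⟩ := ((Finset.Ico (0 : ℤ) N).image fun r => f r - r).bddBelow
  refine ⟨m, fun j => ?_⟩
  have h := hper (j % N) (j / N)
  rw [Int.emod_add_mul_ediv] at h
  have h1 := Int.emod_nonneg j (b := (N : ℤ)) (by omega)
  have h2 := Int.emod_lt_of_pos j (b := (N : ℤ)) (by omega)
  have h3 := hm (Finset.mem_coe.2 (Finset.mem_image.2
    ⟨j % N, Finset.mem_Ico.2 ⟨h1, h2⟩, rfl⟩))
  have h4 := Int.emod_add_mul_ediv j N
  linarith

theorem finite_innerCount {N : ℕ} (hN : 0 < N) {f : ℤ → ℤ}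
    (hper : ∀ z q : ℤ, f (z + N * q) = f z + N * q) (x y : ℤ) :
    {z : ℤ | x ≤ z ∧ f z ≤ y}.Finite := by
  obtain ⟨m, hm⟩ := exists_le_sub_of_periodic hN hper
  refine (Set.finite_Icc x (y - m)).subset ?_
  rintro z ⟨h1, h2⟩
  exact ⟨h1, by linarith [hm z]⟩

/-! ### Length and Bruhat order through exchanges of positions -/

namespace AffinePerm

variable {k : ℤ} {N : ℕ}

theorem injective (f : AffinePerm k N) : Function.Injective f := f.toPerm.injective

theorem mem_inversions {f : AffinePerm k N} {p : ℤ × ℤ} :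
    p ∈ f.inversions ↔ 1 ≤ p.1 ∧ p.1 ≤ N ∧ p.1 < p.2 ∧ f p.2 < f p.1 := Iff.rfl

/-- Translation of a pair so that its first element lies in `{1, …, N}`. -/
def normalize (N : ℕ) (p : ℤ × ℤ) : ℤ × ℤ :=
  (p.1 + N * -((p.1 - 1) / N), p.2 + N * -((p.1 - 1) / N))

theorem normalize_mem (hN : 0 < N) {f : AffinePerm k N} {p : ℤ × ℤ} (h1 : p.1 < p.2)
    (h2 : f p.2 < f p.1) : normalize N p ∈ f.inversions := by
  rw [mem_inversions]
  simp only [normalize, f.shift_zmul]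
  have h3 := Int.emod_nonneg (p.1 - 1) (b := (N : ℤ)) (by omega)
  have h4 := Int.emod_lt_of_pos (p.1 - 1) (b := (N : ℤ)) (by omega)
  have h5 := Int.emod_add_mul_ediv (p.1 - 1) N
  refine ⟨by linarith, by linarith, by linarith, by linarith⟩

/-- Exchanging two values that are in increasing order makes an affine permutation longer. -/
theorem length_lt_of_comp (hN : 0 < N) {f g : AffinePerm k N} {i j : ℤ}
    (hij : ¬ i ≡ j [ZMOD N]) (hlt : i < j) (hflt : f i < f j)
    (hg : ∀ z, g z = f (affineTransposition N i j z)) : f.length < g.length := by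
  classical
  set T := affineTransposition N i j
  have hTT : ∀ z, T (T z) = z := affineTransposition_self hij
  have hgT : ∀ z, g (T z) = f z := fun z => by rw [hg, hTT]
  have hTadd : ∀ z q, T (z + N * q) = T z + N * q := affineTransposition_add hij
  have hTi : ∀ r : ℤ, T (i + N * r) = j + N * r := affineTransposition_left
  have hTj : ∀ r : ℤ, T (j + N * r) = i + N * r := affineTransposition_right hij
  -- An inversion of `f` is moved along with the transposition if it stays in increasing position
  -- order; otherwise it is still an inversion of `g` at the same positions. The inversion of `g` at
  -- `(i, j)` is not reached.
  let F : ℤ × ℤ → ℤ × ℤ := fun p => if T p.1 < T p.2 then normalize N (T p.1, T p.2) else p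
  have hgi : g i = f j := by
    have := hTi 0
    simp only [mul_zero, add_zero] at this
    rw [hg, this]
  have hgj : g j = f i := by
    have := hTj 0
    simp only [mul_zero, add_zero] at this
    rw [hg, this]
  have hb0 : normalize N (i, j) ∈ g.inversions := normalize_mem hN hlt (by
    simp only [hgi, hgj]; exact hflt)
  have hmaps : ∀ p ∈ f.inversions, F p ∈ g.inversions ∧ F p ≠ normalize N (i, j) := by
    rintro ⟨x, y⟩ hp
    obtain ⟨h1, h2, h3, h4⟩ := mem_inversions.1 hp
    simp only at h1 h2 h3 h4
    by_cases h : T x < T y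
    · have hF : F (x, y) = normalize N (T x, T y) := if_pos h
      rw [hF]
      refine ⟨normalize_mem hN h (by simp only [hgT]; exact h4), ?_⟩
      intro h5
      simp only [normalize, Prod.mk.injEq] at h5
      obtain ⟨h5, h6⟩ := h5
      have e1 : T x = i + N * ((T x - 1) / N - (i - 1) / N) := by
        rw [mul_sub]; linarith
      have e2 : T y = j + N * ((T x - 1) / N - (i - 1) / N) := by
        rw [mul_sub]; linarith
      have e3 := congrArg T e1
      have e4 := congrArg T e2
      rw [hTT, hTi] at e3
      rw [hTT, hTj] at e4
      linarith
    · have hF : F (x, y) = (x, y) := if_neg h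
      rw [hF]
      constructor
      · refine mem_inversions.2 ⟨h1, h2, h3, ?_⟩
        simp only
        rw [hg, hg]
        rcases affineTransposition_cases hij x with ⟨-, -, a1⟩ | ⟨r, a1, a2⟩ | ⟨r, a1, a2⟩ <;>
          rcases affineTransposition_cases hij y with ⟨-, -, b1⟩ | ⟨s, b1, b2⟩ | ⟨s, b1, b2⟩
        · change T x = x at a1
          change T y = y at b1
          rw [a1, b1] at h; exact absurd h3 h
        · change T x = x at a1
          change T y = _ at b2
          rw [a1, b2] at h; linarith
        · change T x = x at a1
          change T y = _ at b2
          rw [a1, b2, f.shift_zmul]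
          rw [b1, f.shift_zmul] at h4
          linarith
        · change T y = y at b1
          change T x = _ at a2
          rw [b1, a2, f.shift_zmul]
          rw [a1, f.shift_zmul] at h4
          linarith
        · change T x = _ at a2
          change T y = _ at b2
          rw [a2, b2] at h
          linarith
        · change T x = _ at a2
          change T y = _ at b2
          rw [a2, b2, f.shift_zmul, f.shift_zmul]
          rw [a1, b1, f.shift_zmul, f.shift_zmul] at h4
          linarith
        · change T y = y at b1
          change T x = _ at a2
          rw [b1, a2] at h
          linarith
        · change T x = _ at a2
          change T y = _ at b2
          rw [a2, b2] at h
          linarith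
        · change T x = _ at a2
          change T y = _ at b2
          rw [a2, b2] at h
          linarith
      · intro h5
        simp only [normalize, Prod.mk.injEq] at h5
        rw [h5.1, h5.2, f.shift_zmul, f.shift_zmul] at h4
        linarith
  have hinj : Set.InjOn F f.inversions := by
    rintro ⟨x, y⟩ hp ⟨x', y'⟩ hp' heq
    obtain ⟨h1, h2, h3, h4⟩ := mem_inversions.1 hp
    obtain ⟨h1', h2', h3', h4'⟩ := mem_inversions.1 hp'
    simp only at h1 h2 h3 h4 h1' h2' h3' h4'
    have hmix : ∀ x y x' y' : ℤ, T x < T y → ¬ T x' < T y' → x < y →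
        normalize N (T x, T y) ≠ (x', y') := by
      intro x y x' y' h h' hxy h5
      simp only [normalize, Prod.mk.injEq] at h5
      obtain ⟨h5, h6⟩ := h5
      refine h' ?_
      rw [← h5, ← h6, hTadd, hTadd, hTT, hTT]
      linarith
    by_cases h : T x < T y <;> by_cases h' : T x' < T y'
    · have hF : F (x, y) = normalize N (T x, T y) := if_pos h
      have hF' : F (x', y') = normalize N (T x', T y') := if_pos h'
      rw [hF, hF'] at heq
      simp only [normalize, Prod.mk.injEq] at heq
      obtain ⟨h5, h6⟩ := heq
      have e1 := congrArg T h5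
      have e2 := congrArg T h6
      rw [hTadd, hTadd, hTT, hTT] at e1 e2
      generalize -((T x - 1) / (N : ℤ)) = q at e1 e2
      generalize -((T x' - 1) / (N : ℤ)) = q' at e1 e2
      have hq : q = q' := by
        by_contra hne
        rcases lt_or_gt_of_ne hne with hlt | hlt
        · have : (N : ℤ) * (q' - q) ≥ N * 1 :=
            mul_le_mul_of_nonneg_left (by omega) (by omega)
          rw [mul_sub] at this
          linarith
        · have : (N : ℤ) * (q - q') ≥ N * 1 :=
            mul_le_mul_of_nonneg_left (by omega) (by omega)
          rw [mul_sub] at this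
          linarith
      subst hq
      rw [Prod.mk.injEq]
      exact ⟨by linarith, by linarith⟩
    · have hF : F (x, y) = normalize N (T x, T y) := if_pos h
      have hF' : F (x', y') = (x', y') := if_neg h'
      rw [hF, hF'] at heq
      exact absurd heq (hmix _ _ _ _ h h' h3)
    · have hF : F (x, y) = (x, y) := if_neg h
      have hF' : F (x', y') = normalize N (T x', T y') := if_pos h'
      rw [hF, hF'] at heq
      exact absurd heq.symm (hmix _ _ _ _ h' h h3')
    · have hF : F (x, y) = (x, y) := if_neg h
      have hF' : F (x', y') = (x', y') := if_neg h'
      rwa [hF, hF'] at heq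
  rw [length, length, ← hinj.ncard_image]
  refine Set.ncard_lt_ncard ⟨?_, ?_⟩ g.finite_inversions
  · rintro _ ⟨p, hp, rfl⟩
    exact (hmaps p hp).1
  · intro hsub
    obtain ⟨p, hp, hp'⟩ := hsub hb0
    exact (hmaps p hp).2 hp'

theorem modEq_of_apply (f : AffinePerm k N) {x y : ℤ} (h : f x ≡ f y [ZMOD N]) :
    x ≡ y [ZMOD N] := by
  obtain ⟨r, hr⟩ := modEq_iff_exists.1 h
  rw [← f.shift_zmul] at hr
  exact modEq_iff_exists.2 ⟨r, f.injective hr⟩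

/-- A step in Bruhat order exchanges two values that are in increasing order. -/
theorem BruhatStep.exists_lt (hN : 0 < N) {f g : AffinePerm k N} (h : BruhatStep f g) :
    ∃ i j, ¬ i ≡ j [ZMOD N] ∧ i < j ∧ f i < f j ∧
      ∀ z, g z = f (affineTransposition N i j z) := by
  obtain ⟨⟨a, b, hab, hg⟩, hlen⟩ := h
  obtain ⟨i, rfl⟩ := f.toPerm.surjective a
  obtain ⟨j, rfl⟩ := f.toPerm.surjective b
  have key : ∀ i j, ¬ f i ≡ f j [ZMOD N] → i < j →
      (∀ z, g z = affineTransposition N (f i) (f j) (f z)) →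
      ∃ i j, ¬ i ≡ j [ZMOD N] ∧ i < j ∧ f i < f j ∧
        ∀ z, g z = f (affineTransposition N i j z) := by
    intro i j hfij hlt hg
    have hij : ¬ i ≡ j [ZMOD N] := by
      intro h
      obtain ⟨r, rfl⟩ := modEq_iff_exists.1 h
      rw [f.shift_zmul] at hfij
      exact hfij (modEq_iff_exists.2 ⟨r, rfl⟩)
    have hg' : ∀ z, g z = f (affineTransposition N i j z) := fun z => by
      rw [hg, affineTransposition_apply f.injective f.shift_zmul hij]
    refine ⟨i, j, hij, hlt, ?_, hg'⟩
    -- Otherwise the same exchange leads from `g` to `f` with values in increasing order, and `f`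
    -- would be the longer one.
    by_contra hle
    have hne : f i ≠ f j := fun h => hlt.ne (f.injective h)
    have h1 := affineTransposition_left (N := N) (a := i) (b := j) 0
    have h2 := affineTransposition_right hij 0
    simp only [mul_zero, add_zero] at h1 h2
    have := length_lt_of_comp hN (f := g) (g := f) hij hlt
      (by rw [hg', hg', h1, h2]; exact lt_of_le_of_ne (not_lt.1 hle) hne.symm)
      (fun z => by rw [hg', affineTransposition_self hij])
    omega
  rcases lt_trichotomy i j with h | h | h
  · exact key i j hab h hg
  · exact absurd (by rw [h]) hab
  · exact key j i (fun h => hab h.symm) h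
      (fun z => by rw [hg]; exact affineTransposition_comm hab _)

/-- This is the easy half of the rank-matrix criterion for Bruhat order; for matchings the converse
is supplied by uncrossings. -/
theorem innerCount_le_of_le (hN : 0 < N) {f g : AffinePerm k N} (h : f ≤ g) (x y : ℤ) :
    innerCount f x y ≤ innerCount g x y := by
  have h' : Relation.ReflTransGen BruhatStep f g := h
  clear h
  induction h' with
  | refl => exact le_rfl
  | @tail f' g' _ hs ih =>
    refine ih.trans ?_
    obtain ⟨i, j, hij, hlt, hflt, hg⟩ := hs.exists_lt hN
    have e : (g' : ℤ → ℤ) = fun z => f' (affineTransposition N i j z) := funext hg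
    have := finite_innerCount hN g'.shift_zmul x y
    rw [e] at this ⊢
    exact innerCount_le_comp f'.shift_zmul hij hlt hflt x y this

theorem sum_Icc_modEq (hN : 0 < N) (i c : ℤ) :
    ∑ z ∈ Finset.Icc (1 : ℤ) N, (if z ≡ i [ZMOD N] then c else 0) = c := by
  have h3 := Int.emod_nonneg (i - 1) (b := (N : ℤ)) (by omega)
  have h4 := Int.emod_lt_of_pos (i - 1) (b := (N : ℤ)) (by omega)
  have h5 := Int.emod_add_mul_ediv (i - 1) N
  have hself : (i - 1) % N + 1 ≡ i [ZMOD N] :=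
    modEq_iff_exists.2 ⟨-((i - 1) / N), by rw [mul_neg]; linarith⟩
  rw [Finset.sum_eq_single ((i - 1) % N + 1), if_pos hself]
  · intro z hz hne
    rw [Finset.mem_Icc] at hz
    refine if_neg fun h => hne ?_
    have := (h.trans hself.symm).sub_right 1
    rw [add_sub_cancel_right] at this
    have e : (z - 1) % N = z - 1 := Int.emod_eq_of_lt (by omega) (by omega)
    have : (z - 1) % N = (i - 1) % N % N := this
    rw [e, Int.emod_emod_of_dvd _ dvd_rfl] at this
    omega
  · intro h
    rw [Finset.mem_Icc] at h
    omega

/-- The affine permutation with the values at `i` and `j` exchanged. -/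
def compTransposition (hN : 0 < N) (f : AffinePerm k N) (i j : ℤ) (hij : ¬ i ≡ j [ZMOD N]) :
    AffinePerm k N where
  toPerm := (⟨affineTransposition N i j, affineTransposition N i j,
    affineTransposition_self hij, affineTransposition_self hij⟩ : Equiv.Perm ℤ).trans f.toPerm
  periodic z := by
    have h1 := affineTransposition_add hij z 1
    have h2 := f.shift_zmul (affineTransposition N i j z) 1
    simp only [mul_one] at h1 h2
    change f (affineTransposition N i j (z + N)) = f (affineTransposition N i j z) + N
    rw [h1, h2]
  sum_eq := by
    change ∑ z ∈ Finset.Icc (1 : ℤ) N, (f (affineTransposition N i j z) - z) = k * N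
    have h : ∀ z, f (affineTransposition N i j z) - z = (f z - z) +
        ((if z ≡ i [ZMOD N] then f j - f i else 0) +
          if z ≡ j [ZMOD N] then f i - f j else 0) := by
      intro z
      rcases affineTransposition_cases hij z with ⟨h1, h2, h⟩ | ⟨r, h1, h2⟩ | ⟨r, h1, h2⟩
      · rw [h, if_neg h1, if_neg h2]; ring
      · have h3 : z ≡ i [ZMOD N] := modEq_iff_exists.2 ⟨r, h1⟩
        rw [h2, if_pos h3, if_neg (fun h => hij (h3.symm.trans h)), h1, f.shift_zmul,
          f.shift_zmul]
        ring
      · have h3 : z ≡ j [ZMOD N] := modEq_iff_exists.2 ⟨r, h1⟩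
        rw [h2, if_pos h3, if_neg (fun h => hij (h.symm.trans h3)), h1, f.shift_zmul,
          f.shift_zmul]
        ring
    simp only [h]
    rw [Finset.sum_add_distrib, Finset.sum_add_distrib, sum_Icc_modEq hN, sum_Icc_modEq hN,
      f.sum_eq]
    ring

theorem bruhatStep_of_comp (hN : 0 < N) {f g : AffinePerm k N} {i j : ℤ}
    (hij : ¬ i ≡ j [ZMOD N]) (hlt : i < j) (hflt : f i < f j)
    (hg : ∀ z, g z = f (affineTransposition N i j z)) : BruhatStep f g :=
  ⟨⟨f i, f j, fun h => hij (f.modEq_of_apply h), fun z => by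
    rw [hg, affineTransposition_apply f.injective f.shift_zmul hij]⟩,
    length_lt_of_comp hN hij hlt hflt hg⟩

end AffinePerm

/-! ### Affine matchings -/

/-- `f` sends each integer to the next integer that is matched to it, for a matching of the
integers modulo `N`. -/
def IsAffineMatching (N : ℕ) (f : ℤ → ℤ) : Prop :=
  ∀ z, z < f z ∧ f (f z) = z + N

section Count

variable {N : ℕ} {f : ℤ → ℤ} {i j : ℤ}

theorem innerCount_comp_le_self (hper : ∀ z q : ℤ, f (z + N * q) = f z + N * q)
    (hij : ¬ i ≡ j [ZMOD N]) (hflt : f i < f j) (x y : ℤ)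
    (hs : ∀ r : ℤ, i + N * r < x → x ≤ j + N * r → f i + N * r ≤ y → y < f j + N * r → False)
    (hfin : {z : ℤ | x ≤ z ∧ f z ≤ y}.Finite) :
    innerCount (fun z => f (affineTransposition N i j z)) x y ≤ innerCount f x y := by
  have := innerCount_comp_le hper hij hflt x y ∅
    (fun r h1 h2 h3 h4 => (hs r h1 h2 h3 h4).elim) hfin
  rwa [Set.sdiff_empty] at this

/-- Because `j - i < N`, the translates of the interval `(i, j]` are disjoint. So `x` lies in at
most one of them and at most one exceptional position occurs. -/
theorem innerCount_comp_le_add_one (hper : ∀ z q : ℤ, f (z + N * q) = f z + N * q)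
    (hij : ¬ i ≡ j [ZMOD N]) (hflt : f i < f j) (hlt : j - i < N) (x y : ℤ)
    (hfin : {z : ℤ | x ≤ z ∧ f z ≤ y}.Finite) :
    innerCount (fun z => f (affineTransposition N i j z)) x y ≤ innerCount f x y + 1 := by
  let s : Set ℤ := {z | ∃ r : ℤ, z = j + N * r ∧ i + N * r < x ∧ x ≤ j + N * r}
  have hsub : s.Subsingleton := by
    rintro z ⟨r, rfl, h1, h2⟩ z' ⟨r', rfl, h3, h4⟩
    have hr : r = r' := by
      by_contra hne
      rcases lt_or_gt_of_ne hne with h | h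
      · have : (N : ℤ) * (r' - r) ≥ N * 1 := mul_le_mul_of_nonneg_left (by omega) (by omega)
        rw [mul_sub] at this
        linarith
      · have : (N : ℤ) * (r - r') ≥ N * 1 := mul_le_mul_of_nonneg_left (by omega) (by omega)
        rw [mul_sub] at this
        linarith
    rw [hr]
  have h1 := innerCount_comp_le hper hij hflt x y s
    (fun r h1 h2 _ _ => ⟨r, rfl, h1, h2⟩) hfin
  have h2 := Set.ncard_le_ncard_sdiff_add_ncard
    {z : ℤ | x ≤ z ∧ f (affineTransposition N i j z) ≤ y} s hsub.finite
  have h3 : s.ncard ≤ 1 := (Set.ncard_le_one hsub.finite).2 fun a ha b hb => hsub ha hb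
  have h4 : innerCount (fun z => f (affineTransposition N i j z)) x y ≤ _ := h2
  omega

theorem innerCount_shift (hper : ∀ z q : ℤ, f (z + N * q) = f z + N * q) (x y r : ℤ) :
    innerCount f (x + N * r) (y + N * r) = innerCount f x y := by
  rw [innerCount, innerCount, ← Set.ncard_image_of_injective {z : ℤ | x ≤ z ∧ f z ≤ y}
    (add_left_injective ((N : ℤ) * r))]
  congr 1
  ext z
  simp only [Set.mem_ofPred_eq, Set.mem_image]
  constructor
  · rintro ⟨h1, h2⟩
    refine ⟨z - N * r, ⟨by linarith, ?_⟩, by ring⟩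
    have := hper (z - N * r) r
    rw [sub_add_cancel] at this
    linarith
  · rintro ⟨u, ⟨h1, h2⟩, rfl⟩
    rw [hper]
    exact ⟨by linarith, by linarith⟩

end Count

namespace IsAffineMatching

variable {N : ℕ} {f f' : ℤ → ℤ}

theorem add_natCast (hf : IsAffineMatching N f) (z : ℤ) : f (z + N) = f z + N := by
  rw [← (hf z).2, (hf (f z)).2]

theorem lt_add (hf : IsAffineMatching N f) (z : ℤ) : f z < z + N := by
  rw [← (hf z).2]; exact (hf _).1

theorem pos (hf : IsAffineMatching N f) : 0 < N := by
  have h1 := (hf 0).1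
  have h2 := hf.lt_add 0
  omega

theorem shift (hf : IsAffineMatching N f) (z q : ℤ) : f (z + N * q) = f z + N * q := by
  induction q using Int.induction_on with
  | zero => simp
  | succ m ih =>
    have e : z + (N : ℤ) * (m + 1) = z + N * m + N := by ring
    rw [e, hf.add_natCast, ih]; ring
  | pred m ih =>
    have h := hf.add_natCast (z + N * (-(m : ℤ) - 1))
    have e : z + (N : ℤ) * (-(m : ℤ) - 1) + N = z + N * (-(m : ℤ)) := by ring
    rw [e, ih] at h
    linarith

theorem injective (hf : IsAffineMatching N f) : Function.Injective f := by
  intro x y h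
  have h1 := (hf x).2
  rw [h, (hf y).2] at h1
  linarith

theorem apply_sub (hf : IsAffineMatching N f) (z : ℤ) : f (f z - N) = z := by
  have := hf.add_natCast (f z - N)
  rw [sub_add_cancel, (hf z).2] at this
  linarith

theorem finite (hf : IsAffineMatching N f) (x y : ℤ) : {z : ℤ | x ≤ z ∧ f z ≤ y}.Finite :=
  finite_innerCount hf.pos hf.shift x y

theorem not_modEq {x y : ℤ} (h1 : x < y) (h2 : y < x + N) :
    ¬ x ≡ y [ZMOD N] := by
  intro h
  obtain ⟨r, hr⟩ := modEq_iff_exists.1 h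
  rcases lt_trichotomy r 0 with h | rfl | h
  · have : (N : ℤ) * (-r) ≥ N * 1 := mul_le_mul_of_nonneg_left (by omega) (by omega)
    rw [mul_neg] at this
    linarith
  · simp at hr; omega
  · have : (N : ℤ) * r ≥ N * 1 := mul_le_mul_of_nonneg_left (by omega) (by omega)
    linarith

theorem innerCount_eq_card (hf : IsAffineMatching N f) (x y : ℤ) :
    innerCount f x y = ((Finset.Icc x y).filter fun z => f z ≤ y).card := by
  rw [innerCount, ← Set.ncard_coe_finset]
  congr 1
  ext z
  simp only [Set.mem_ofPred_eq, Finset.coe_filter, Finset.mem_Icc]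
  constructor
  · rintro ⟨h1, h2⟩
    exact ⟨⟨h1, ((hf z).1.le).trans h2⟩, h2⟩
  · rintro ⟨⟨h1, -⟩, h2⟩
    exact ⟨h1, h2⟩

/-- The points of an interval are matched inside the interval, in pairs, or outside it. -/
theorem two_mul_innerCount (hf : IsAffineMatching N f) {x y : ℤ} (hxy : x ≤ y + 1)
    (hy : y < x + N) : 2 * (innerCount f x y : ℤ) +
      ((Finset.Icc x y).filter fun z => y < f z ∧ f z < x + N).card = y + 1 - x := by
  -- A chord inside the interval is counted once at its left end `z`. Its right end `f z` is
  -- recognised by having its next partner beyond `x + N`.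
  have h1 : ((Finset.Icc x y).filter fun z => x + N ≤ f z).card = innerCount f x y := by
    rw [hf.innerCount_eq_card]
    refine (Finset.card_bij (fun z _ => f z) ?_ ?_ ?_).symm
    · intro z hz
      simp only [Finset.mem_filter, Finset.mem_Icc] at hz ⊢
      have := hf z
      omega
    · intro z _ z' _ h
      exact hf.injective h
    · intro z hz
      simp only [Finset.mem_filter, Finset.mem_Icc] at hz
      have h2 := hf.apply_sub z
      have h3 := hf.lt_add z
      refine ⟨f z - N, ?_, h2⟩
      simp only [Finset.mem_filter, Finset.mem_Icc]
      omega
  have h2 := Finset.card_filter_add_card_filter_not (s := Finset.Icc x y) (fun z => f z ≤ y)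
  have h3 := Finset.card_filter_add_card_filter_not
    (s := (Finset.Icc x y).filter fun z => ¬ f z ≤ y) (fun z => f z < x + N)
  have e1 : (((Finset.Icc x y).filter fun z => ¬ f z ≤ y).filter fun z => f z < x + N) =
      (Finset.Icc x y).filter fun z => y < f z ∧ f z < x + N := by
    rw [Finset.filter_filter]
    simp only [not_le]
  have e2 : (((Finset.Icc x y).filter fun z => ¬ f z ≤ y).filter fun z => ¬ f z < x + N) =
      (Finset.Icc x y).filter fun z => x + N ≤ f z := by
    rw [Finset.filter_filter]
    refine Finset.filter_congr fun z _ => ?_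
    omega
  rw [e1, e2, h1] at h3
  rw [← hf.innerCount_eq_card, Int.card_Icc] at h2
  omega

/-- The chords leaving an interval are those leaving its complement in a period, and the whole
period contains `n` chords. So the two inner counts determine each other. -/
theorem innerCount_sub_compl (hf : IsAffineMatching N f) {n : ℕ} (hN : N = 2 * n) {x y : ℤ}
    (hxy : x ≤ y + 1) (hy : y < x + N) :
    (innerCount f x y : ℤ) - innerCount f (y + 1) (x + N - 1) = y + 1 - x - n := by
  have h1 := hf.two_mul_innerCount hxy hy
  have h2 := hf.two_mul_innerCount (x := x) (y := x + N - 1) (by omega) (by omega)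
  have h3 : ((Finset.Icc x (x + N - 1)).filter fun z => x + N - 1 < f z ∧ f z < x + N) = ∅ := by
    refine Finset.filter_false_of_mem fun z _ => ?_
    omega
  rw [h3, Finset.card_empty] at h2
  have h4 : innerCount f x (x + N - 1) = innerCount f x y +
      ((Finset.Icc x y).filter fun z => y < f z ∧ f z < x + N).card +
      innerCount f (y + 1) (x + N - 1) := by
    rw [hf.innerCount_eq_card, hf.innerCount_eq_card, hf.innerCount_eq_card,
      ← Finset.card_union_of_disjoint, ← Finset.card_union_of_disjoint]
    · congr 1
      ext z
      simp only [Finset.mem_filter, Finset.mem_Icc, Finset.mem_union]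
      have := hf z
      omega
    · rw [Finset.disjoint_left]
      intro z
      simp only [Finset.mem_filter, Finset.mem_Icc, Finset.mem_union]
      omega
    · rw [Finset.disjoint_left]
      intro z
      simp only [Finset.mem_filter, Finset.mem_Icc]
      omega
  subst hN
  push_cast at *
  omega

theorem innerCount_eq_zero (hf : IsAffineMatching N f) (x : ℤ) : innerCount f x x = 0 := by
  rw [hf.innerCount_eq_card, Finset.card_eq_zero]
  refine Finset.filter_false_of_mem fun z hz => ?_
  have := (hf z).1
  rw [Finset.mem_Icc] at hz
  omega

/-- Any excess of one matching over another in an interval occurs equally in the complementary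
interval. -/
theorem innerCount_congr_compl (hf : IsAffineMatching N f) (hf' : IsAffineMatching N f') {n : ℕ}
    (hN : N = 2 * n) {x y : ℤ} (hxy : x ≤ y + 1) (hy : y < x + N) :
    (innerCount f' x y : ℤ) - innerCount f x y =
      (innerCount f' (y + 1) (x + N - 1) : ℤ) - innerCount f (y + 1) (x + N - 1) := by
  have h1 := hf.innerCount_sub_compl hN hxy hy
  have h2 := hf'.innerCount_sub_compl hN hxy hy
  omega

/-- The matching in which all chords cross has the fewest chords inside any interval. -/
theorem innerCount_le_of_eq_add (hf : IsAffineMatching N f) (hf' : IsAffineMatching N f') {n : ℕ}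
    (hN : N = 2 * n) (hfn : ∀ z, f z = z + n) {x y : ℤ} (hy : y < x + N) :
    innerCount f x y ≤ innerCount f' x y := by
  have hempty : ∀ x y : ℤ, y - n < x → innerCount f x y = 0 := by
    intro x y hxy
    rw [hf.innerCount_eq_card, Finset.card_eq_zero]
    refine Finset.filter_false_of_mem fun z hz => ?_
    rw [Finset.mem_Icc] at hz
    rw [hfn]
    omega
  -- An interval of at most `n` points contains no diameter. A longer one has a complement with
  -- fewer than `n` points, and the comparison passes to the complement.
  by_cases h : y - n < x
  · rw [hempty x y h]; exact Nat.zero_le _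
  · have h1 := hf.innerCount_congr_compl hf' hN (by omega) hy
    rw [hempty (y + 1) (x + N - 1) (by omega)] at h1
    omega

/-- If two matchings differ, and the second one has at least as many chords inside each interval,
then two crossing chords of the first one can be uncrossed. -/
theorem exists_uncrossing (hf : IsAffineMatching N f) (hf' : IsAffineMatching N f') {n : ℕ}
    (hN : N = 2 * n) (hne : f ≠ f')
    (hle : ∀ x y : ℤ, y < x + N → innerCount f x y ≤ innerCount f' x y) :
    ∃ a b c d : ℤ, a < b ∧ b < c ∧ c < d ∧ d < a + N ∧ f a = c ∧ f b = d ∧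
      (∀ z, b < z → z < c → d < f z → f z < a + N → False) ∧
      ∀ x y : ℤ, d - N < x → x ≤ a → b ≤ y → y < c → innerCount f x y < innerCount f' x y := by
  -- a shortest chord `(p, q)` of `f'` that is not a chord of `f`
  obtain ⟨p, hp, hmin⟩ : ∃ p, f' p ≠ f p ∧ ∀ z, f' z - z < f' p - p → f z = f' z := by
    have hex : ∃ m : ℕ, ∃ p, f' p ≠ f p ∧ f' p - p = m := by
      obtain ⟨p, hp⟩ := Function.ne_iff.1 hne
      exact ⟨(f' p - p).toNat, p, hp.symm, by have := (hf' p).1; omega⟩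
    classical
    obtain ⟨p, hp, hm⟩ := Nat.find_spec hex
    refine ⟨p, hp, fun z hz => ?_⟩
    by_contra hzne
    have h1 := (hf' z).1
    exact Nat.find_min hex (m := (f' z - z).toNat) (by omega)
      ⟨z, fun h => hzne h.symm, by omega⟩
  set q := f' p with hq
  set c := f p with hc
  have hpq : p < q := (hf' p).1
  have hqN : q < p + N := hf'.lt_add p
  have hcN : c < p + N := hf.lt_add p
  have hsub : ∀ x y : ℤ, y - x < q - p →
      {z : ℤ | x ≤ z ∧ f' z ≤ y} ⊆ {z : ℤ | x ≤ z ∧ f z ≤ y} := by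
    rintro x y hxy z ⟨h1, h2⟩
    refine ⟨h1, ?_⟩
    rw [hmin z (by omega)]
    exact h2
  -- If `c < q`, then every chord of `f'` inside `[p, c]` is shorter than `(p, q)` and hence a chord
  -- of `f`, while `f` has the chord `(p, c)` in addition. This contradicts `hle`.
  have hqc : q < c := by
    by_contra hlt
    have hcq : c < q := lt_of_le_of_ne (not_lt.1 hlt) hp.symm
    have h1 : innerCount f' p c < innerCount f p c := by
      refine Set.ncard_lt_ncard ⟨hsub p c (by omega), fun h => ?_⟩ (hf.finite p c)
      have : p ∈ {z : ℤ | p ≤ z ∧ f' z ≤ c} := h ⟨le_rfl, le_rfl⟩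
      have : f' p ≤ c := this.2
      omega
    have h2 := hle p c hcN
    omega
  -- For `q ≤ y < c` the point `p` starts a chord inside `[p, y]` for `f'` but not for `f`. Compare
  -- with the interval starting at `p + 1`.
  have hrow : ∀ y, q ≤ y → y < c → innerCount f p y < innerCount f' p y := by
    intro y hy1 hy2
    have h1 : innerCount f p y = innerCount f (p + 1) y := by
      rw [innerCount, innerCount]
      congr 1
      ext z
      simp only [Set.mem_ofPred_eq]
      constructor
      · rintro ⟨h1, h2⟩
        refine ⟨?_, h2⟩
        by_contra h3
        obtain rfl : z = p := by omega
        omega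
      · rintro ⟨h1, h2⟩
        exact ⟨by omega, h2⟩
    have h2 : innerCount f' (p + 1) y < innerCount f' p y := by
      refine Set.ncard_lt_ncard ⟨fun z hz => ⟨by have := hz.1; omega, hz.2⟩, fun h => ?_⟩
        (hf'.finite p y)
      have : p ∈ {z : ℤ | p + 1 ≤ z ∧ f' z ≤ y} := h ⟨le_rfl, hy1⟩
      have := this.1
      omega
    have h3 := hle (p + 1) y (by omega)
    omega
  -- the first column to the left of `p` where the counts agree
  have hwhole : innerCount f' (c + 1 - N) (c - 1) ≤ innerCount f (c + 1 - N) (c - 1) := by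
    -- The complement of this interval is the single point `c`, which contains no chord, so the
    -- counts agree. Hence the search for a column to the left of `p` succeeds.
    have h1 := hf.innerCount_congr_compl hf' hN (x := c + 1 - N) (y := c - 1) (by omega) (by omega)
    rw [show c - 1 + 1 = c by ring, show c + 1 - (N : ℤ) + N - 1 = c by ring,
      hf.innerCount_eq_zero, hf'.innerCount_eq_zero] at h1
    omega
  have hbdd : ∃ x, (c - N < x ∧ x < p ∧
      ∃ y, q ≤ y ∧ y < c ∧ innerCount f' x y ≤ innerCount f x y) ∧
      ∀ x', (c - N < x' ∧ x' < p ∧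
      ∃ y, q ≤ y ∧ y < c ∧ innerCount f' x' y ≤ innerCount f x' y) → x' ≤ x := by
    refine Int.exists_greatest_of_bdd ⟨p, fun z hz => hz.2.1.le⟩
      ⟨c + 1 - N, by omega, ?_, c - 1, by omega, by omega, hwhole⟩
    by_contra h
    have h1 : c + 1 - N = p := by omega
    rw [h1] at hwhole
    have := hrow (c - 1) (by omega) (by omega)
    omega
  obtain ⟨x₀, ⟨hx1, hx2, y₀, hy1, hy2, hxy⟩, hmax⟩ := hbdd
  -- a chord from `[x₀, p)` to `[q, y₀]`
  have hchord : ∃ z, x₀ ≤ z ∧ z < p ∧ q ≤ f z ∧ f z ≤ y₀ := by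
    -- Without such a chord, inclusion and exclusion of the intervals `[x₀, q - 1]` and `[p, y₀]` is
    -- exact for `f` and an inequality for `f'`. The count on `[p, q - 1]` is no larger for `f'` and
    -- the one on `[p, y₀]` is strictly larger, so the count on `[x₀, y₀]` would be strictly larger
    -- too.
    by_contra! hno
    have hU : ∀ g : ℤ → ℤ, {z : ℤ | x₀ ≤ z ∧ g z ≤ q - 1} ∪ {z : ℤ | p ≤ z ∧ g z ≤ y₀} ⊆
        {z : ℤ | x₀ ≤ z ∧ g z ≤ y₀} := by
      rintro g z (⟨h1, h2⟩ | ⟨h1, h2⟩)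
      · exact ⟨h1, by omega⟩
      · exact ⟨by omega, h2⟩
    have hI : ∀ g : ℤ → ℤ, {z : ℤ | x₀ ≤ z ∧ g z ≤ q - 1} ∩ {z : ℤ | p ≤ z ∧ g z ≤ y₀} =
        {z : ℤ | p ≤ z ∧ g z ≤ q - 1} := by
      intro g
      ext z
      simp only [Set.mem_inter_iff, Set.mem_ofPred_eq]
      omega
    have h1 := Set.ncard_union_add_ncard_inter {z : ℤ | x₀ ≤ z ∧ f z ≤ q - 1}
      {z : ℤ | p ≤ z ∧ f z ≤ y₀} (hf.finite _ _) (hf.finite _ _)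
    have h2 := Set.ncard_union_add_ncard_inter {z : ℤ | x₀ ≤ z ∧ f' z ≤ q - 1}
      {z : ℤ | p ≤ z ∧ f' z ≤ y₀} (hf'.finite _ _) (hf'.finite _ _)
    rw [hI] at h1 h2
    have h3 : {z : ℤ | x₀ ≤ z ∧ f z ≤ q - 1} ∪ {z : ℤ | p ≤ z ∧ f z ≤ y₀} =
        {z : ℤ | x₀ ≤ z ∧ f z ≤ y₀} := by
      refine (hU f).antisymm ?_
      rintro z ⟨h3, h4⟩
      by_cases h5 : z < p
      · left
        refine ⟨h3, ?_⟩
        by_contra h6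
        have := hno z h3 h5 (by omega)
        omega
      · exact Or.inr ⟨not_lt.1 h5, h4⟩
    have h4 := Set.ncard_le_ncard (hU f') (hf'.finite _ _)
    have h5 := Set.ncard_le_ncard (hsub p (q - 1) (by omega)) (hf.finite _ _)
    have h6 := hle x₀ (q - 1) (by omega)
    have h7 := hrow y₀ hy1 hy2
    rw [h3] at h1
    unfold innerCount at *
    omega
  -- the last such chord
  have hlast : ∃ b, (b < c ∧ q ≤ b ∧ ∃ z, x₀ ≤ z ∧ z < p ∧ f z = b) ∧
      ∀ b', (b' < c ∧ q ≤ b' ∧ ∃ z, x₀ ≤ z ∧ z < p ∧ f z = b') → b' ≤ b := by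
    obtain ⟨z, h1, h2, h3, h4⟩ := hchord
    exact Int.exists_greatest_of_bdd ⟨c, fun z hz => hz.1.le⟩
      ⟨f z, by omega, h3, z, h1, h2, rfl⟩
  obtain ⟨b, ⟨hbc, hqb, z₀, hz1, hz2, rfl⟩, hbmax⟩ := hlast
  refine ⟨p, f z₀, c, z₀ + N, by omega, hbc, by omega, by omega, rfl, (hf z₀).2, ?_, ?_⟩
  -- Such a `z` would be the right end of a chord from `(z₀, p)` lying beyond `f z₀`, against the
  -- choice of the last chord.
  · intro z h1 h2 h3 h4
    have h5 := hf.apply_sub z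
    have := hbmax z ⟨h2, by omega, f z - N, by omega, by omega, h5⟩
    omega
  · intro x y h1 h2 h3 h4
    by_cases hxp : x = p
    · rw [hxp]
      exact hrow y (by omega) h4
    · by_contra h5
      have := hmax x ⟨by omega, by omega, y, by omega, h4, by omega⟩
      omega

variable {a b c d : ℤ}

/-- Uncrossing two chords keeps the numbers of chords inside intervals below those of another
matching, if there is room for the new chords. -/
theorem innerCount_uncrossing_le (hf : IsAffineMatching N f) (hf' : IsAffineMatching N f') {n : ℕ}
    (hN : N = 2 * n) (hab : a < b) (hbc : b < c) (hcd : c < d) (hda : d < a + N)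
    (hfa : f a = c) (hfb : f b = d)
    (hle : ∀ x y : ℤ, y < x + N → innerCount f x y ≤ innerCount f' x y)
    (hlt : ∀ x y : ℤ, d - N < x → x ≤ a → b ≤ y → y < c → innerCount f x y < innerCount f' x y)
    {x y : ℤ} (hxy : y < x + N) :
    innerCount (fun z => affineTransposition N b c (f (affineTransposition N b c z))) x y ≤
      innerCount f' x y := by
  have hbc' : ¬ b ≡ c [ZMOD N] := not_modEq hbc (by omega)
  have hfc : f c = a + N := by rw [← hfa, (hf a).2]
  set f₁ : ℤ → ℤ := fun z => f (affineTransposition N b c z) with hf₁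
  have hper₁ : ∀ z q : ℤ, f₁ (z + N * q) = f₁ z + N * q := by
    intro z q
    simp only [hf₁]
    rw [affineTransposition_add hbc', hf.shift]
  have hinj₁ : Function.Injective f₁ := by
    intro z z' h
    have h1 := congrArg (affineTransposition N b c) (hf.injective h)
    rwa [affineTransposition_self hbc', affineTransposition_self hbc'] at h1
  have hi : f₁ (d - N) = b := by
    simp only [hf₁]
    have h1 := not_modEq (N := N) (x := d - N) (y := b) (by omega) (by omega)
    have h2 := not_modEq (N := N) (x := d - N) (y := c) (by omega) (by omega)
    rw [affineTransposition_of_not h1 h2, ← hfb, hf.apply_sub]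
  have hj : f₁ a = c := by
    simp only [hf₁]
    have h1 := not_modEq (N := N) (x := a) (y := b) (by omega) (by omega)
    have h2 := not_modEq (N := N) (x := a) (y := c) (by omega) (by omega)
    rw [affineTransposition_of_not h1 h2, hfa]
  have hij : ¬ d - N ≡ a [ZMOD N] := not_modEq (by omega) (by omega)
  -- Written as an exchange of positions, the second transposition moves `d - N` and `a`, where `f₁`
  -- has the values `b` and `c`. Each of the two exchanges raises the count by at most one.
  have hf₂ : (fun z => affineTransposition N b c (f₁ z)) =
      fun z => f₁ (affineTransposition N (d - N) a z) := by
    funext z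
    rw [← affineTransposition_apply hinj₁ hper₁ hij, hi, hj]
  change innerCount (fun z => affineTransposition N b c (f₁ z)) x y ≤ _
  rw [hf₂]
  have hfin₁ := finite_innerCount hf.pos hper₁ x y
  have hfin := hf.finite x y
  have hfl : f b < f c := by omega
  have hfl₁ : f₁ (d - N) < f₁ a := by omega
  have hA := innerCount_comp_le_add_one hf.shift hbc' hfl (by omega) x y hfin
  have hB := innerCount_comp_le_add_one hper₁ hij hfl₁ (by omega) x y hfin₁
  change innerCount f₁ x y ≤ _ at hA
  -- The first exchange matters for windows with left end in `(b, c]` and right end in `[d, a + N)`,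
  -- the second for those with left end in `(d - N, a]` and right end in `[b, c)`, up to
  -- translation. These rectangles are complementary to each other and no window lies in both.
  by_cases h1 : ∃ r : ℤ, b + N * r < x ∧ x ≤ c + N * r ∧ f b + N * r ≤ y ∧ y < f c + N * r
  · obtain ⟨r, h1, h2, h3, h4⟩ := h1
    have hB' := innerCount_comp_le_self hper₁ hij hfl₁ x y (fun s h5 h6 _ _ => by
      rcases lt_trichotomy r s with h | h | h
      · have : (N : ℤ) * (s - r) ≥ N * 1 := mul_le_mul_of_nonneg_left (by omega) (by omega)
        rw [mul_sub] at this
        linarith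
      · subst h
        linarith
      · have : (N : ℤ) * (r - s) ≥ N * 1 := mul_le_mul_of_nonneg_left (by omega) (by omega)
        rw [mul_sub] at this
        linarith) hfin₁
    -- The strict inequality is known for the second rectangle; passing to complementary windows
    -- transfers it to the first.
    have h5 := hf.innerCount_congr_compl hf' hN (x := x) (y := y) (by omega) hxy
    have h6 := hlt (y + 1 - N * (r + 1)) (x + N - 1 - N * (r + 1)) (by rw [mul_add]; omega)
      (by rw [mul_add]; omega) (by rw [mul_add]; omega) (by rw [mul_add]; omega)
    rw [← innerCount_shift hf.shift _ _ (r + 1), ← innerCount_shift hf'.shift _ _ (r + 1),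
      sub_add_cancel, sub_add_cancel] at h6
    omega
  · have hA' := innerCount_comp_le_self hf.shift hbc' hfl x y
      (fun r h2 h3 h4 h5 => h1 ⟨r, h2, h3, h4, h5⟩) hfin
    change innerCount f₁ x y ≤ _ at hA'
    by_cases h2 : ∃ r : ℤ, d - N + N * r < x ∧ x ≤ a + N * r ∧ b + N * r ≤ y ∧ y < c + N * r
    · obtain ⟨r, h2, h3, h4, h5⟩ := h2
      have h6 := hlt (x - N * r) (y - N * r) (by omega) (by omega) (by omega) (by omega)
      rw [← innerCount_shift hf.shift _ _ r, ← innerCount_shift hf'.shift _ _ r,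
        sub_add_cancel, sub_add_cancel] at h6
      omega
    · have hB' := innerCount_comp_le_self hper₁ hij hfl₁ x y (fun r h3 h4 h5 h6 => by
        rw [hi] at h5
        rw [hj] at h6
        exact h2 ⟨r, h3, h4, h5, h6⟩) hfin₁
      have := hle x y hxy
      omega

end IsAffineMatching

/-! ### The affine matching of a matching -/

namespace Matching

variable {n : ℕ} [NeZero n]

theorem residue_gFun (τ : Matching n) (z : ℤ) : residue n (τ.gFun z) = τ (residue n z) := by
  rw [← label_residue (n := n) z]
  generalize residue n z = p
  generalize (z - 1) / (2 * (n : ℤ)) = q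
  rw [gFun_label, residue_label]
  split_ifs
  · rw [residue_label]
  · rw [add_assoc, ← mul_one_add, residue_label]

theorem isAffineMatching_gFun (τ : Matching n) : IsAffineMatching (2 * n) τ.gFun := by
  intro z
  have hne : residue n z ≠ τ (residue n z) := (τ.ne_self _).symm
  rw [← label_residue (n := n) z]
  revert hne
  generalize residue n z = p
  generalize (z - 1) / (2 * (n : ℤ)) = q
  intro hne
  have hp := p.2
  have hp' := (τ p).2
  have hval : (p : ℕ) ≠ τ p := fun h => hne (Fin.ext h)
  rw [gFun_label]
  by_cases h : p < τ p
  · have h' : ¬ τ p < τ (τ p) := by rw [τ.invol]; exact h.not_gt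
    have h3 : (p : ℕ) < τ p := h
    rw [if_pos h, gFun_label, if_neg h', τ.invol]
    simp only [label]
    push_cast
    constructor <;> linarith
  · have h' : τ p < τ (τ p) := by rw [τ.invol]; exact lt_of_le_of_ne (not_lt.1 h) hne.symm
    have h3 : (τ p : ℕ) < p := by
      have : ¬ (p : ℕ) < τ p := h
      omega
    have e : label (τ p) + 2 * (n : ℤ) + 2 * n * q = label (τ p) + 2 * n * (q + 1) := by ring
    rw [if_neg h, e, gFun_label, if_pos h', τ.invol]
    simp only [label]
    push_cast
    constructor <;> linarith

theorem residue_eq_iff {x y : ℤ} : residue n x = residue n y ↔ x ≡ y [ZMOD (2 * n : ℕ)] := by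
  rw [modEq_iff_exists]
  constructor
  · intro h
    have hx := label_residue (n := n) x
    have hy := label_residue (n := n) y
    refine ⟨(x - 1) / (2 * n) - (y - 1) / (2 * n), ?_⟩
    rw [h] at hx
    push_cast
    rw [mul_sub]
    linarith
  · rintro ⟨r, rfl⟩
    rw [← label_residue (n := n) y, residue_label]
    push_cast
    rw [add_assoc, ← mul_add, residue_label]

/-- An affine matching is determined by its residues, because `f x` lies strictly between `x` and `x
+ N`. -/
theorem eq_gFun {τ : Matching n} {f : ℤ → ℤ} (hf : IsAffineMatching (2 * n) f)
    (h : ∀ x, residue n (f x) = τ (residue n x)) : τ.gFun = f := by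
  funext x
  have hg := τ.isAffineMatching_gFun
  have h1 : τ.gFun x ≡ f x [ZMOD (2 * n : ℕ)] := by
    rw [← residue_eq_iff, residue_gFun, h]
  by_contra hne
  have h2 := hg x
  have h3 := hg.lt_add x
  have h4 := hf x
  have h5 := hf.lt_add x
  rcases lt_or_gt_of_ne hne with h6 | h6
  · exact IsAffineMatching.not_modEq h6 (by omega) h1
  · exact IsAffineMatching.not_modEq h6 (by omega) h1.symm

theorem gFun_injective : Function.Injective (gFun : Matching n → ℤ → ℤ) := by
  intro τ τ' h
  have key : ∀ p, τ p = τ' p := by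
    intro p
    have h1 := residue_gFun τ (label p)
    have h2 := residue_gFun τ' (label p)
    have h3 := residue_label p 0
    rw [mul_zero, add_zero] at h3
    rw [h3] at h1 h2
    rw [← h1, ← h2, h]
  cases τ
  cases τ'
  congr
  exact funext key

end Matching

/-- Uncrossing two chords of an affine matching. -/
theorem IsAffineMatching.uncrossing {N : ℕ} {f : ℤ → ℤ} (hf : IsAffineMatching N f) {a b c d : ℤ}
    (hab : a < b) (hbc : b < c) (hcd : c < d) (hda : d < a + N) (hfa : f a = c) (hfb : f b = d) :
    IsAffineMatching N fun z => affineTransposition N b c (f (affineTransposition N b c z)) := by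
  have hbc' : ¬ b ≡ c [ZMOD N] := not_modEq hbc (by omega)
  have hfc : f c = a + N := by rw [← hfa, (hf a).2]
  have hfix : ∀ z r : ℤ, c < z → z < b + N → affineTransposition N b c (z + N * r) = z + N * r := by
    intro z r h1 h2
    have h3 : z + N * r ≡ z [ZMOD N] := modEq_iff_exists.2 ⟨r, rfl⟩
    exact affineTransposition_of_not
      (fun h => not_modEq (by omega) (by omega) (h3.symm.trans h).symm)
      (fun h => not_modEq (by omega) (by omega) (h3.symm.trans h).symm)
  refine fun z => ⟨?_, ?_⟩
  · beta_reduce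
    rcases affineTransposition_cases hbc' z with ⟨h1, h2, h⟩ | ⟨r, h1, h2⟩ | ⟨r, h1, h2⟩
    · rw [h]
      have hz := hf z
      rcases affineTransposition_cases hbc' (f z) with ⟨-, -, h'⟩ | ⟨r, h3, h4⟩ | ⟨r, h3, h4⟩
      · rw [h']
        exact hz.1
      · have h5 := hf.shift b r
        rw [← h3, hz.2] at h5
        rw [h4]
        linarith
      · have h5 := hf.shift c r
        rw [← h3, hz.2] at h5
        rw [h4]
        linarith
    · rw [h2, h1, hf.shift, hfc, hfix _ _ (by omega) (by omega)]
      linarith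
    · rw [h2, h1, hf.shift, hfb, hfix _ _ (by omega) (by omega)]
      linarith
  · have h := affineTransposition_add hbc' (affineTransposition N b c z) 1
    rw [mul_one, affineTransposition_self hbc'] at h
    simp only [affineTransposition_self hbc', (hf _).2, h]

namespace Matching

variable {n : ℕ} [NeZero n]

theorem residue_affineTransposition {b c : ℤ} (hbc : ¬ b ≡ c [ZMOD (2 * n : ℕ)]) (z : ℤ) :
    residue n (affineTransposition (2 * n) b c z) =
      Equiv.swap (residue n b) (residue n c) (residue n z) := by
  have hper : ∀ x r : ℤ, residue n (x + (2 * n : ℕ) * r) = residue n x := fun x r =>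
    residue_eq_iff.2 (modEq_iff_exists.2 ⟨r, rfl⟩)
  rcases affineTransposition_cases hbc z with ⟨h1, h2, h⟩ | ⟨r, h1, h2⟩ | ⟨r, h1, h2⟩
  · rw [h, Equiv.swap_apply_of_ne_of_ne (fun h => h1 (residue_eq_iff.1 h))
      (fun h => h2 (residue_eq_iff.1 h))]
  · rw [h2, h1, hper, hper, Equiv.swap_apply_left]
  · rw [h2, h1, hper, hper, Equiv.swap_apply_right]

theorem gFun_conjSwap (τ : Matching n) {a b c d : ℤ} (hab : a < b) (hbc : b < c) (hcd : c < d)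
    (hda : d < a + (2 * n : ℕ)) (hfa : τ.gFun a = c) (hfb : τ.gFun b = d) :
    (τ.conjSwap (residue n b) (residue n c)).gFun = fun z =>
      affineTransposition (2 * n) b c (τ.gFun (affineTransposition (2 * n) b c z)) := by
  have hbc' : ¬ b ≡ c [ZMOD (2 * n : ℕ)] := IsAffineMatching.not_modEq hbc (by omega)
  refine eq_gFun (τ.isAffineMatching_gFun.uncrossing hab hbc hcd hda hfa hfb) fun x => ?_
  rw [residue_affineTransposition hbc', residue_gFun, residue_affineTransposition hbc',
    conjSwap_apply]

/-- The alternatives are the two cyclic orders of interlacing ends, according to whether `c` comes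
before or after the next partner of `b`. -/
theorem interlace_residue (τ : Matching n) {b c : ℤ} (hbc : b < c) (hcb : c < b + (2 * n : ℕ))
    (hne : c ≠ τ.gFun b) : τ.interlace (residue n b) (residue n c) = 1 ↔
      (c < τ.gFun b ∧ τ.gFun b < τ.gFun c ∧ τ.gFun c < b + (2 * n : ℕ)) ∨
      (τ.gFun b < c ∧ b + (2 * n : ℕ) < τ.gFun c ∧ τ.gFun c < τ.gFun b + (2 * n : ℕ)) := by
  have hb0 := τ.ne_self (residue n b)
  have hc0 := τ.ne_self (residue n c)
  have hinj := τ.isAffineMatching_gFun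
  have hne1 := hinj c
  have hne2 : residue n b ≠ residue n c := fun h =>
    IsAffineMatching.not_modEq hbc hcb (residue_eq_iff.1 h)
  have hb1 := label_residue (n := n) b
  have hc1 := label_residue (n := n) c
  rw [← hb1, ← hc1] at hbc hcb hne
  rw [← hb1, ← hc1] at ⊢
  simp only [residue_label]
  rw [gFun_label] at hne ⊢
  rw [gFun_label]
  revert hb0 hc0 hbc hcb hne hne2
  generalize residue n b = β
  generalize residue n c = γ
  generalize (b - 1) / (2 * (n : ℤ)) = q
  generalize (c - 1) / (2 * (n : ℤ)) = r
  intro hbc hcb hne hb0 hc0 hne2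
  have hβ := β.2
  have hγ := γ.2
  have hβ' := (τ β).2
  have hγ' := (τ γ).2
  have hn : 0 < n := Nat.pos_of_ne_zero (NeZero.ne n)
  simp only [label] at *
  push_cast at *
  -- As `c` is less than one period after `b`, it lies in the same block of labels or in the next.
  -- With this, only finitely many linear comparisons remain.
  have hqr : r = q ∨ r = q + 1 := by
    by_contra! h
    rcases lt_or_ge r q with h1 | h1
    · have : (n : ℤ) * (q - r) ≥ n * 1 := mul_le_mul_of_nonneg_left (by omega) (by omega)
      rw [mul_sub] at this
      linarith
    · have : (n : ℤ) * (r - q) ≥ n * 2 := mul_le_mul_of_nonneg_left (by omega) (by omega)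
      rw [mul_sub] at this
      linarith
  have e : 2 * (n : ℤ) * r = 2 * n * q ∨ 2 * (n : ℤ) * r = 2 * n * q + 2 * n := by
    rcases hqr with rfl | rfl
    · exact Or.inl rfl
    · right; ring
  generalize 2 * (n : ℤ) * r = R at *
  generalize 2 * (n : ℤ) * q = Q at *
  have hτ1 : τ β ≠ τ γ := fun h => hne2 (τ.injective h)
  have hτ2 : γ = τ β ↔ β = τ γ :=
    ⟨fun h => by rw [h, τ.invol], fun h => by rw [h, τ.invol]⟩
  rw [interlace]
  simp only [Fin.lt_def, ne_eq, Fin.ext_iff] at *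
  have z1 : ¬ (0 : ZMod 2) = 1 := by decide
  have z2 : (1 : ZMod 2) + 1 = 0 := by decide
  generalize (β : ℕ) = β at *
  generalize (γ : ℕ) = γ at *
  generalize ((τ _ : Fin _) : ℕ) = β' at *
  generalize ((τ _ : Fin _) : ℕ) = γ' at *
  split_ifs at * <;> simp only [z1, z2, add_zero, zero_add, false_iff, true_iff] <;> omega

/-- Interlacing chords can be lifted to crossing chords of the affine matching. -/
theorem exists_lift_of_interlace (τ : Matching n) {β γ : Fin (2 * n)} (hne : β ≠ γ)
    (hne' : β ≠ τ γ) (h : τ.interlace β γ = 1) :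
    ∃ a b c d : ℤ, a < b ∧ b < c ∧ c < d ∧ d < a + (2 * n : ℕ) ∧ τ.gFun a = c ∧ τ.gFun b = d ∧
      τ.conjSwap β γ = τ.conjSwap (residue n b) (residue n c) := by
  have hf := τ.isAffineMatching_gFun
  obtain ⟨b, hb⟩ : ∃ b, residue n b = β := ⟨_, residue_label β 0⟩
  obtain ⟨c, hc, hbc, hcb⟩ : ∃ c, residue n c = γ ∧ b < c ∧ c < b + (2 * n : ℕ) := by
    have h1 := Int.emod_nonneg (label γ - b) (b := ((2 * n : ℕ) : ℤ)) (by have := hf.pos; omega)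
    have h2 := Int.emod_lt_of_pos (label γ - b) (b := ((2 * n : ℕ) : ℤ))
      (by have := hf.pos; omega)
    have h3 := Int.emod_add_mul_ediv (label γ - b) ((2 * n : ℕ) : ℤ)
    have h4 : residue n (b + (label γ - b) % ((2 * n : ℕ) : ℤ)) = γ := by
      have h5 := residue_label γ 0
      rw [mul_zero, add_zero] at h5
      rw [← h5, residue_eq_iff, modEq_iff_exists, h5]
      exact ⟨-((label γ - b) / ((2 * n : ℕ) : ℤ)), by rw [mul_neg]; linarith⟩
    refine ⟨_, h4, ?_, by omega⟩
    by_contra h5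
    have h6 : (label γ - b) % ((2 * n : ℕ) : ℤ) = 0 := by omega
    rw [h6, add_zero] at h4
    exact hne (hb.symm.trans h4)
  subst hb hc
  have hcf : c ≠ τ.gFun b := by
    rintro rfl
    rw [residue_gFun, τ.invol] at hne'
    exact hne' rfl
  have hsh := hf.shift
  have hb1 := hf.add_natCast b
  have hc1 := hf.apply_sub c
  -- The lift needs four ends in order with the exchanged points in the middle. In the second cyclic
  -- order these are `c` and `b + 2n`, so the two roles are exchanged.
  rcases (τ.interlace_residue hbc hcb hcf).1 h with ⟨h1, h2, h3⟩ | ⟨h1, h2, h3⟩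
  · exact ⟨τ.gFun c - (2 * n : ℕ), b, c, τ.gFun b, by omega, hbc, h1, by omega, hc1, rfl, rfl⟩
  · refine ⟨τ.gFun b, c, b + (2 * n : ℕ), τ.gFun c, h1, hcb, h2, h3, (hf b).2, rfl, ?_⟩
    have : residue n (b + (2 * n : ℕ)) = residue n b :=
      residue_eq_iff.2 (modEq_iff_exists.2 ⟨1, by rw [mul_one]⟩)
    rw [this, conjSwap_comm]

/-- Uncrossing two chords is two steps up in Bruhat order. -/
theorem g_le_conjSwap (τ : Matching n) {a b c d : ℤ} (hab : a < b) (hbc : b < c) (hcd : c < d)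
    (hda : d < a + (2 * n : ℕ)) (hfa : τ.gFun a = c) (hfb : τ.gFun b = d) :
    τ.g ≤ (τ.conjSwap (residue n b) (residue n c)).g := by
  have hf := τ.isAffineMatching_gFun
  have hbc' : ¬ b ≡ c [ZMOD (2 * n : ℕ)] := IsAffineMatching.not_modEq hbc (by omega)
  have hij : ¬ d - (2 * n : ℕ) ≡ a [ZMOD (2 * n : ℕ)] :=
    IsAffineMatching.not_modEq (by omega) (by omega)
  have hg := τ.gFun_conjSwap hab hbc hcd hda hfa hfb
  have hfc : τ.gFun c = a + (2 * n : ℕ) := by rw [← hfa, (hf a).2]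
  let f₁ := τ.g.1.compTransposition hf.pos b c hbc'
  have hi : f₁ (d - (2 * n : ℕ)) = b := by
    have h1 := IsAffineMatching.not_modEq (N := 2 * n) (x := d - (2 * n : ℕ)) (y := b)
      (by omega) (by omega)
    have h2 := IsAffineMatching.not_modEq (N := 2 * n) (x := d - (2 * n : ℕ)) (y := c)
      (by omega) (by omega)
    change τ.gFun (affineTransposition (2 * n) b c _) = b
    rw [affineTransposition_of_not h1 h2, ← hfb, hf.apply_sub]
  have hj : f₁ a = c := by
    have h1 := IsAffineMatching.not_modEq (N := 2 * n) (x := a) (y := b) (by omega) (by omega)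
    have h2 := IsAffineMatching.not_modEq (N := 2 * n) (x := a) (y := c) (by omega) (by omega)
    change τ.gFun (affineTransposition (2 * n) b c _) = c
    rw [affineTransposition_of_not h1 h2, hfa]
  have s1 : AffinePerm.BruhatStep τ.g.1 f₁ :=
    AffinePerm.bruhatStep_of_comp hf.pos hbc' hbc
      (show τ.gFun b < τ.gFun c by omega) fun _ => rfl
  have s2 : AffinePerm.BruhatStep f₁ (τ.conjSwap (residue n b) (residue n c)).g.1 := by
    refine AffinePerm.bruhatStep_of_comp hf.pos hij (by omega) (by omega) fun z => ?_
    change (τ.conjSwap (residue n b) (residue n c)).gFun z = _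
    rw [hg, ← affineTransposition_apply f₁.injective f₁.shift_zmul hij, hi, hj]
    rfl
  exact (Relation.ReflTransGen.single s1).tail s2

end Matching

/-! ### Counting crossings in windows -/

/-- The crossing pairs of chords of an affine matching that lie in the window `[s, s + N)`,
represented by their left endpoints. -/
def windowCrossings (N : ℕ) (f : ℤ → ℤ) (s : ℤ) : Set (ℤ × ℤ) :=
  {p | s ≤ p.1 ∧ p.1 < p.2 ∧ p.2 < f p.1 ∧ f p.1 < f p.2 ∧ f p.2 < s + N}

theorem finite_windowCrossings (N : ℕ) (f : ℤ → ℤ) (s : ℤ) : (windowCrossings N f s).Finite := by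
  refine ((Set.finite_Icc s (s + N)).prod (Set.finite_Icc s (s + N))).subset ?_
  rintro ⟨x, y⟩ ⟨h1, h2, h3, h4, h5⟩
  simp only at h1 h2 h3 h4 h5
  simp only [Set.mem_prod, Set.mem_Icc]
  omega

namespace IsAffineMatching

variable {N : ℕ} {f : ℤ → ℤ}

/-- The cyclic rotation of the endpoints of two crossing chords. -/
theorem rotate_injective (hf : IsAffineMatching N f) :
    Function.Injective fun p : ℤ × ℤ => (p.2, f p.1) := by
  rintro ⟨x, y⟩ ⟨x', y'⟩ h
  simp only [Prod.mk.injEq] at h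
  rw [h.1, hf.injective h.2]

theorem mem_rotate_image (hf : IsAffineMatching N f) (A : Set (ℤ × ℤ)) (u v : ℤ) :
    (u, v) ∈ (fun p : ℤ × ℤ => (p.2, f p.1)) '' A ↔ (f v - N, u) ∈ A := by
  constructor
  · rintro ⟨⟨x, y⟩, h, h'⟩
    simp only [Prod.mk.injEq] at h'
    obtain ⟨rfl, rfl⟩ := h'
    rw [(hf x).2, add_sub_cancel_right]
    exact h
  · intro h
    refine ⟨_, h, ?_⟩
    simp only [hf.apply_sub]

/-- When the window moves by one, its left end `s` is replaced by `s + N`. A crossing pair that uses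
`s` is then read off from its next end on, which is the rotation `(x, y) ↦ (y, f x)`. -/
theorem ncard_windowCrossings_succ (hf : IsAffineMatching N f) (s : ℤ) :
    (windowCrossings N f (s + 1)).ncard = (windowCrossings N f s).ncard := by
  let B : Set (ℤ × ℤ) := {p | p ∈ windowCrossings N f s ∧ s < p.1}
  let D : Set (ℤ × ℤ) := {p | p ∈ windowCrossings N f s ∧ p.1 = s}
  have h1 : windowCrossings N f s = B ∪ D := by
    ext ⟨x, y⟩
    simp only [windowCrossings, B, D, Set.mem_union, Set.mem_ofPred_eq]
    omega
  have h2 : windowCrossings N f (s + 1) = B ∪ (fun p : ℤ × ℤ => (p.2, f p.1)) '' D := by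
    ext ⟨x, y⟩
    rw [Set.mem_union, hf.mem_rotate_image]
    simp only [windowCrossings, B, D, Set.mem_ofPred_eq, hf.apply_sub]
    have hx := hf x
    have hy := hf y
    constructor
    · rintro ⟨h1, h2, h3, h4, h5⟩
      by_cases h6 : f y < s + N
      · left; omega
      · right; omega
    · rintro (h | h) <;> omega
  have hB : B.Finite := (finite_windowCrossings N f s).subset fun p hp => hp.1
  have hD : D.Finite := (finite_windowCrossings N f s).subset fun p hp => hp.1
  rw [h1, h2, Set.ncard_union_eq _ hB hD, Set.ncard_union_eq _ hB (hD.image _),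
    Set.ncard_image_of_injective _ hf.rotate_injective]
  · rw [Set.disjoint_left]
    rintro ⟨x, y⟩ ⟨h3, h4⟩ h5
    rw [hf.mem_rotate_image] at h5
    obtain ⟨-, -, -, -, h6⟩ := h3
    have h7 := h5.2
    simp only at h6 h7
    omega
  · rw [Set.disjoint_left]
    rintro ⟨x, y⟩ ⟨h3, h4⟩ ⟨h5, h6⟩
    exact h4.ne' h6

theorem ncard_windowCrossings (hf : IsAffineMatching N f) (s t : ℤ) :
    (windowCrossings N f s).ncard = (windowCrossings N f t).ncard := by
  have key : ∀ s : ℤ, (windowCrossings N f s).ncard = (windowCrossings N f 0).ncard := by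
    intro s
    induction s using Int.induction_on with
    | zero => rfl
    | succ m ih => rw [hf.ncard_windowCrossings_succ, ih]
    | pred m ih => rw [← ih, ← hf.ncard_windowCrossings_succ, sub_add_cancel]
  rw [key s, key t]

/-- Each pair of crossing chords is counted once for each of its four endpoints. -/
theorem sum_card_crossing_eq (hf : IsAffineMatching N f) (s : ℤ) :
    ∑ x ∈ Finset.Ico s (s + N),
      ((Finset.Ioo x (f x)).filter fun z => f x < f z ∧ f z < x + N).card =
    4 * (windowCrossings N f s).ncard := by
  let R : ℤ × ℤ → ℤ × ℤ := fun p => (p.2, f p.1)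
  have hR : ∀ A : Set (ℤ × ℤ), (R '' A).ncard = A.ncard := fun A =>
    Set.ncard_image_of_injective _ hf.rotate_injective
  have hmem : ∀ (A : Set (ℤ × ℤ)) (u v : ℤ), (u, v) ∈ R '' A ↔ (f v - N, u) ∈ A :=
    hf.mem_rotate_image
  set P := windowCrossings N f s
  have hP : P.Finite := finite_windowCrossings N f s
  have e : ∑ x ∈ Finset.Ico s (s + N),
      ((Finset.Ioo x (f x)).filter fun z => f x < f z ∧ f z < x + N).card =
      {p : ℤ × ℤ | s ≤ p.1 ∧ p.1 < s + N ∧ p.1 < p.2 ∧ p.2 < f p.1 ∧ f p.1 < f p.2 ∧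
        f p.2 < p.1 + N}.ncard := by
    rw [← Finset.card_sigma, ← Set.ncard_coe_finset]
    refine Set.ncard_congr (fun p _ => (p.1, p.2)) ?_ ?_ ?_
    · rintro ⟨x, y⟩ h
      simp only [Finset.coe_sigma, Set.mem_sigma_iff, Finset.mem_coe, Finset.mem_filter,
        Finset.mem_Ico, Finset.mem_Ioo] at h
      simp only [Set.mem_ofPred_eq]
      omega
    · rintro ⟨x, y⟩ ⟨x', y'⟩ _ _ h
      simp only [Prod.mk.injEq] at h
      rw [h.1, h.2]
    · rintro ⟨x, y⟩ h
      refine ⟨⟨x, y⟩, ?_, rfl⟩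
      simp only [Set.mem_ofPred_eq] at h
      simp only [Finset.coe_sigma, Set.mem_sigma_iff, Finset.mem_coe, Finset.mem_filter,
        Finset.mem_Ico, Finset.mem_Ioo]
      omega
  -- For the ends `x < y < f x < f y`, the four sets are distinguished by which end is the first to
  -- reach `s + N`.
  have hU : {p : ℤ × ℤ | s ≤ p.1 ∧ p.1 < s + N ∧ p.1 < p.2 ∧ p.2 < f p.1 ∧ f p.1 < f p.2 ∧
        f p.2 < p.1 + N} = ((P ∪ R '' P) ∪ R '' (R '' P)) ∪ R '' (R '' (R '' P)) := by
    ext ⟨x, y⟩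
    simp only [Set.mem_union, hmem, P, windowCrossings, Set.mem_ofPred_eq, hf.apply_sub]
    have hx := hf x
    have hy := hf y
    have hx' := hf.add_natCast (x - N)
    have hy' := hf.add_natCast (y - N)
    have hfy' := hf.apply_sub y
    rw [sub_add_cancel] at hx' hy'
    constructor
    · rintro ⟨h1, h2, h3, h4, h5, h6⟩
      by_cases h7 : s + N ≤ y
      · right; omega
      by_cases h8 : s + N ≤ f x
      · left; right; omega
      by_cases h9 : s + N ≤ f y
      · left; left; right; omega
      · left; left; left; omega
    · rintro (((h | h) | h) | h) <;> omega
  rw [e, hU, Set.ncard_union_eq _ ((hP.union (hP.image _)).union ((hP.image _).image _))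
    (((hP.image _).image _).image _), Set.ncard_union_eq _ (hP.union (hP.image _))
    ((hP.image _).image _), Set.ncard_union_eq _ hP (hP.image _)]
  · simp only [hR]
    ring
  all_goals
    rw [Set.disjoint_left]
    rintro ⟨x, y⟩
    have hx := hf x
    have hy := hf y
    simp only [Set.mem_union, hmem, P, windowCrossings, Set.mem_ofPred_eq, hf.apply_sub]
    omega

/-- The points strictly between `x` and `f x` are the ends of nested chords, two for each, and one
end of each chord that crosses. -/
theorem innerCount_succ_pred (hf : IsAffineMatching N f) (x : ℤ) :
    2 * (innerCount f (x + 1) (f x - 1) : ℤ) +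
      ((Finset.Ioo x (f x)).filter fun z => f x < f z ∧ f z < x + N).card = f x - x - 1 := by
  have hx := hf x
  have hx' := hf.lt_add x
  have h := hf.two_mul_innerCount (x := x + 1) (y := f x - 1) (by omega) (by omega)
  have e : ((Finset.Icc (x + 1) (f x - 1)).filter fun z => f x - 1 < f z ∧ f z < x + 1 + N) =
      (Finset.Ioo x (f x)).filter fun z => f x < f z ∧ f z < x + N := by
    ext z
    simp only [Finset.mem_filter, Finset.mem_Icc, Finset.mem_Ioo]
    have h1 : z ≠ x → f z ≠ f x := fun h h' => h (hf.injective h')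
    have h2 : f z = x + N → z = f x := fun h' => hf.injective (h'.trans hx.2.symm)
    constructor
    · intro h
      have := h1 (by omega)
      have : f z ≠ x + N := fun h' => by have := h2 h'; omega
      omega
    · omega
  rw [e] at h
  linarith

variable {a b c d : ℤ}

open Classical in
theorem ncard_windowCrossings_eq_sum (hf : IsAffineMatching N f) (s : ℤ) :
    ((windowCrossings N f s).ncard : ℤ) = ∑ x ∈ Finset.Ico s (s + N), ∑ y ∈ Finset.Ico s (s + N),
      if x < y ∧ y < f x ∧ f x < f y ∧ f y < s + N then 1 else 0 := by
  rw [← Finset.sum_product', Finset.sum_boole, ← Set.ncard_coe_finset]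
  congr 2
  ext ⟨x, y⟩
  simp only [windowCrossings, Set.mem_ofPred_eq, Finset.coe_filter, Finset.mem_product,
    Finset.mem_Ico]
  have hx := hf x
  have hy := hf y
  omega

/-- Uncrossing two chords with room for the new chords removes exactly one crossing. -/
theorem ncard_windowCrossings_uncrossing (hf : IsAffineMatching N f) (hab : a < b) (hbc : b < c)
    (hcd : c < d) (hda : d < a + N) (hfa : f a = c) (hfb : f b = d)
    (hroom : ∀ z, b < z → z < c → d < f z → f z < a + N → False) (s t : ℤ) :
    (windowCrossings N f s).ncard = (windowCrossings N (fun z =>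
      affineTransposition N b c (f (affineTransposition N b c z))) t).ncard + 1 := by
  classical
  have hf' := hf.uncrossing hab hbc hcd hda hfa hfb
  set f' : ℤ → ℤ := fun z => affineTransposition N b c (f (affineTransposition N b c z)) with hf'_def
  -- In the window starting at `a` the four ends appear in the order `a < b < c < d`.
  rw [hf.ncard_windowCrossings s a, hf'.ncard_windowCrossings t a]
  have hbc' : ¬ b ≡ c [ZMOD N] := not_modEq hbc (by omega)
  have hfc : f c = a + N := by rw [← hfa, (hf a).2]
  have hfd : f d = b + N := by rw [← hfb, (hf b).2]
  have hTb : affineTransposition N b c b = c := by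
    have := affineTransposition_left (N := N) (a := b) (b := c) 0
    rwa [mul_zero, add_zero, add_zero] at this
  have hTc : affineTransposition N b c c = b := by
    have := affineTransposition_right hbc' 0
    rwa [mul_zero, add_zero, add_zero] at this
  have hTbN : affineTransposition N b c (b + N) = c + N := by
    have := affineTransposition_left (N := N) (a := b) (b := c) 1
    rwa [mul_one] at this
  have hTcN : affineTransposition N b c (c + N) = b + N := by
    have := affineTransposition_right hbc' 1
    rwa [mul_one] at this
  have hfix : ∀ z, z ≠ b → z ≠ c → z ≠ b + N → z ≠ c + N → c - N < z → z < b + N + N →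
      affineTransposition N b c z = z := by
    intro z h1 h2 h3 h4 h5 h6
    refine affineTransposition_of_not ?_ ?_
    · intro h
      rcases lt_trichotomy z (b + N) with h7 | h7 | h7
      · rcases lt_trichotomy z b with h8 | h8 | h8
        · exact not_modEq h8 (by omega) h
        · exact h1 h8
        · exact not_modEq h8 (by omega) h.symm
      · exact h3 h7
      · exact not_modEq h7 (by omega) ((modEq_iff_exists.2 ⟨1, by ring⟩).trans h.symm)
    · intro h
      rcases lt_trichotomy z (c + N) with h7 | h7 | h7
      · rcases lt_trichotomy z c with h8 | h8 | h8
        · exact not_modEq h8 (by omega) h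
        · exact h2 h8
        · exact not_modEq h8 (by omega) h.symm
      · exact h4 h7
      · exact not_modEq h7 (by omega) ((modEq_iff_exists.2 ⟨1, by ring⟩).trans h.symm)
  have ga : f' a = b := by
    simp only [hf'_def]
    rw [hfix a (by omega) (by omega) (by omega) (by omega) (by omega) (by omega), hfa, hTc]
  have gb : f' b = a + N := by
    simp only [hf'_def]
    rw [hTb, hfc, hfix _ (by omega) (by omega) (by omega) (by omega) (by omega) (by omega)]
  have gc : f' c = d := by
    simp only [hf'_def]
    rw [hTc, hfb, hfix _ (by omega) (by omega) (by omega) (by omega) (by omega) (by omega)]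
  have gd : f' d = c + N := by
    simp only [hf'_def]
    rw [hfix d (by omega) (by omega) (by omega) (by omega) (by omega) (by omega), hfd, hTbN]
  have hvals : ∀ z, z ≠ a → z ≠ b → z ≠ c → z ≠ d → a ≤ z → z < a + N →
      f z ≠ b ∧ f z ≠ c ∧ f z ≠ d ∧ f z ≠ a + N := by
    intro z h1 h2 h3 h4 h5 h6
    refine ⟨fun h => ?_, fun h => h1 (hf.injective (h.trans hfa.symm)),
      fun h => h2 (hf.injective (h.trans hfb.symm)),
      fun h => h3 (hf.injective (h.trans hfc.symm))⟩
    have h7 := (hf z).2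
    rw [h] at h7
    omega
  have gz : ∀ z, z ≠ a → z ≠ b → z ≠ c → z ≠ d → a ≤ z → z < a + N → f' z = f z := by
    intro z h1 h2 h3 h4 h5 h6
    have h7 := hvals z h1 h2 h3 h4 h5 h6
    have h8 := hf z
    have h9 := hf.lt_add z
    have h10 : f z ≠ b + N := fun h => h4 (hf.injective (h.trans hfd.symm))
    have h11 : f z ≠ c + N := by
      intro h
      have h12 := h8.2
      rw [h, hf.add_natCast, hfc] at h12
      omega
    simp only [hf'_def]
    rw [hfix z (by omega) (by omega) (by omega) (by omega) (by omega) (by omega),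
      hfix (f z) (by omega) (by omega) (by omega) (by omega) (by omega) (by omega)]
  zify
  rw [hf.ncard_windowCrossings_eq_sum, hf'.ncard_windowCrossings_eq_sum]
  set W := Finset.Ico a (a + N)
  let S : Finset ℤ := {a, b, c, d}
  have hS : S ⊆ W := by
    intro z hz
    simp only [S, Finset.mem_insert, Finset.mem_singleton] at hz
    simp only [W, Finset.mem_Ico]
    omega
  have hsum : ∀ F : ℤ → ℤ, ∑ z ∈ S, F z = F a + F b + F c + F d := by
    intro F
    simp only [S]
    rw [Finset.sum_insert, Finset.sum_insert, Finset.sum_insert, Finset.sum_singleton]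
    · ring
    all_goals simp only [Finset.mem_insert, Finset.mem_singleton]; omega
  have hsplit : ∀ F : ℤ → ℤ → ℤ, ∑ x ∈ W, ∑ y ∈ W, F x y =
      ∑ x ∈ W \ S, ∑ y ∈ W \ S, F x y + ∑ x ∈ W \ S, (∑ y ∈ S, F x y + ∑ y ∈ S, F y x) +
        ∑ x ∈ S, ∑ y ∈ S, F x y := by
    intro F
    rw [Finset.sum_add_distrib, ← Finset.sum_sdiff hS,
      Finset.sum_comm (s := W \ S) (t := S) (f := fun x y => F y x)]
    simp only [← Finset.sum_sdiff hS (f := fun y => F _ y)]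
    rw [Finset.sum_add_distrib, Finset.sum_add_distrib]
    ring
  rw [hsplit, hsplit]
  have h1 : ∀ x ∈ W \ S, x ≠ a ∧ x ≠ b ∧ x ≠ c ∧ x ≠ d ∧ a ≤ x ∧ x < a + N := by
    intro x hx
    simp only [W, S, Finset.mem_sdiff, Finset.mem_Ico, Finset.mem_insert,
      Finset.mem_singleton] at hx
    omega
  have hg : ∀ x ∈ W \ S, f' x = f x := by
    intro x hx
    obtain ⟨h2, h3, h4, h5, h6, h7⟩ := h1 x hx
    exact gz x h2 h3 h4 h5 h6 h7
  have e1 : ∑ x ∈ W \ S, ∑ y ∈ W \ S,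
      (if x < y ∧ y < f x ∧ f x < f y ∧ f y < a + N then (1 : ℤ) else 0) =
      ∑ x ∈ W \ S, ∑ y ∈ W \ S,
      (if x < y ∧ y < f' x ∧ f' x < f' y ∧ f' y < a + N then (1 : ℤ) else 0) := by
    refine Finset.sum_congr rfl fun x hx => Finset.sum_congr rfl fun y hy => ?_
    rw [hg x hx, hg y hy]
  -- A third chord meets the old pair of chords as often as the new pair, unless it joins `(b, c)`
  -- to `(d, a + N)`. `hroom` excludes this case.
  have e2 : ∑ x ∈ W \ S, (∑ y ∈ S,
      (if x < y ∧ y < f x ∧ f x < f y ∧ f y < a + N then (1 : ℤ) else 0) + ∑ y ∈ S,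
      (if y < x ∧ x < f y ∧ f y < f x ∧ f x < a + N then (1 : ℤ) else 0)) =
      ∑ x ∈ W \ S, (∑ y ∈ S,
      (if x < y ∧ y < f' x ∧ f' x < f' y ∧ f' y < a + N then (1 : ℤ) else 0) + ∑ y ∈ S,
      (if y < x ∧ x < f' y ∧ f' y < f' x ∧ f' x < a + N then (1 : ℤ) else 0)) := by
    refine Finset.sum_congr rfl fun x hx => ?_
    rw [hsum, hsum, hsum, hsum, hg x hx, hfa, hfb, hfc, hfd, ga, gb, gc, gd]
    obtain ⟨h2, h3, h4, h5, h6, h7⟩ := h1 x hx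
    obtain ⟨h8, h9, h10, h11⟩ := hvals x h2 h3 h4 h5 h6 h7
    have h12 : ¬ (b < x ∧ x < c ∧ d < f x ∧ f x < a + N) :=
      fun ⟨h1, h2, h3, h4⟩ => hroom x h1 h2 h3 h4
    have h13 := (hf x).1
    clear * - hab hbc hcd hda h2 h3 h4 h5 h6 h7 h8 h9 h10 h11 h12 h13
    generalize f x = v at *
    rw [if_neg (by omega : ¬ (x < a ∧ a < v ∧ v < c ∧ c < a + N)),
      if_neg (by omega : ¬ (x < c ∧ c < v ∧ v < a + N ∧ a + N < a + (N : ℤ))),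
      if_neg (by omega : ¬ (x < d ∧ d < v ∧ v < b + N ∧ b + N < a + (N : ℤ))),
      if_neg (by omega : ¬ (c < x ∧ x < a + N ∧ a + N < v ∧ v < a + (N : ℤ))),
      if_neg (by omega : ¬ (d < x ∧ x < b + N ∧ b + N < v ∧ v < a + (N : ℤ))),
      if_neg (by omega : ¬ (x < a ∧ a < v ∧ v < b ∧ b < a + (N : ℤ))),
      if_neg (by omega : ¬ (x < b ∧ b < v ∧ v < a + N ∧ a + N < a + (N : ℤ))),
      if_neg (by omega : ¬ (x < d ∧ d < v ∧ v < c + N ∧ c + N < a + (N : ℤ))),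
      if_neg (by omega : ¬ (b < x ∧ x < a + N ∧ a + N < v ∧ v < a + (N : ℤ))),
      if_neg (by omega : ¬ (d < x ∧ x < c + N ∧ c + N < v ∧ v < a + (N : ℤ)))]
    split_ifs <;> omega
  -- Among the four ends themselves, the old chords contribute their one crossing and the new chords
  -- none.
  have e3 : ∑ x ∈ S, ∑ y ∈ S,
      (if x < y ∧ y < f x ∧ f x < f y ∧ f y < a + N then (1 : ℤ) else 0) = 1 := by
    simp only [hsum, hfa, hfb, hfc, hfd]
    rw [if_pos (by omega : a < b ∧ b < c ∧ c < d ∧ d < a + (N : ℤ))]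
    repeat rw [if_neg (by omega)]
    rfl
  have e4 : ∑ x ∈ S, ∑ y ∈ S,
      (if x < y ∧ y < f' x ∧ f' x < f' y ∧ f' y < a + N then (1 : ℤ) else 0) = 0 := by
    simp only [hsum, ga, gb, gc, gd]
    repeat rw [if_neg (by omega)]
    rfl
  rw [e1, e2, e3, e4]
  ring

end IsAffineMatching

/-! ### Length and crossings -/

namespace Matching

variable {n : ℕ} [NeZero n]

theorem ncard_windowCrossings_gFun (τ : Matching n) (s : ℤ) :
    (windowCrossings (2 * n) τ.gFun s).ncard = τ.cross := by
  rw [τ.isAffineMatching_gFun.ncard_windowCrossings s 1, cross, ← Set.ncard_coe_finset]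
  have hg : ∀ p : Fin (2 * n), τ.gFun (label p) =
      if p < τ p then label (τ p) else label (τ p) + 2 * n := by
    intro p
    have := gFun_label τ p 0
    rwa [mul_zero, add_zero, add_zero] at this
  symm
  refine Set.ncard_congr (fun p _ => (label p.1, label p.2)) ?_ ?_ ?_
  · rintro ⟨p, q⟩ h
    obtain ⟨h1, h2, h3⟩ := mem_crossingPairs.1 (Finset.mem_coe.1 h)
    simp only at h1 h2 h3
    simp only [windowCrossings, Set.mem_ofPred_eq, hg]
    rw [if_pos (h1.trans h2), if_pos (h2.trans h3)]
    simp only [label, Fin.lt_def] at *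
    have := (τ q).2
    push_cast
    omega
  · rintro ⟨p, q⟩ ⟨p', q'⟩ _ _ h
    simp only [label, Prod.mk.injEq] at h
    simp only [Prod.mk.injEq, Fin.ext_iff]
    omega
  · rintro ⟨x, y⟩ h
    obtain ⟨h1, h2, h3, h4, h5⟩ := h
    simp only at h1 h2 h3 h4 h5
    push_cast at h5
    have h6 := (τ.isAffineMatching_gFun y).1
    obtain ⟨p, rfl⟩ : ∃ p : Fin (2 * n), x = label p :=
      ⟨⟨(x - 1).toNat, by omega⟩, by simp only [label]; omega⟩
    obtain ⟨q, rfl⟩ : ∃ q : Fin (2 * n), y = label q :=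
      ⟨⟨(y - 1).toNat, by omega⟩, by simp only [label]; omega⟩
    refine ⟨(p, q), Finset.mem_coe.2 (mem_crossingPairs.2 ?_), rfl⟩
    rw [hg] at h3 h4
    rw [hg] at h4 h5
    have := p.2
    have := q.2
    simp only [label, Fin.lt_def] at *
    split_ifs at * <;> omega

/-- For an affine matching the condition `y < f y < f x` makes an inversion `(x, y)` a chord nested
strictly inside the one that starts at `x`. -/
theorem length_eq_sum (τ : Matching n) : τ.g.1.length =
    ∑ x ∈ Finset.Icc (1 : ℤ) (2 * n : ℕ), innerCount τ.gFun (x + 1) (τ.gFun x - 1) := by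
  have hf := τ.isAffineMatching_gFun
  simp only [hf.innerCount_eq_card]
  rw [← Finset.card_sigma, ← Set.ncard_coe_finset, AffinePerm.length]
  symm
  refine Set.ncard_congr (fun p _ => (p.1, p.2)) ?_ ?_ ?_
  · rintro ⟨x, y⟩ h
    simp only [Finset.coe_sigma, Set.mem_sigma_iff, Finset.mem_coe, Finset.mem_filter,
      Finset.mem_Icc] at h
    rw [AffinePerm.mem_inversions]
    change 1 ≤ x ∧ x ≤ _ ∧ x < y ∧ τ.gFun y < τ.gFun x
    omega
  · rintro ⟨x, y⟩ ⟨x', y'⟩ _ _ h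
    simp only [Prod.mk.injEq] at h
    rw [h.1, h.2]
  · rintro ⟨x, y⟩ h
    refine ⟨⟨x, y⟩, ?_, rfl⟩
    rw [AffinePerm.mem_inversions] at h
    change 1 ≤ x ∧ x ≤ _ ∧ x < y ∧ τ.gFun y < τ.gFun x at h
    simp only [Finset.coe_sigma, Set.mem_sigma_iff, Finset.mem_coe, Finset.mem_filter,
      Finset.mem_Icc]
    have := hf y
    omega

/-- Summing `innerCount_succ_pred` over a period gives `2ℓ + 4c` on the left and `2n · n - 2n`, that
is `4` times `n.choose 2`, on the right. -/
theorem length_g (τ : Matching n) :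
    (τ.g.1.length : ℤ) = 2 * ((n.choose 2 : ℤ) - (τ.cross : ℤ)) := by
  have hf := τ.isAffineMatching_gFun
  have h1 := hf.sum_card_crossing_eq 1
  rw [τ.ncard_windowCrossings_gFun] at h1
  have hI : Finset.Ico (1 : ℤ) (1 + (2 * n : ℕ)) = Finset.Icc (1 : ℤ) (2 * n : ℕ) := by
    ext z
    simp only [Finset.mem_Ico, Finset.mem_Icc]
    omega
  rw [hI] at h1
  have h2 := Finset.sum_congr (rfl : Finset.Icc (1 : ℤ) (2 * n : ℕ) = _)
    fun x _ => hf.innerCount_succ_pred x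
  rw [Finset.sum_add_distrib, Finset.sum_sub_distrib, τ.gFun_sum, ← Finset.mul_sum,
    ← Nat.cast_sum, ← Nat.cast_sum, h1, ← τ.length_eq_sum] at h2
  simp only [Finset.sum_const, Int.card_Icc, nsmul_eq_mul, mul_one] at h2
  have h3 : (((2 * n : ℕ) : ℤ) + 1 - 1).toNat = 2 * n := by omega
  rw [h3] at h2
  have h4 : 2 * (n.choose 2 : ℤ) = n * (n - 1) := by
    obtain ⟨m, rfl⟩ := Nat.exists_eq_succ_of_ne_zero (NeZero.ne n)
    have h5 : 2 * (m + 1).choose 2 = (m + 1) * m := by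
      rw [Nat.choose_two_right, Nat.add_sub_cancel,
        Nat.mul_div_cancel' (by rw [mul_comm]; exact (Nat.even_mul_succ_self m).two_dvd)]
    push_cast
    rw [add_sub_cancel_right]
    exact_mod_cast h5
  push_cast at h2
  rw [mul_sub] at h4
  linarith

/-! ### The uncrossing order -/

/-- The converse of `exists_lift_of_interlace`: it turns the affine chords found by
`exists_uncrossing` into interlacing chords on the circle, where the topology applies. -/
theorem interlace_of_lift (τ : Matching n) {a b c d : ℤ} (hab : a < b) (hbc : b < c) (hcd : c < d)
    (hda : d < a + (2 * n : ℕ)) (hfa : τ.gFun a = c) (hfb : τ.gFun b = d) :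
    residue n b ≠ residue n c ∧ residue n b ≠ τ (residue n c) ∧
      τ.interlace (residue n b) (residue n c) = 1 := by
  have hfc : τ.gFun c = a + (2 * n : ℕ) := by rw [← hfa, (τ.isAffineMatching_gFun a).2]
  refine ⟨fun h => ?_, fun h => ?_, ?_⟩
  · exact IsAffineMatching.not_modEq hbc (by omega) (residue_eq_iff.1 h)
  · rw [← residue_gFun, hfc] at h
    exact IsAffineMatching.not_modEq (by omega) (by omega) (residue_eq_iff.1 h)
  · rw [interlace_residue _ hbc (by omega) (by omega)]
    left
    omega

/-- A matching with at least as many chords inside each interval lies below in the uncrossing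
order, and has a lensless medial graph. -/
theorem le_of_innerCount_le (τ τ' : Matching n) {G : MedialGraph n} (hG : G.Lensless)
    (hτ : G.Represents τ) (hle : ∀ x y : ℤ, y < x + (2 * n : ℕ) →
      innerCount τ.gFun x y ≤ innerCount τ'.gFun x y) :
    τ' ≤ τ ∧ ∃ G' : MedialGraph n, G'.Lensless ∧ G'.Represents τ' := by
  induction hm : τ.cross generalizing τ G with
  | zero =>
    by_cases hne : τ.gFun = τ'.gFun
    · obtain rfl := gFun_injective hne
      exact ⟨le_rfl, G, hG, hτ⟩
    -- Different matchings would allow removing a crossing, but `τ` has none.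
    · obtain ⟨a, b, c, d, hab, hbc, hcd, hda, hfa, hfb, hroom, -⟩ :=
        τ.isAffineMatching_gFun.exists_uncrossing τ'.isAffineMatching_gFun rfl hne hle
      have := τ.isAffineMatching_gFun.ncard_windowCrossings_uncrossing hab hbc hcd hda hfa hfb
        hroom 1 1
      rw [ncard_windowCrossings_gFun] at this
      omega
  | succ m ih =>
    by_cases hne : τ.gFun = τ'.gFun
    · obtain rfl := gFun_injective hne
      exact ⟨le_rfl, G, hG, hτ⟩
    · obtain ⟨a, b, c, d, hab, hbc, hcd, hda, hfa, hfb, hroom, hlt⟩ :=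
        τ.isAffineMatching_gFun.exists_uncrossing τ'.isAffineMatching_gFun rfl hne hle
      have hcross := τ.isAffineMatching_gFun.ncard_windowCrossings_uncrossing hab hbc hcd hda
        hfa hfb hroom 1 1
      rw [← τ.gFun_conjSwap hab hbc hcd hda hfa hfb, ncard_windowCrossings_gFun,
        ncard_windowCrossings_gFun] at hcross
      obtain ⟨h1, h2, h3⟩ := τ.interlace_of_lift hab hbc hcd hda hfa hfb
      obtain ⟨G₁, h4, h5, h6⟩ := hτ.exists_uncrosses (Nat.pos_of_ne_zero (NeZero.ne n)) hG
        h1 h2 h3 hcross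
      obtain ⟨h7, h8⟩ := ih (τ.conjSwap (residue n b) (residue n c)) h5 h6 (fun x y hxy => by
        rw [τ.gFun_conjSwap hab hbc hcd hda hfa hfb]
        exact τ.isAffineMatching_gFun.innerCount_uncrossing_le τ'.isAffineMatching_gFun rfl
          hab hbc hcd hda hfa hfb hle hlt hxy) (by omega)
      exact ⟨h7.trans (Relation.ReflTransGen.single ⟨G, G₁, hG, hτ, h4, h5, h6⟩), h8⟩

theorem residue_add_one (z : ℤ) : residue n (z + 1) = finRotate _ (residue n z) := by
  have hn : 0 < n := Nat.pos_of_ne_zero (NeZero.ne n)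
  have h := label_residue (n := n) z
  revert h
  generalize residue n z = p
  generalize (z - 1) / (2 * (n : ℤ)) = q
  rintro rfl
  have h1 := finRotate_val _ p
  have hp := p.2
  by_cases h2 : (p : ℕ) + 1 = 2 * n
  · have h3 : (finRotate (2 * n) p : ℕ) = 0 := by rw [h1, if_pos h2]
    have e : label p + 2 * (n : ℤ) * q + 1 = label (finRotate (2 * n) p) + 2 * n * (q + 1) := by
      simp only [label, h3]
      rw [mul_add]
      push_cast
      omega
    rw [e, residue_label]
  · have h3 : (finRotate (2 * n) p : ℕ) = p + 1 := by rw [h1, if_neg h2]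
    have e : label p + 2 * (n : ℤ) * q + 1 = label (finRotate (2 * n) p) + 2 * n * q := by
      simp only [label, h3]
      push_cast
      ring
    rw [e, residue_label]

/-- If the chords at adjacent points cross, then all chords are diameters. -/
theorem gFun_eq_add {τ : Matching n} (h : ∀ i, τ i ≠ finRotate _ i →
    τ.interlace i (finRotate _ i) = 1) (z : ℤ) : τ.gFun z = z + n := by
  have hf := τ.isAffineMatching_gFun
  have hn : 0 < n := Nat.pos_of_ne_zero (NeZero.ne n)
  -- Crossing of the chords at `z` and `z + 1` means that their next partners come in the same
  -- order. If `z` and `z + 1` are matched to each other, the bound is just `z + 1 < τ.gFun (z +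
  -- 1)`.
  have hmono : ∀ z, τ.gFun z + 1 ≤ τ.gFun (z + 1) := by
    intro z
    have h1 := (hf (z + 1)).1
    by_cases h2 : z + 1 = τ.gFun z
    · omega
    · have h3 : τ (residue n z) ≠ finRotate _ (residue n z) := by
        rw [← residue_gFun, ← residue_add_one, Ne, residue_eq_iff]
        intro h3
        have h4 := (hf z).1
        have h5 := hf.lt_add z
        exact IsAffineMatching.not_modEq (by omega) (by omega) h3.symm
      have h4 := h _ h3
      rw [← residue_add_one, τ.interlace_residue (by omega) (by omega) h2] at h4
      have h5 := (hf z).1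
      omega
  have hmono' : Monotone fun z => τ.gFun z - z := by
    refine monotone_int_of_le_succ fun z => ?_
    have := hmono z
    omega
  -- A monotone periodic function is constant; applying `gFun` twice then shows that the constant is
  -- `n`.
  have hconst : ∀ z, τ.gFun (z + 1) - (z + 1) = τ.gFun z - z := by
    intro z
    refine le_antisymm ?_ (hmono' (by omega))
    have h1 : τ.gFun (z + 1) - (z + 1) ≤ τ.gFun (z + (2 * n : ℕ)) - (z + (2 * n : ℕ)) :=
      hmono' (by omega)
    rw [hf.add_natCast] at h1
    omega
  have hzero : ∀ z, τ.gFun z - z = τ.gFun 0 - 0 := by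
    intro z
    induction z using Int.induction_on with
    | zero => rfl
    | succ m ih => rw [hconst, ih]
    | pred m ih =>
      rw [← ih, ← hconst, sub_add_cancel]
  have h1 := hzero z
  have h2 := hzero (τ.gFun z)
  have h3 := (hf z).2
  push_cast at h3
  omega

/-- The matching by diameters has the smallest counts of all, so the descent by uncrossings starting
from its lensless graph reaches every `τ`. -/
theorem exists_lensless (τ : Matching n) :
    ∃ G : MedialGraph n, G.Lensless ∧ G.Represents τ := by
  obtain ⟨τ₀, G, hG, hτ₀, h⟩ :=
    MedialGraph.exists_lensless_adjacent (Nat.pos_of_ne_zero (NeZero.ne n))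
  exact (le_of_innerCount_le τ₀ τ hG hτ₀ fun x y hxy =>
    τ₀.isAffineMatching_gFun.innerCount_le_of_eq_add τ.isAffineMatching_gFun rfl
      (gFun_eq_add h) hxy).2

theorem isCrossingNumber_cross (τ : Matching n) : τ.IsCrossingNumber τ.cross :=
  ⟨τ.exists_lensless, fun _ hG hτ => hτ.crossings_eq (Nat.pos_of_ne_zero (NeZero.ne n)) hG⟩

theorem cross_le_of_le {τ τ' : Matching n} (h : τ ≤ τ') : τ.cross ≤ τ'.cross := by
  have h' : Relation.ReflTransGen UncrossStep τ τ' := h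
  clear h
  induction h' with
  | refl => exact le_rfl
  | tail _ h ih =>
    have := (h.exists_conjSwap (Nat.pos_of_ne_zero (NeZero.ne n))).1
    omega

/-- Every step changes `cross` by exactly one, so there are no nontrivial cycles. -/
theorem le_antisymm_uncrossing {τ τ' : Matching n} (h : τ ≤ τ') (h' : τ' ≤ τ) : τ = τ' := by
  have hr : Relation.ReflTransGen UncrossStep τ τ' := h
  rcases Relation.ReflTransGen.cases_head hr with h1 | ⟨σ, h1, h2⟩
  · exact h1
  · have h3 := (h1.exists_conjSwap (Nat.pos_of_ne_zero (NeZero.ne n))).1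
    have h4 := cross_le_of_le (show σ ≤ τ' from h2)
    have h5 := cross_le_of_le h'
    omega

theorem g_le_of_le {τ τ' : Matching n} (h : τ' ≤ τ) : τ.g ≤ τ'.g := by
  have hr : Relation.ReflTransGen UncrossStep τ' τ := h
  clear h
  induction hr with
  | refl => exact le_rfl
  | @tail σ ρ _ h ih =>
    refine le_trans ?_ ih
    obtain ⟨-, β, γ, h1, h2, h3, rfl⟩ := h.exists_conjSwap (Nat.pos_of_ne_zero (NeZero.ne n))
    obtain ⟨a, b, c, d, hab, hbc, hcd, hda, hfa, hfb, he⟩ := ρ.exists_lift_of_interlace h1 h2 h3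
    rw [he]
    exact ρ.g_le_conjSwap hab hbc hcd hda hfa hfb

theorem g_injective : Function.Injective (g : Matching n → BoundedAffinePerm n (2 * n)) := by
  intro τ τ' h
  refine gFun_injective ?_
  exact congrArg (fun f : BoundedAffinePerm n (2 * n) => (f.1 : ℤ → ℤ)) h

end Matching

theorem theorem3p9 (n : ℕ) [NeZero n] :
    (∀ τ : Matching n, ∃ c : ℕ, τ.IsCrossingNumber c ∧
      (τ.g.1.length : ℤ) = 2 * ((n.choose 2 : ℤ) - (c : ℤ))) ∧
    (∀ τ τ' : Matching n, τ ≤ τ' → τ' ≤ τ → τ = τ') ∧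
    Function.Injective (Matching.g : Matching n → BoundedAffinePerm n (2 * n)) ∧
    ∀ τ τ' : Matching n, τ.g ≤ τ'.g ↔ τ' ≤ τ := by
  refine ⟨fun τ => ⟨τ.cross, τ.isCrossingNumber_cross, τ.length_g⟩,
    fun τ τ' => Matching.le_antisymm_uncrossing, Matching.g_injective,
    fun τ τ' => ⟨fun h => ?_, Matching.g_le_of_le⟩⟩
  -- Bruhat order is used only through the counts; the descent starts from any lensless graph of
  -- `τ`.
  obtain ⟨G, hG, hτ⟩ := τ.exists_lensless
  exact (Matching.le_of_innerCount_le τ τ' hG hτ fun x y _ =>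
    AffinePerm.innerCount_le_of_le τ.isAffineMatching_gFun.pos
      (show τ.g.1 ≤ τ'.g.1 from h) x y).1
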